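/- Let $\Bbbk$ be a field, $H$ a Hopf algebra over $\Bbbk$ with bijective antipode $S$, and $A$ a right $H$-comodule algebra with coaction $\Delta_A\colon A\to A\otimes H$ and coinvariant subalgebra $B=\{a\in A\mid\Delta_A(a)=a\otimes 1\}$. Assume that $B\subseteq A$ is a quantum principal bundle: the map $A\otimes_BA\to A\otimes H$, $a\otimes_B a'\mapsto a\Delta_A(a')$, is bijective and $A$ is a faithfully flat right $B$-module. A differential calculus on an algebra $C$ is a differential graded algebra $\Omega^\bullet(C)=\bigoplus_{n\ge0}\Omega^n(C)$ with $\Omega^0(C)=C$ and $\Omega^n(C)=\mathrm{span}_\Bbbk\{c^0\mathrm{d}c^1\wedge\dots\wedge\mathrm{d}c^n\}$. Let $\Omega^\bullet(H)$ be the maximal prolongation of a bicovariant first order differential calculus on $H$, that is, every differential calculus on $H$ with the same first order part is a quotient of it. Let $\Omega^\bullet(A)$ be a complete differential calculus on $A$: $\Delta_A$ extends to a (necessarily unique) morphism $\Delta_A^\bullet\colon\Omega^\bullet(A)\to\Omega^\bullet(A)\otimes\Omega^\bullet(H)$, $\Delta_A^\bullet(\omega)=\omega_{[0]}\otimes\omega_{[1]}$,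 of differential graded algebras, where tensor products of graded algebras carry the multiplication with Koszul signs. Let $\Omega^\bullet(B)=\{\omega\in\Omega^\bullet(A)\mid\Delta_A^\bullet(\omega)=\omega\otimes1\}$. Then the following holds. (1) The Hopf algebra structure of $H$ extends to a differential graded Hopf algebra structure $(\Delta^\bullet,\varepsilon^\bullet,S^\bullet)$ on $\Omega^\bullet(H)$, where $\Delta^\bullet(\omega)=\omega_{[1]}\otimes\omega_{[2]}$ is a morphism of differential graded algebras, $\varepsilon^\bullet$ vanishes in positive degrees, and $S^\bullet$ is the graded antipode: $S^\bullet(\omega_{[1]})\wedge\omega_{[2]}=\varepsilon^\bullet(\omega)1=\omega_{[1]}\wedge S^\bullet(\omega_{[2]})$. The statements below hold for every such extension. (2) The map $\chi^\bullet\colon\Omega^\bullet(A)\otimes_{\Omega^\bullet(B)}\Omega^\bullet(A)\to\Omega^\bullet(A)\otimes\Omega^\bullet(H)$, $\omega\otimes\eta\mapsto\omega\wedge\Delta_A^\bullet(\eta)$, is bijective. Write $\tau^\bullet(\omega)=(\chi^\bullet)^{-1}(1\otimes\omega)=\omega^{\langle1\rangle}\otimes_{\Omega^\bullet(B)}\omega^{\langle2\rangle}$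 for $\omega\in\Omega^\bullet(H)$ (the graded translation map). (3) Let $\mathfrak{Gau}^\bullet(B,A)$ be the set of $\Bbbk$-linear maps $f^\bullet\colon\Omega^\bullet(H)\to\Omega^\bullet(A)$ of degree zero such that: there is a $\Bbbk$-linear map $\bar f^\bullet\colon\Omega^\bullet(H)\to\Omega^\bullet(A)$ of degree zero with $f^\bullet(\omega_{[1]})\bar f^\bullet(\omega_{[2]})=\varepsilon^\bullet(\omega)1=\bar f^\bullet(\omega_{[1]})f^\bullet(\omega_{[2]})$; $f^\bullet(1)=1$; and $\Delta_A^\bullet\circ f^\bullet=(f^\bullet\otimes\mathrm{id})\circ\mathrm{Ad}^\bullet$, where $\mathrm{Ad}^\bullet(\omega)=(-1)^{|\omega_{[1]}||\omega_{[2]}|}\omega_{[2]}\otimes S^\bullet(\omega_{[1]})\wedge\omega_{[3]}$. Let $\mathfrak{aut}_v^\bullet(B,A)$ be the set of bijective $\Bbbk$-linear maps $F^\bullet\colon\Omega^\bullet(A)\to\Omega^\bullet(A)$ of degree zero which are left $\Omega^\bullet(B)$-linear, satisfy $F^\bullet(1)=1$, and satisfy $\Delta_A^\bullet\circ F^\bullet=(F^\bullet\otimes\mathrm{id})\circ\Delta_A^\bullet$.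 Then $\mathfrak{Gau}^\bullet(B,A)$ is a group under the convolution product $(f*g)(\omega)=f(\omega_{[1]})g(\omega_{[2]})$ with unit $\omega\mapsto\varepsilon^\bullet(\omega)1$, the set $\mathfrak{aut}_v^\bullet(B,A)$ is a group under the opposite composition $(F,G)\mapsto G\circ F$ with unit $\mathrm{id}$, and $$\theta^\bullet\colon\mathfrak{Gau}^\bullet(B,A)\to\mathfrak{aut}_v^\bullet(B,A),\qquad\theta^\bullet(f^\bullet)(\omega)=\omega_{[0]}\wedge f^\bullet(\omega_{[1]}),$$ is a group isomorphism with inverse $$(\theta^\bullet)^{-1}(F^\bullet)(\omega)=\omega^{\langle1\rangle}\wedge F^\bullet(\omega^{\langle2\rangle}).$$ -/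

import Mathlib

open scoped TensorProduct

noncomputable section

universe v

/-! ### Balanced tensor products, faithful flatness -/

section Balanced

variable {k R : Type*} [Field k] [Ring R] [Algebra k R]

/-- The relations `(r * b) ⊗ m = r ⊗ (b • m)` that define `R ⊗_B M`. -/
def balancedRel (B : Subalgebra k R) (M : Type*) [AddCommGroup M] [Module k M] [Module B M]
    [IsScalarTower k B M] : Submodule k (R ⊗[k] M) :=
  Submodule.span k {t | ∃ (r : R) (b : B) (m : M),
    t = (r * (b : R)) ⊗ₜ[k] m - r ⊗ₜ[k] (b • m)}

/-- The tensor product `R ⊗_B M` of the right `B`-module `R` with a left `B`-module `M`, where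
`B` is a (not necessarily commutative) subalgebra of `R`. -/
abbrev BalancedTensor (B : Subalgebra k R) (M : Type*) [AddCommGroup M] [Module k M] [Module B M]
    [IsScalarTower k B M] : Type _ :=
  (R ⊗[k] M) ⧸ balancedRel B M

/-- The map `id ⊗_B f : R ⊗_B M → R ⊗_B N` induced by a left `B`-linear map `f`. -/
def BalancedTensor.map (B : Subalgebra k R) {M N : Type*}
    [AddCommGroup M] [Module k M] [Module B M] [IsScalarTower k B M]
    [AddCommGroup N] [Module k N] [Module B N] [IsScalarTower k B N] (f : M →ₗ[B] N) :
    BalancedTensor B M →ₗ[k] BalancedTensor B N :=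
  Submodule.mapQ (balancedRel B M) (balancedRel B N)
    (TensorProduct.map LinearMap.id (f.restrictScalars k)) (by
      rw [balancedRel, Submodule.span_le]
      rintro _ ⟨r, b, m, rfl⟩
      refine Submodule.subset_span ⟨r, b, f m, ?_⟩
      simp)

/-- `R` is a faithfully flat right `B`-module: the functor `R ⊗_B -` on left `B`-modules is exact
and reflects exactness. (Each left `B`-module carries exactly one compatible `k`-structure.) -/
def IsFaithfullyFlatRight {k : Type*} {R : Type v} [Field k] [Ring R] [Algebra k R]
    (B : Subalgebra k R) : Prop :=
  ∀ (M N P : Type v)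
    [AddCommGroup M] [Module k M] [Module B M] [IsScalarTower k B M]
    [AddCommGroup N] [Module k N] [Module B N] [IsScalarTower k B N]
    [AddCommGroup P] [Module k P] [Module B P] [IsScalarTower k B P]
    (f : M →ₗ[B] N) (g : N →ₗ[B] P),
    Function.Exact f g ↔
      Function.Exact (BalancedTensor.map B f) (BalancedTensor.map B g)

/-- For algebra morphisms `δ, j : R → T` and the subalgebra `B = {b | δ b = j b}`, the map
`R ⊗_B R → T`, `x ⊗ y ↦ j x * δ y`. With `δ` a coaction and `j x = x ⊗ 1`, the algebra `B` is that
of the coinvariants and this is the canonical (Galois) map `x ⊗ y ↦ x δ(y)`. -/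
def galoisMap {T : Type*} [Ring T] [Algebra k T] (δ j : R →ₐ[k] T) :
    BalancedTensor (AlgHom.equalizer δ j) R →ₗ[k] T :=
  Submodule.liftQ (balancedRel (AlgHom.equalizer δ j) R)
    (LinearMap.mul' k T ∘ₗ TensorProduct.map j.toLinearMap δ.toLinearMap) (by
      rw [balancedRel, Submodule.span_le]
      rintro _ ⟨r, ⟨b, hb⟩, m, rfl⟩
      have hb' : δ b = j b := hb
      simp [Subalgebra.smul_def, hb', mul_assoc])

/-- For a left `B`-linear map `F : R → R`, the map `R ⊗_B R → R`, `x ⊗ y ↦ x * F y`. -/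
def BalancedTensor.mulMap (B : Subalgebra k R) (F : R →ₗ[k] R)
    (hF : ∀ b ∈ B, ∀ x, F (b * x) = b * F x) : BalancedTensor B R →ₗ[k] R :=
  Submodule.liftQ (balancedRel B R)
    (LinearMap.mul' k R ∘ₗ TensorProduct.map LinearMap.id F) (by
      rw [balancedRel, Submodule.span_le]
      rintro _ ⟨r, ⟨b, hb⟩, m, rfl⟩
      simp [Subalgebra.smul_def, hF b hb, mul_assoc])

end Balanced

/-! ### Quantum principal bundles -/

/-- A right coaction of the Hopf algebra `H` on `A` which makes `A` a right `H`-comodule algebra. -/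
structure RightComoduleAlgebra (k H A : Type*) [Field k] [Ring H] [HopfAlgebra k H]
    [Ring A] [Algebra k A] where
  coact : A →ₐ[k] A ⊗[k] H
  coassoc : (TensorProduct.assoc k A H H).toLinearMap ∘ₗ
      TensorProduct.map coact.toLinearMap LinearMap.id ∘ₗ coact.toLinearMap =
    TensorProduct.map LinearMap.id Coalgebra.comul ∘ₗ coact.toLinearMap
  counit : (TensorProduct.rid k A).toLinearMap ∘ₗ
      TensorProduct.map LinearMap.id Coalgebra.counit ∘ₗ coact.toLinearMap = LinearMap.id

namespace RightComoduleAlgebra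

variable {k H A : Type*} [Field k] [Ring H] [HopfAlgebra k H] [Ring A] [Algebra k A]

/-- The subalgebra `B = {b | Δ_A b = b ⊗ 1}` of coinvariants. -/
abbrev coinvariants (δ : RightComoduleAlgebra k H A) : Subalgebra k A :=
  AlgHom.equalizer δ.coact Algebra.TensorProduct.includeLeft

/-- `B ⊆ A` is a quantum principal bundle: the Galois map `A ⊗_B A → A ⊗ H` is bijective, and `A`
is a faithfully flat right `B`-module. -/
structure IsQuantumPrincipalBundle (δ : RightComoduleAlgebra k H A) : Prop where
  galois : Function.Bijective
    (galoisMap δ.coact (Algebra.TensorProduct.includeLeft : A →ₐ[k] A ⊗[k] H))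
  faithfullyFlat : IsFaithfullyFlatRight δ.coinvariants

end RightComoduleAlgebra

/-! ### Differential calculi -/

/-- A differential calculus on the algebra `A`: a differential graded algebra `Ω = ⨁ gr n` with
`gr 0 = A` (through `incl`) and `gr n` spanned by the `a⁰ da¹ ⋯ daⁿ`. -/
structure DifferentialCalculus (k A : Type*) {Ω : Type*} [Field k] [Ring A] [Algebra k A]
    [Ring Ω] [Algebra k Ω] (gr : ℕ → Submodule k Ω) [GradedAlgebra gr] where
  incl : A →ₐ[k] Ω
  incl_injective : Function.Injective incl
  range_incl : LinearMap.range incl.toLinearMap = gr 0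
  d : Ω →ₗ[k] Ω
  d_mem : ∀ (n : ℕ) (ω : Ω), ω ∈ gr n → d ω ∈ gr (n + 1)
  d_d : ∀ ω : Ω, d (d ω) = 0
  leibniz : ∀ (n : ℕ) (ω η : Ω), ω ∈ gr n →
    d (ω * η) = d ω * η + (-1 : k) ^ n • (ω * d η)
  gr_eq_span : ∀ n : ℕ, gr n = Submodule.span k
    {ω | ∃ (a₀ : A) (a : Fin n → A),
      ω = incl a₀ * (List.ofFn fun i => d (incl (a i))).prod}

section Graded

variable {k Ω Ω' : Type*} [Field k] [Ring Ω] [Algebra k Ω] [Ring Ω'] [Algebra k Ω']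

/-- The `k`-linear map `ω ↦ (-1)^|ω| ω`. -/
def degreeSign (gr : ℕ → Submodule k Ω) [GradedAlgebra gr] : Ω →ₗ[k] Ω :=
  DirectSum.toModule k ℕ Ω (fun n => (-1 : k) ^ n • (gr n).subtype) ∘ₗ
    (DirectSum.decomposeLinearEquiv gr).toLinearMap

/-- The degree `n` part of the tensor product of two graded algebras. -/
def tensorGr (gr : ℕ → Submodule k Ω) [GradedAlgebra gr]
    (gr' : ℕ → Submodule k Ω') [GradedAlgebra gr'] (n : ℕ) : Submodule k (gr ᵍ⊗[k] gr') :=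
  Submodule.span k {t | ∃ (i j : ℕ) (a : Ω) (b : Ω'), i + j = n ∧ a ∈ gr i ∧ b ∈ gr' j ∧
    t = GradedTensorProduct.tmul k a b}

/-- The differential `ω ⊗ η ↦ dω ⊗ η + (-1)^|ω| ω ⊗ dη` of the tensor product. -/
def tensorD (gr : ℕ → Submodule k Ω) [GradedAlgebra gr]
    (gr' : ℕ → Submodule k Ω') [GradedAlgebra gr'] (d : Ω →ₗ[k] Ω) (d' : Ω' →ₗ[k] Ω') :
    (gr ᵍ⊗[k] gr') →ₗ[k] (gr ᵍ⊗[k] gr') :=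
  (GradedTensorProduct.of k gr gr').toLinearMap ∘ₗ
    (TensorProduct.map d LinearMap.id + TensorProduct.map (degreeSign gr) d') ∘ₗ
    (GradedTensorProduct.of k gr gr').symm.toLinearMap

/-- A map into the graded tensor product, as a linear map into the underlying tensor product. -/
def toTensor {X : Type*} [AddCommGroup X] [Module k X]
    {gr : ℕ → Submodule k Ω} [GradedAlgebra gr] {gr' : ℕ → Submodule k Ω'} [GradedAlgebra gr']
    (φ : X →ₗ[k] gr ᵍ⊗[k] gr') : X →ₗ[k] Ω ⊗[k] Ω' :=
  (GradedTensorProduct.of k gr gr').symm.toLinearMap ∘ₗ φ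

/-- The graded flip `ω ⊗ η ↦ (-1)^{|ω||η|} η ⊗ ω`. -/
def gradedFlip (gr : ℕ → Submodule k Ω) [GradedAlgebra gr]
    (gr' : ℕ → Submodule k Ω') [GradedAlgebra gr'] : Ω ⊗[k] Ω' →ₗ[k] Ω' ⊗[k] Ω :=
  (GradedTensorProduct.of k gr' gr).symm.toLinearMap ∘ₗ
    (GradedTensorProduct.comm gr gr').toLinearMap ∘ₗ
    (GradedTensorProduct.of k gr gr').toLinearMap

end Graded

namespace DifferentialCalculus

section Maximal

variable {k A : Type*} {Ω : Type v} {Ω' : Type*} [Field k] [Ring A] [Algebra k A]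
  [Ring Ω] [Algebra k Ω] {gr : ℕ → Submodule k Ω} [GradedAlgebra gr]
  [Ring Ω'] [Algebra k Ω'] {gr' : ℕ → Submodule k Ω'} [GradedAlgebra gr']

/-- Two calculi on `A` have the same truncation `(Ω¹(A), d)`, up to isomorphism. A linear bijection
with `a db ↦ a d'b` is automatically an isomorphism of bimodules which intertwines `d` and `d'`. -/
def SameFirstOrder (C : DifferentialCalculus k A gr) (C' : DifferentialCalculus k A gr') : Prop :=
  ∃ e : gr 1 ≃ₗ[k] gr' 1, ∀ (a b : A) (γ : gr 1),
    (γ : Ω) = C.incl a * C.d (C.incl b) → (e γ : Ω') = C'.incl a * C'.d (C'.incl b)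

/-- `Ω` is the maximal prolongation of its truncation `(Ω¹(A), d)`: each calculus on `A` which
extends the same first order calculus is a quotient of `Ω` as a differential calculus. -/
def IsMaximalProlongation (C : DifferentialCalculus k A gr) : Prop :=
  ∀ (Ω' : Type v) [Ring Ω'] [Algebra k Ω'] (gr' : ℕ → Submodule k Ω') [GradedAlgebra gr']
    (C' : DifferentialCalculus k A gr'), C.SameFirstOrder C' →
    ∃ φ : Ω →ₐ[k] Ω', (∀ n, ∀ ω ∈ gr n, φ ω ∈ gr' n) ∧ (∀ ω, φ (C.d ω) = C'.d (φ ω)) ∧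
      (∀ a, φ (C.incl a) = C'.incl a) ∧ Function.Surjective φ

end Maximal

section Covariant

variable {k H Ω : Type*} [Field k] [Ring H] [HopfAlgebra k H] [Ring Ω] [Algebra k Ω]
  {gr : ℕ → Submodule k Ω} [GradedAlgebra gr]

/-- The first order calculus `(Ω¹(H), d)` is left covariant: there is a left `H`-coaction `coact`
on `Ω¹(H)` with `coact (a γ b) = Δ(a) coact(γ) Δ(b)` and `coact ∘ d = (id ⊗ d) ∘ Δ`. The last two
equations are written in the algebra `H ⊗ Ω`, which contains `H ⊗ H` and `H ⊗ Ω¹(H)`. -/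
def IsLeftCovariant (C : DifferentialCalculus k H gr) : Prop :=
  ∃ coact : gr 1 →ₗ[k] H ⊗[k] gr 1,
    (TensorProduct.assoc k H H (gr 1)).toLinearMap ∘ₗ
        TensorProduct.map Coalgebra.comul LinearMap.id ∘ₗ coact =
      TensorProduct.map LinearMap.id coact ∘ₗ coact ∧
    (TensorProduct.lid k (gr 1)).toLinearMap ∘ₗ
        TensorProduct.map Coalgebra.counit LinearMap.id ∘ₗ coact = LinearMap.id ∧
    (∀ (a b : H) (γ γ' : gr 1), (γ' : Ω) = C.incl a * γ * C.incl b →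
      TensorProduct.map LinearMap.id (gr 1).subtype (coact γ') =
        TensorProduct.map LinearMap.id C.incl.toLinearMap (Coalgebra.comul (R := k) a) *
          TensorProduct.map LinearMap.id (gr 1).subtype (coact γ) *
          TensorProduct.map LinearMap.id C.incl.toLinearMap (Coalgebra.comul (R := k) b)) ∧
    (∀ (h : H) (γ : gr 1), (γ : Ω) = C.d (C.incl h) →
      TensorProduct.map LinearMap.id (gr 1).subtype (coact γ) =
        TensorProduct.map LinearMap.id (C.d ∘ₗ C.incl.toLinearMap) (Coalgebra.comul (R := k) h))

/-- The first order calculus `(Ω¹(H), d)` is right covariant. -/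
def IsRightCovariant (C : DifferentialCalculus k H gr) : Prop :=
  ∃ coact : gr 1 →ₗ[k] gr 1 ⊗[k] H,
    (TensorProduct.assoc k (gr 1) H H).toLinearMap ∘ₗ
        TensorProduct.map coact LinearMap.id ∘ₗ coact =
      TensorProduct.map LinearMap.id Coalgebra.comul ∘ₗ coact ∧
    (TensorProduct.rid k (gr 1)).toLinearMap ∘ₗ
        TensorProduct.map LinearMap.id Coalgebra.counit ∘ₗ coact = LinearMap.id ∧
    (∀ (a b : H) (γ γ' : gr 1), (γ' : Ω) = C.incl a * γ * C.incl b →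
      TensorProduct.map (gr 1).subtype LinearMap.id (coact γ') =
        TensorProduct.map C.incl.toLinearMap LinearMap.id (Coalgebra.comul (R := k) a) *
          TensorProduct.map (gr 1).subtype LinearMap.id (coact γ) *
          TensorProduct.map C.incl.toLinearMap LinearMap.id (Coalgebra.comul (R := k) b)) ∧
    (∀ (h : H) (γ : gr 1), (γ : Ω) = C.d (C.incl h) →
      TensorProduct.map (gr 1).subtype LinearMap.id (coact γ) =
        TensorProduct.map (C.d ∘ₗ C.incl.toLinearMap) LinearMap.id (Coalgebra.comul (R := k) h))

/-- The first order calculus `(Ω¹(H), d)` is bicovariant. (The two coactions are unique, and they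
commute because they do so on the forms `a db`.) -/
def IsBicovariant (C : DifferentialCalculus k H gr) : Prop :=
  C.IsLeftCovariant ∧ C.IsRightCovariant

/-- A differential graded Hopf algebra structure on `Ω(H)` which extends the Hopf algebra `H`. -/
structure HopfExtension (C : DifferentialCalculus k H gr) where
  comul : Ω →ₐ[k] gr ᵍ⊗[k] gr
  comul_mem : ∀ (n : ℕ) (ω : Ω), ω ∈ gr n → comul ω ∈ tensorGr gr gr n
  comul_d : ∀ ω : Ω, comul (C.d ω) = tensorD gr gr C.d C.d (comul ω)
  comul_incl : ∀ h : H, toTensor comul.toLinearMap (C.incl h) =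
    TensorProduct.map C.incl.toLinearMap C.incl.toLinearMap (Coalgebra.comul (R := k) h)
  counit : Ω →ₐ[k] k
  counit_incl : ∀ h : H, counit (C.incl h) = Coalgebra.counit h
  counit_eq_zero : ∀ (n : ℕ) (ω : Ω), 0 < n → ω ∈ gr n → counit ω = 0
  coassoc : (TensorProduct.assoc k Ω Ω Ω).toLinearMap ∘ₗ
      TensorProduct.map (toTensor comul.toLinearMap) LinearMap.id ∘ₗ toTensor comul.toLinearMap =
    TensorProduct.map LinearMap.id (toTensor comul.toLinearMap) ∘ₗ toTensor comul.toLinearMap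
  counit_comul : (TensorProduct.lid k Ω).toLinearMap ∘ₗ
    TensorProduct.map counit.toLinearMap LinearMap.id ∘ₗ toTensor comul.toLinearMap = LinearMap.id
  comul_counit : (TensorProduct.rid k Ω).toLinearMap ∘ₗ
    TensorProduct.map LinearMap.id counit.toLinearMap ∘ₗ toTensor comul.toLinearMap = LinearMap.id
  antipode : Ω →ₗ[k] Ω
  antipode_mem : ∀ (n : ℕ) (ω : Ω), ω ∈ gr n → antipode ω ∈ gr n
  antipode_incl : ∀ h : H, antipode (C.incl h) = C.incl (HopfAlgebra.antipode k h)
  antipode_mul : LinearMap.mul' k Ω ∘ₗ TensorProduct.map antipode LinearMap.id ∘ₗ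
    toTensor comul.toLinearMap = Algebra.linearMap k Ω ∘ₗ counit.toLinearMap
  mul_antipode : LinearMap.mul' k Ω ∘ₗ TensorProduct.map LinearMap.id antipode ∘ₗ
    toTensor comul.toLinearMap = Algebra.linearMap k Ω ∘ₗ counit.toLinearMap

namespace HopfExtension

variable {C : DifferentialCalculus k H gr}

/-- The graded adjoint coaction `ω ↦ (-1)^{|ω₁||ω₂|} ω₂ ⊗ S(ω₁) ω₃`. -/
def adjoint (E : C.HopfExtension) : Ω →ₗ[k] Ω ⊗[k] Ω :=
  TensorProduct.map LinearMap.id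
      (LinearMap.mul' k Ω ∘ₗ TensorProduct.map E.antipode LinearMap.id) ∘ₗ
    (TensorProduct.assoc k Ω Ω Ω).toLinearMap ∘ₗ
    TensorProduct.map (gradedFlip gr gr) LinearMap.id ∘ₗ
    TensorProduct.map (toTensor E.comul.toLinearMap) LinearMap.id ∘ₗ
    toTensor E.comul.toLinearMap

/-- The convolution product `ω ↦ f(ω₁) g(ω₂)`. -/
def conv {X : Type*} [Ring X] [Algebra k X] (E : C.HopfExtension) (f g : Ω →ₗ[k] X) :
    Ω →ₗ[k] X :=
  LinearMap.mul' k X ∘ₗ TensorProduct.map f g ∘ₗ toTensor E.comul.toLinearMap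

/-- The convolution unit `ω ↦ ε(ω) 1`. -/
def convOne {X : Type*} [Ring X] [Algebra k X] (E : C.HopfExtension) : Ω →ₗ[k] X :=
  Algebra.linearMap k X ∘ₗ E.counit.toLinearMap

end HopfExtension

end Covariant

end DifferentialCalculus

/-! ### Complete calculi, graded gauge transformations, graded vertical automorphisms -/

section Complete

variable {k H A ΩH ΩA : Type*} [Field k] [Ring H] [HopfAlgebra k H] [Ring A] [Algebra k A]
  [Ring ΩH] [Algebra k ΩH] {grH : ℕ → Submodule k ΩH} [GradedAlgebra grH]
  [Ring ΩA] [Algebra k ΩA] {grA : ℕ → Submodule k ΩA} [GradedAlgebra grA]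

/-- The calculus `Ω(A)` is complete: the coaction `Δ_A : A → A ⊗ H` extends to a (necessarily
unique) morphism `Ω(A) → Ω(A) ⊗ Ω(H)` of differential graded algebras. -/
structure CompleteCalculus (δ : RightComoduleAlgebra k H A)
    (CH : DifferentialCalculus k H grH) (CA : DifferentialCalculus k A grA) where
  coact : ΩA →ₐ[k] grA ᵍ⊗[k] grH
  coact_mem : ∀ (n : ℕ) (ω : ΩA), ω ∈ grA n → coact ω ∈ tensorGr grA grH n
  coact_d : ∀ ω : ΩA, coact (CA.d ω) = tensorD grA grH CA.d CH.d (coact ω)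
  coact_incl : ∀ a : A, toTensor coact.toLinearMap (CA.incl a) =
    TensorProduct.map CA.incl.toLinearMap CH.incl.toLinearMap (δ.coact a)

namespace CompleteCalculus

variable {δ : RightComoduleAlgebra k H A}
  {CH : DifferentialCalculus k H grH} {CA : DifferentialCalculus k A grA}

/-- The basic forms `Ω(B) = {ω | Δ_A ω = ω ⊗ 1}`. -/
abbrev basicForms (K : CompleteCalculus δ CH CA) : Subalgebra k ΩA :=
  AlgHom.equalizer K.coact (GradedTensorProduct.includeLeft grA grH)

/-- The graded Galois map `Ω(A) ⊗_{Ω(B)} Ω(A) → Ω(A) ⊗ Ω(H)`, `ω ⊗ η ↦ ω Δ_A(η)`. -/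
def gradedGalois (K : CompleteCalculus δ CH CA) :
    BalancedTensor K.basicForms ΩA →ₗ[k] grA ᵍ⊗[k] grH :=
  galoisMap K.coact (GradedTensorProduct.includeLeft grA grH)

/-- The graded translation map `ω ↦ χ⁻¹(1 ⊗ ω)`. -/
def translation (K : CompleteCalculus δ CH CA) (hχ : Function.Bijective K.gradedGalois) :
    ΩH →ₗ[k] BalancedTensor K.basicForms ΩA :=
  (LinearEquiv.ofBijective K.gradedGalois hχ).symm.toLinearMap ∘ₗ
    (GradedTensorProduct.includeRight grA grH).toLinearMap

/-- `f` is a graded gauge transformation. -/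
structure IsGradedGauge (K : CompleteCalculus δ CH CA) (E : CH.HopfExtension)
    (f : ΩH →ₗ[k] ΩA) : Prop where
  degree_zero : ∀ (n : ℕ) (ω : ΩH), ω ∈ grH n → f ω ∈ grA n
  conv_invertible : ∃ g : ΩH →ₗ[k] ΩA, (∀ (n : ℕ) (ω : ΩH), ω ∈ grH n → g ω ∈ grA n) ∧
    E.conv f g = E.convOne ∧ E.conv g f = E.convOne
  unital : f 1 = 1
  colinear : toTensor K.coact.toLinearMap ∘ₗ f =
    TensorProduct.map f LinearMap.id ∘ₗ E.adjoint

/-- The graded gauge transformations `Gau(B, A)`. -/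
def GradedGauge (K : CompleteCalculus δ CH CA) (E : CH.HopfExtension) : Type _ :=
  {f : ΩH →ₗ[k] ΩA // K.IsGradedGauge E f}

/-- `F` is a graded vertical automorphism. -/
structure IsGradedVertical (K : CompleteCalculus δ CH CA) (F : ΩA →ₗ[k] ΩA) : Prop where
  degree_zero : ∀ (n : ℕ) (ω : ΩA), ω ∈ grA n → F ω ∈ grA n
  left_linear : ∀ b ∈ K.basicForms, ∀ ω : ΩA, F (b * ω) = b * F ω
  bijective : Function.Bijective F
  unital : F 1 = 1
  colinear : toTensor K.coact.toLinearMap ∘ₗ F =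
    TensorProduct.map F LinearMap.id ∘ₗ toTensor K.coact.toLinearMap

/-- The graded vertical automorphisms `aut_v(B, A)`. -/
def GradedVertical (K : CompleteCalculus δ CH CA) : Type _ :=
  {F : ΩA →ₗ[k] ΩA // K.IsGradedVertical F}

/-- The map `ω ↦ ω₀ f(ω₁)` on `Ω(A)`, where `Δ_A ω = ω₀ ⊗ ω₁`. -/
def verticalOfGauge (K : CompleteCalculus δ CH CA) (f : ΩH →ₗ[k] ΩA) : ΩA →ₗ[k] ΩA :=
  LinearMap.mul' k ΩA ∘ₗ TensorProduct.map LinearMap.id f ∘ₗ toTensor K.coact.toLinearMap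

/-- The map `ω ↦ τ(ω)⁽¹⁾ F(τ(ω)⁽²⁾)` on `Ω(H)`, where `τ` is the graded translation map. -/
def gaugeOfVertical (K : CompleteCalculus δ CH CA) (hχ : Function.Bijective K.gradedGalois)
    (F : K.GradedVertical) : ΩH →ₗ[k] ΩA :=
  BalancedTensor.mulMap K.basicForms F.1 F.2.left_linear ∘ₗ K.translation hχ

end CompleteCalculus

end Complete

end

open scoped TensorProduct

noncomputable section

universe v w w' u

/-! ### Graded algebras and their graded tensor products -/

section Internal

variable {k T X : Type*} [Field k] [AddCommGroup T] [Module k T] [AddCommGroup X] [Module k X]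

/-! Write Δ for the extended coaction or comultiplication, and i_L, i_R for the two inclusions of
the factors into a graded tensor product.

Hopf structure on Ω(H). The subalgebra of Ω(H) ⊗ Ω(H) generated by Δ(H) and dΔ(H) is a calculus on
H. Its first order part is that of Ω(H): the sum of the left and right coactions identifies the two,
and it is injective because ε ⊗ id recovers a one-form from it. Maximality then yields the morphism
Δ (`exists_comul`). A calculus is generated by its elements a and da, so coassociativity and
counitality need only be checked there. The antipode exists because a degree-preserving map that is
convolution invertible in degree zero is convolution invertible: the geometric series for the
inverse is finite in each degree (`IsGradedCoalgebra.exists_inverse`).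

Surjectivity of χ. The image contains 1 ⊗ H by the Galois condition, is stable under d, under left
multiplication by Ω(A) and under right multiplication by Δ(Ω(A)). Since 1 ⊗ q commutes with Ω(A) up
to sign, the image contains products of such elements, hence 1 ⊗ Ω(H)
(`includeRight_mem_galoisSpan`).

Injectivity of χ. Filter Ω(A) by F_n, the forms whose coaction has no component of degree ≥ n in
Ω(H); F_0 = 0 and F_1 is the space of horizontal forms. For a left A-module N the map A ⊗_B N → N ⊗
H, a ⊗ n ↦ a₀n ⊗ a₁, is injective, and flatness turns a vanishing statement about id ⊗ g into
membership in A ⊗ ker g modulo the relations (`exists_sub_mem_of_canTensor_eq_zero`). With g = Δ −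
(· ⊗ 1) this shows that the horizontal forms are A·Ω(B). With g the truncated coaction it moves an
element of the kernel of χ from Ω(A) ⊗ F_(n+1) to Ω(A) ⊗ F_n modulo the relations
(`mem_sup_kerSpan`), and induction ends at F_0 = 0.

Gauge group. In the convolution algebra of maps Ω(H) → Ω(A) ⊗ Ω(H), colinearity of f for Ad reads
i_R * (Δ∘f) = (i_L∘f) * i_R, a condition visibly stable under products and inverses
(`colinear_iff`). The maps out of Ω(A) form a right module over the convolution algebra, and θ(f) is
the action of f on the identity; thus θ(g) ∘ θ(f) = θ(f * g). Surjectivity of χ makes this action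
faithful on algebra morphisms, and the translation map provides the preimage of a vertical
automorphism (`act_gaugeOfVertical`). -/

theorem isInternal_of_projections (M : ℕ → Submodule k T) (htop : ⨆ n, M n = ⊤)
    (f : T →ₗ[k] X) (hf : Function.Injective f) (p : ℕ → T →ₗ[k] X)
    (hsame : ∀ n, ∀ x ∈ M n, p n x = f x) (hne : ∀ n m, n ≠ m → ∀ x ∈ M m, p n x = 0) :
    DirectSum.IsInternal M := by
  rw [DirectSum.isInternal_submodule_iff_iSupIndep_and_iSup_eq_top]
  refine ⟨fun n => ?_, htop⟩
  rw [Submodule.disjoint_def]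
  intro x hx hx'
  have hle : (⨆ m, ⨆ (_ : m ≠ n), M m) ≤ LinearMap.ker (p n) :=
    iSup₂_le fun m hm y hy => LinearMap.mem_ker.2 (hne n m hm.symm y hy)
  refine hf ?_
  rw [← hsame n x hx, map_zero]
  exact LinearMap.mem_ker.1 (hle hx')

end Internal

section GradedBasics

variable {k Ω Ω' : Type*} [Field k] [Ring Ω] [Algebra k Ω] [Ring Ω'] [Algebra k Ω']
  (gr : ℕ → Submodule k Ω) [GradedAlgebra gr] (gr' : ℕ → Submodule k Ω') [GradedAlgebra gr']

/-- Linear maps that agree on homogeneous elements are equal. -/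
theorem linearMap_ext_homogeneous {M : Type*} [AddCommMonoid M] [Module k M] {f g : Ω →ₗ[k] M}
    (h : ∀ n, ∀ x ∈ gr n, f x = g x) : f = g :=
  DirectSum.decompose_lhom_ext gr fun n => LinearMap.ext fun x => h n x x.2

theorem iSup_gr_eq_top : ⨆ n, gr n = ⊤ :=
  (DirectSum.Decomposition.isInternal gr).submodule_iSup_eq_top

variable {gr} in
theorem proj_of_mem {n : ℕ} {x : Ω} (hx : x ∈ gr n) : GradedAlgebra.proj gr n x = x := by
  rw [GradedAlgebra.proj_apply, DirectSum.decompose_of_mem_same gr hx]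

variable {gr} in
theorem proj_of_mem_ne {n m : ℕ} {x : Ω} (hx : x ∈ gr n) (h : n ≠ m) :
    GradedAlgebra.proj gr m x = 0 := by
  rw [GradedAlgebra.proj_apply, DirectSum.decompose_of_mem_ne gr hx h]

theorem proj_mem (n : ℕ) (x : Ω) : GradedAlgebra.proj gr n x ∈ gr n := by
  rw [GradedAlgebra.proj_apply]; exact SetLike.coe_mem _

variable {gr} in
theorem degreeSign_of_mem {n : ℕ} {x : Ω} (hx : x ∈ gr n) :
    degreeSign gr x = (-1 : k) ^ n • x := by
  have h := DirectSum.decompose_of_mem gr hx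
  simp only [degreeSign, LinearMap.comp_apply, LinearEquiv.coe_coe,
    DirectSum.decomposeLinearEquiv_apply, h]
  rw [← DirectSum.lof_eq_of k, DirectSum.toModule_lof]
  simp

variable {gr gr'}

theorem units_smul_eq {M : Type*} [AddCommGroup M] [Module k M] (n : ℕ) (x : M) :
    ((-1 : ℤˣ) ^ n) • x = (-1 : k) ^ n • x := by
  rcases Nat.even_or_odd n with h | h <;> simp [h.neg_one_pow]

namespace GradedTensorProduct

theorem tmul_mul_tmul_of_mem {i j : ℕ} (a₁ : Ω) {b₁ : Ω'} (hb : b₁ ∈ gr' j) {a₂ : Ω}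
    (ha : a₂ ∈ gr i) (b₂ : Ω') :
    (tmul k a₁ b₁ * tmul k a₂ b₂ : gr ᵍ⊗[k] gr') =
      (-1 : k) ^ (j * i) • tmul k (a₁ * a₂) (b₁ * b₂) := by
  rw [← units_smul_eq]
  exact tmul_coe_mul_coe_tmul gr gr' a₁ ⟨b₁, hb⟩ ⟨a₂, ha⟩ b₂

/-- A crossing factor of degree zero produces no sign, so the other factors need not be homogeneous.
-/
theorem tmul_mul_tmul_left {b₁ : Ω'} (hb : b₁ ∈ gr' 0) (a₁ a₂ : Ω) (b₂ : Ω') :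
    (tmul k a₁ b₁ * tmul k a₂ b₂ : gr ᵍ⊗[k] gr') = tmul k (a₁ * a₂) (b₁ * b₂) := by
  have : a₂ ∈ ⨆ n, gr n := by rw [iSup_gr_eq_top]; trivial
  induction this using Submodule.iSup_induction' with
  | mem i x hx => simpa using tmul_mul_tmul_of_mem a₁ hb hx b₂
  | zero => simp [tmul]
  | add x y _ _ hx hy =>
    simp only [tmul, TensorProduct.add_tmul, mul_add, map_add] at hx hy ⊢
    rw [hx, hy]

theorem tmul_mul_tmul_right {a₂ : Ω} (ha : a₂ ∈ gr 0) (a₁ : Ω) (b₁ b₂ : Ω') :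
    (tmul k a₁ b₁ * tmul k a₂ b₂ : gr ᵍ⊗[k] gr') = tmul k (a₁ * a₂) (b₁ * b₂) := by
  have : b₁ ∈ ⨆ n, gr' n := by rw [iSup_gr_eq_top]; trivial
  induction this using Submodule.iSup_induction' with
  | mem i x hx => simpa using tmul_mul_tmul_of_mem a₁ hx ha b₂
  | zero => simp [tmul]
  | add x y _ _ hx hy =>
    simp only [tmul, TensorProduct.tmul_add, add_mul, map_add] at hx hy ⊢
    rw [hx, hy]

theorem includeLeft_mul_tmul (a₁ a₂ : Ω) (b : Ω') :
    (includeLeft gr gr' a₁ * tmul k a₂ b : gr ᵍ⊗[k] gr') = tmul k (a₁ * a₂) b := by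
  have := tmul_mul_tmul_left (k := k) (gr := gr) (gr' := gr') (b₁ := 1)
    SetLike.GradedOne.one_mem a₁ a₂ b
  simpa using this

theorem tmul_mul_includeRight (a : Ω) (b₁ b₂ : Ω') :
    (tmul k a b₁ * includeRight gr gr' b₂ : gr ᵍ⊗[k] gr') = tmul k a (b₁ * b₂) := by
  have := tmul_mul_tmul_right (k := k) (gr := gr) (gr' := gr') (a₂ := 1)
    SetLike.GradedOne.one_mem a b₁ b₂
  simpa using this

theorem includeLeft_mul_includeRight (a : Ω) (b : Ω') :
    (includeLeft gr gr' a * includeRight gr gr' b : gr ᵍ⊗[k] gr') = tmul k a b :=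
  tmul_one_mul_one_tmul gr gr' a b

theorem includeRight_mul_includeLeft {i j : ℕ} {a : Ω} {b : Ω'} (ha : a ∈ gr i) (hb : b ∈ gr' j) :
    (includeRight gr gr' b * includeLeft gr gr' a : gr ᵍ⊗[k] gr') =
      (-1 : k) ^ (j * i) • tmul k a b := by
  have := tmul_mul_tmul_of_mem (k := k) (gr := gr) (gr' := gr') 1 hb ha 1
  simpa using this

theorem tmul_mem_tensorGr {i j : ℕ} {a : Ω} {b : Ω'} (ha : a ∈ gr i) (hb : b ∈ gr' j) :
    tmul k a b ∈ tensorGr gr gr' (i + j) :=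
  Submodule.subset_span ⟨i, j, a, b, rfl, ha, hb, rfl⟩

theorem induction_tmul {motive : gr ᵍ⊗[k] gr' → Prop} (zero : motive 0)
    (tmul : ∀ a b, motive (tmul k a b)) (add : ∀ x y, motive x → motive y → motive (x + y))
    (t : gr ᵍ⊗[k] gr') : motive t :=
  TensorProduct.induction_on (motive := fun t => motive (of k gr gr' t)) t zero tmul add

theorem induction_homogeneous {motive : gr ᵍ⊗[k] gr' → Prop} (zero : motive 0)
    (tmul : ∀ i j, ∀ a ∈ gr i, ∀ b ∈ gr' j, motive (tmul k a b))
    (add : ∀ x y, motive x → motive y → motive (x + y)) (t : gr ᵍ⊗[k] gr') : motive t := by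
  refine induction_tmul zero (fun a b => ?_) add t
  have ha : a ∈ ⨆ n, gr n := by rw [iSup_gr_eq_top]; trivial
  have hb : b ∈ ⨆ n, gr' n := by rw [iSup_gr_eq_top]; trivial
  induction ha using Submodule.iSup_induction' with
  | mem i x hx =>
    induction hb using Submodule.iSup_induction' with
    | mem j y hy => exact tmul i j x hx y hy
    | zero => simpa [GradedTensorProduct.tmul] using zero
    | add y z _ _ hy hz =>
      simp only [GradedTensorProduct.tmul, TensorProduct.tmul_add, map_add] at hy hz ⊢
      exact add _ _ hy hz
  | zero => simpa [GradedTensorProduct.tmul] using zero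
  | add y z _ _ hy hz =>
    simp only [GradedTensorProduct.tmul, TensorProduct.add_tmul, map_add] at hy hz ⊢
    exact add _ _ hy hz

/-- The projection of the graded tensor product onto its degree `n` part. -/
def tensorProj (gr : ℕ → Submodule k Ω) [GradedAlgebra gr] (gr' : ℕ → Submodule k Ω')
    [GradedAlgebra gr'] (n : ℕ) : (gr ᵍ⊗[k] gr') →ₗ[k] (gr ᵍ⊗[k] gr') :=
  (of k gr gr').toLinearMap ∘ₗ
    (∑ p ∈ Finset.HasAntidiagonal.antidiagonal n,
      TensorProduct.map (GradedAlgebra.proj gr p.1) (GradedAlgebra.proj gr' p.2)) ∘ₗ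
    (of k gr gr').symm.toLinearMap

theorem tensorProj_tmul (n i j : ℕ) {a : Ω} {b : Ω'} (ha : a ∈ gr i) (hb : b ∈ gr' j) :
    tensorProj gr gr' n (tmul k a b) = if i + j = n then tmul k a b else 0 := by
  have hterm : ∀ p : ℕ × ℕ, (GradedAlgebra.proj gr p.1 a) ⊗ₜ[k] (GradedAlgebra.proj gr' p.2 b) =
      if p = (i, j) then a ⊗ₜ b else 0 := by
    rintro ⟨p, q⟩
    by_cases h1 : i = p
    · by_cases h2 : j = q
      · subst h1 h2; simp [proj_of_mem ha, proj_of_mem hb]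
      · rw [proj_of_mem_ne hb h2, TensorProduct.tmul_zero, if_neg]
        simp only [Prod.mk.injEq, not_and]; exact fun _ h => h2 h.symm
    · rw [proj_of_mem_ne ha h1, TensorProduct.zero_tmul, if_neg]
      simp only [Prod.mk.injEq, not_and]; exact fun h => absurd h.symm h1
  simp only [tensorProj, LinearMap.comp_apply, LinearEquiv.coe_coe, of_symm_of,
    LinearMap.sum_apply, TensorProduct.map_tmul, hterm]
  rw [Finset.sum_ite_eq']
  simp only [Finset.HasAntidiagonal.mem_antidiagonal]
  split_ifs <;> simp

theorem tensorProj_of_mem {n : ℕ} {t : gr ᵍ⊗[k] gr'} (ht : t ∈ tensorGr gr gr' n) :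
    tensorProj gr gr' n t = t := by
  induction ht using Submodule.span_induction with
  | mem x hx =>
    obtain ⟨i, j, a, b, h, ha, hb, rfl⟩ := hx
    rw [tensorProj_tmul n i j ha hb, if_pos h]
  | zero => simp
  | add x y _ _ hx hy => rw [map_add, hx, hy]
  | smul c x _ hx => rw [map_smul, hx]

theorem tensorProj_of_mem_ne {n m : ℕ} (hnm : n ≠ m) {t : gr ᵍ⊗[k] gr'}
    (ht : t ∈ tensorGr gr gr' m) : tensorProj gr gr' n t = 0 := by
  induction ht using Submodule.span_induction with
  | mem x hx =>
    obtain ⟨i, j, a, b, h, ha, hb, rfl⟩ := hx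
    rw [tensorProj_tmul n i j ha hb, if_neg (h ▸ hnm.symm)]
  | zero => simp
  | add x y _ _ hx hy => rw [map_add, hx, hy, add_zero]
  | smul c x _ hx => rw [map_smul, hx, smul_zero]

theorem iSup_tensorGr : ⨆ n, tensorGr gr gr' n = ⊤ := by
  refine eq_top_iff.2 fun t _ => ?_
  refine induction_homogeneous (zero_mem _) (fun i j a ha b hb => ?_)
    (fun x y => add_mem) t
  exact Submodule.mem_iSup_of_mem (i + j) (tmul_mem_tensorGr ha hb)

theorem one_mem_tensorGr : (1 : gr ᵍ⊗[k] gr') ∈ tensorGr gr gr' 0 :=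
  tmul_mem_tensorGr (i := 0) (j := 0) SetLike.GradedOne.one_mem SetLike.GradedOne.one_mem

theorem mul_mem_tensorGr {m n : ℕ} {s t : gr ᵍ⊗[k] gr'} (hs : s ∈ tensorGr gr gr' m)
    (ht : t ∈ tensorGr gr gr' n) : s * t ∈ tensorGr gr gr' (m + n) := by
  induction hs using Submodule.span_induction with
  | mem x hx =>
    obtain ⟨i, j, a, b, rfl, ha, hb, rfl⟩ := hx
    induction ht using Submodule.span_induction with
    | mem x hx =>
      obtain ⟨i', j', a', b', rfl, ha', hb', rfl⟩ := hx
      rw [tmul_mul_tmul_of_mem a hb ha' b', add_add_add_comm]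
      exact Submodule.smul_mem _ _ (tmul_mem_tensorGr (SetLike.mul_mem_graded ha ha')
        (SetLike.mul_mem_graded hb hb'))
    | zero => rw [mul_zero]; exact zero_mem _
    | add x y _ _ hx hy => rw [mul_add]; exact add_mem hx hy
    | smul c x _ hx => rw [mul_smul_comm]; exact Submodule.smul_mem _ _ hx
  | zero => rw [zero_mul]; exact zero_mem _
  | add x y _ _ hx hy => rw [add_mul]; exact add_mem hx hy
  | smul c x _ hx => rw [smul_mul_assoc]; exact Submodule.smul_mem _ _ hx

/-- The total grading is needed to tensor with a third factor, for coassociativity, and to speak of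
differentials on the tensor product. -/
instance tensorGr.gradedAlgebra : GradedAlgebra (tensorGr gr gr') where
  one_mem := one_mem_tensorGr
  mul_mem _ _ _ _ := mul_mem_tensorGr
  toDecomposition := (isInternal_of_projections (tensorGr gr gr') iSup_tensorGr
    LinearMap.id Function.injective_id (tensorProj gr gr') (fun _ _ h => tensorProj_of_mem h)
    (fun _ _ h _ hx => tensorProj_of_mem_ne h hx)).chooseDecomposition

end GradedTensorProduct

/-- `D` is a differential on the graded algebra `gr`: it has degree one and square zero, and it
satisfies the graded Leibniz rule. -/
structure IsDifferential (gr : ℕ → Submodule k Ω) (D : Ω →ₗ[k] Ω) : Prop where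
  d_mem : ∀ (n : ℕ) (ω : Ω), ω ∈ gr n → D ω ∈ gr (n + 1)
  d_d : ∀ ω : Ω, D (D ω) = 0
  leibniz : ∀ (n : ℕ) (ω η : Ω), ω ∈ gr n → D (ω * η) = D ω * η + (-1 : k) ^ n • (ω * D η)

theorem DifferentialCalculus.isDifferential {A : Type*} [Ring A] [Algebra k A]
    (C : DifferentialCalculus k A gr) : IsDifferential gr C.d :=
  ⟨C.d_mem, C.d_d, C.leibniz⟩

open GradedTensorProduct

theorem tensorD_tmul (D : Ω →ₗ[k] Ω) (D' : Ω' →ₗ[k] Ω') (a : Ω) (b : Ω') :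
    tensorD gr gr' D D' (tmul k a b) =
      tmul k (D a) b + tmul k (degreeSign gr a) (D' b) := by
  simp [tensorD, tmul]

theorem tensorD_tmul_of_mem (D : Ω →ₗ[k] Ω) (D' : Ω' →ₗ[k] Ω') {i : ℕ} {a : Ω} (ha : a ∈ gr i)
    (b : Ω') :
    tensorD gr gr' D D' (tmul k a b) = tmul k (D a) b + (-1 : k) ^ i • tmul k a (D' b) := by
  rw [tensorD_tmul, degreeSign_of_mem ha]
  simp only [tmul, ← TensorProduct.smul_tmul', map_smul]

theorem IsDifferential.tensorD {D : Ω →ₗ[k] Ω} {D' : Ω' →ₗ[k] Ω'} (hD : IsDifferential gr D)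
    (hD' : IsDifferential gr' D') : IsDifferential (tensorGr gr gr') (tensorD gr gr' D D') where
  d_mem n ω hω := by
    induction hω using Submodule.span_induction with
    | mem x hx =>
      obtain ⟨i, j, a, b, rfl, ha, hb, rfl⟩ := hx
      rw [tensorD_tmul_of_mem D D' ha]
      refine add_mem ?_ (Submodule.smul_mem _ _ ?_)
      · rw [add_right_comm]; exact tmul_mem_tensorGr (hD.d_mem _ _ ha) hb
      · rw [add_assoc]; exact tmul_mem_tensorGr ha (hD'.d_mem _ _ hb)
    | zero => rw [map_zero]; exact zero_mem _
    | add x y _ _ hx hy => rw [map_add]; exact add_mem hx hy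
    | smul c x _ hx => rw [map_smul]; exact Submodule.smul_mem _ _ hx
  d_d ω := by
    induction ω using induction_homogeneous with
    | zero => simp
    | add x y hx hy => rw [map_add, map_add, hx, hy, add_zero]
    | tmul i j a ha b hb =>
      rw [tensorD_tmul_of_mem D D' ha, map_add, map_smul, tensorD_tmul_of_mem D D' ha,
        tensorD_tmul_of_mem D D' (hD.d_mem _ _ ha), hD.d_d, hD'.d_d]
      simp [tmul, pow_succ]
  leibniz n ω η hω := by
    induction hω using Submodule.span_induction with
    | mem x hx =>
      obtain ⟨i, j, a, b, rfl, ha, hb, rfl⟩ := hx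
      induction η using induction_homogeneous with
      | zero => simp
      | add x y hx hy => simp only [map_add, mul_add, hx, hy, smul_add]; abel
      | tmul i' j' a' ha' b' hb' =>
        have h1 := SetLike.mul_mem_graded ha ha'
        rw [tmul_mul_tmul_of_mem a hb ha' b', map_smul, tensorD_tmul_of_mem D D' h1,
          tensorD_tmul_of_mem D D' ha, tensorD_tmul_of_mem D D' ha', mul_add, mul_smul_comm,
          add_mul, smul_mul_assoc, tmul_mul_tmul_of_mem _ hb ha', tmul_mul_tmul_of_mem _ hb
          (hD.d_mem _ _ ha'), tmul_mul_tmul_of_mem _ hb ha', tmul_mul_tmul_of_mem _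
          (hD'.d_mem _ _ hb) ha', hD.leibniz i a a' ha, hD'.leibniz j b b' hb]
        simp only [tmul, TensorProduct.add_tmul, TensorProduct.tmul_add, map_add, smul_add,
          ← TensorProduct.smul_tmul', TensorProduct.tmul_smul, map_smul, smul_smul]
        -- The three sign identities belong to the terms in which the differential falls on `a'`, on
        -- `b` and on `b'`, in this order.
        have e1 : (-1 : k) ^ (j * i') * (-1) ^ i = (-1) ^ (i + j) * (-1) ^ (j * (i' + 1)) := by
          rw [mul_add, mul_one, pow_add, pow_add]
          have hu : (-1 : k) ^ j * (-1) ^ j = 1 := by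
            rw [← pow_add]; exact Even.neg_one_pow ⟨j, rfl⟩
          linear_combination -((-1 : k) ^ (j * i') * (-1) ^ i) * hu
        have e2 : (-1 : k) ^ (j * i') * (-1) ^ (i + i') = (-1) ^ i * (-1) ^ ((j + 1) * i') := by
          rw [add_mul, one_mul, pow_add, pow_add]; ring
        have e3 : (-1 : k) ^ (j * i') * ((-1) ^ (i + i') * (-1) ^ j) =
            (-1) ^ (i + j) * ((-1) ^ i' * (-1) ^ (j * i')) := by
          rw [pow_add, pow_add]; ring
        rw [e1, e2, e3]
        abel
    | zero => simp
    | add x y _ _ hx hy => simp only [map_add, add_mul, hx, hy, smul_add]; abel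
    | smul c x _ hx =>
      simp only [map_smul, smul_mul_assoc, hx, smul_add]
      rw [smul_comm]

end GradedBasics

/-! ### The calculus generated by an algebra inside a differential graded algebra -/

section Generated

variable {k A : Type*} {T : Type*} [Field k] [Ring A] [Algebra k A] [Ring T] [Algebra k T]

/-- The span of the forms `a⁰ da¹ ⋯ daⁿ` for an algebra morphism `j : A → T` and `D : T → T`. -/
def formSpan (j : A →ₐ[k] T) (D : T →ₗ[k] T) (n : ℕ) : Submodule k T :=
  Submodule.span k {ω | ∃ (a₀ : A) (a : Fin n → A),
    ω = j a₀ * (List.ofFn fun i => D (j (a i))).prod}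

/-- Lists in place of tuples allow induction on the differential factors. -/
theorem formSpan_eq_list (j : A →ₐ[k] T) (D : T →ₗ[k] T) (n : ℕ) :
    formSpan j D n = Submodule.span k {ω | ∃ (a₀ : A) (l : List A), l.length = n ∧
      ω = j a₀ * (l.map fun a => D (j a)).prod} := by
  rw [formSpan]
  congr 1
  ext ω
  constructor
  · rintro ⟨a₀, a, rfl⟩
    refine ⟨a₀, List.ofFn a, by simp, ?_⟩
    rw [List.map_ofFn]; rfl
  · rintro ⟨a₀, l, rfl, rfl⟩
    refine ⟨a₀, l.get, ?_⟩
    congr 2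
    rw [← Function.comp_def (fun a => D (j a)) l.get, ← List.map_ofFn, List.ofFn_get]

theorem DifferentialCalculus.gr_eq_formSpan {gr : ℕ → Submodule k T} [GradedAlgebra gr]
    (C : DifferentialCalculus k A gr) (n : ℕ) : gr n = formSpan C.incl C.d n :=
  C.gr_eq_span n

variable (j : A →ₐ[k] T) (D : T →ₗ[k] T)

theorem mem_formSpan (a₀ : A) (l : List A) :
    j a₀ * (l.map fun a => D (j a)).prod ∈ formSpan j D l.length := by
  rw [formSpan_eq_list]
  exact Submodule.subset_span ⟨a₀, l, rfl, rfl⟩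

variable {j D}

theorem formSpan_induction {n : ℕ} {M : Submodule k T}
    (h : ∀ (a₀ : A) (l : List A), l.length = n → j a₀ * (l.map fun a => D (j a)).prod ∈ M) :
    formSpan j D n ≤ M := by
  rw [formSpan_eq_list, Submodule.span_le]
  rintro _ ⟨a₀, l, hl, rfl⟩
  exact h a₀ l hl

theorem mul_formSpan {n : ℕ} (a : A) {x : T} (hx : x ∈ formSpan j D n) :
    j a * x ∈ formSpan j D n := by
  suffices formSpan j D n ≤ (formSpan j D n).comap (LinearMap.mulLeft k (j a)) from this hx
  refine formSpan_induction fun a₀ l hl => ?_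
  rw [Submodule.mem_comap, LinearMap.mulLeft_apply, ← mul_assoc, ← map_mul, ← hl]
  exact mem_formSpan j D _ l

variable {grT : ℕ → Submodule k T}

/-- The Leibniz rule in the form da · a₀ = d(a a₀) − a da₀ brings coefficients to the left. This is
what makes the spans closed under multiplication. -/
theorem d_mul_formSpan (hD : IsDifferential grT D) (hj : ∀ a, j a ∈ grT 0) {n : ℕ} (a : A)
    {x : T} (hx : x ∈ formSpan j D n) : D (j a) * x ∈ formSpan j D (n + 1) := by
  suffices formSpan j D n ≤ (formSpan j D (n + 1)).comap (LinearMap.mulLeft k (D (j a))) from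
    this hx
  refine formSpan_induction fun a₀ l hl => ?_
  rw [Submodule.mem_comap, LinearMap.mulLeft_apply, ← mul_assoc]
  have h := hD.leibniz 0 (j a) (j a₀) (hj a)
  rw [pow_zero, one_smul] at h
  rw [← sub_eq_of_eq_add h, sub_mul]
  subst hl
  refine sub_mem ?_ ?_
  · simpa using mem_formSpan j D 1 (a * a₀ :: l)
  · simpa [mul_assoc] using mem_formSpan j D a (a₀ :: l)

variable [GradedAlgebra grT]

theorem mul_mem_formSpan (hD : IsDifferential grT D) (hj : ∀ a, j a ∈ grT 0) {m n : ℕ} {x y : T}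
    (hx : x ∈ formSpan j D m) (hy : y ∈ formSpan j D n) : x * y ∈ formSpan j D (m + n) := by
  suffices formSpan j D m ≤ (formSpan j D (m + n)).comap (LinearMap.mulRight k y) from this hx
  refine formSpan_induction fun a₀ l hl => ?_
  rw [Submodule.mem_comap, LinearMap.mulRight_apply, mul_assoc]
  refine mul_formSpan a₀ ?_
  subst hl
  clear hx
  induction l with
  | nil => simpa using hy
  | cons a l ih =>
    rw [List.map_cons, List.prod_cons, mul_assoc, List.length_cons, add_right_comm]
    exact d_mul_formSpan hD hj a ih

theorem prod_d_mem (hD : IsDifferential grT D) (hj : ∀ a, j a ∈ grT 0) (l : List A) :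
    (l.map fun a => D (j a)).prod ∈ grT l.length := by
  induction l with
  | nil => exact SetLike.GradedOne.one_mem
  | cons a l ih =>
    rw [List.map_cons, List.prod_cons, List.length_cons, add_comm]
    exact SetLike.mul_mem_graded (hD.d_mem 0 _ (hj a)) ih

theorem d_prod_d (hD : IsDifferential grT D) (hj : ∀ a, j a ∈ grT 0) (l : List A) :
    D (l.map fun a => D (j a)).prod = 0 := by
  induction l with
  | nil =>
    have h := hD.leibniz 0 1 1 SetLike.GradedOne.one_mem
    simpa using h
  | cons a l ih =>
    rw [List.map_cons, List.prod_cons, hD.leibniz _ _ _ (hD.d_mem 0 _ (hj a)), ih, hD.d_d]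
    simp

theorem d_mem_formSpan (hD : IsDifferential grT D) (hj : ∀ a, j a ∈ grT 0) {n : ℕ} {x : T}
    (hx : x ∈ formSpan j D n) : D x ∈ formSpan j D (n + 1) := by
  suffices formSpan j D n ≤ (formSpan j D (n + 1)).comap D from this hx
  refine formSpan_induction fun a₀ l hl => ?_
  rw [Submodule.mem_comap, hD.leibniz 0 _ _ (hj a₀), d_prod_d hD hj]
  subst hl
  simpa using mem_formSpan j D 1 (a₀ :: l)

theorem formSpan_le (hD : IsDifferential grT D) (hj : ∀ a, j a ∈ grT 0) (n : ℕ) :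
    formSpan j D n ≤ grT n := by
  refine formSpan_induction fun a₀ l hl => ?_
  subst hl
  simpa using SetLike.mul_mem_graded (hj a₀) (prod_d_mem hD hj l)

/-- The differential graded subalgebra generated by `j : A → T`. -/
def formAlgebra (hD : IsDifferential grT D) (hj : ∀ a, j a ∈ grT 0) : Subalgebra k T :=
  (⨆ n, formSpan j D n).toSubalgebra
    (Submodule.mem_iSup_of_mem 0 (by simpa using mem_formSpan j D 1 []))
    (fun x y hx hy => by
      induction hx using Submodule.iSup_induction' with
      | mem m x hx =>
        induction hy using Submodule.iSup_induction' with
        | mem n y hy => exact Submodule.mem_iSup_of_mem (m + n) (mul_mem_formSpan hD hj hx hy)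
        | zero => rw [mul_zero]; exact zero_mem _
        | add y z _ _ hy hz => rw [mul_add]; exact add_mem hy hz
      | zero => rw [zero_mul]; exact zero_mem _
      | add y z _ _ hy hz => rw [add_mul]; exact add_mem hy hz)

theorem formSpan_le_formAlgebra (hD : IsDifferential grT D) (hj : ∀ a, j a ∈ grT 0) (n : ℕ) :
    formSpan j D n ≤ (formAlgebra hD hj).toSubmodule :=
  le_iSup (formSpan j D) n

/-- The degree `n` part of `formAlgebra`. -/
def formGr (hD : IsDifferential grT D) (hj : ∀ a, j a ∈ grT 0) (n : ℕ) :
    Submodule k (formAlgebra hD hj) :=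
  (formSpan j D n).comap (formAlgebra hD hj).val.toLinearMap

theorem iSup_formGr (hD : IsDifferential grT D) (hj : ∀ a, j a ∈ grT 0) :
    ⨆ n, formGr hD hj n = ⊤ := by
  refine eq_top_iff.2 ?_
  rintro ⟨x, hx⟩ -
  change x ∈ ⨆ n, formSpan j D n at hx
  suffices ∀ h : x ∈ formAlgebra hD hj, (⟨x, h⟩ : formAlgebra hD hj) ∈ ⨆ n, formGr hD hj n from
    this _
  induction hx using Submodule.iSup_induction' with
  | mem n x hx => exact fun h => Submodule.mem_iSup_of_mem n hx
  | zero => exact fun h => zero_mem _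
  | add x y hx hy hx' hy' => exact fun h => add_mem (hx' hx) (hy' hy)

instance formGr.gradedAlgebra (hD : IsDifferential grT D) (hj : ∀ a, j a ∈ grT 0) :
    GradedAlgebra (formGr hD hj) where
  one_mem := show (1 : T) ∈ formSpan j D 0 by simpa using mem_formSpan j D 1 []
  mul_mem _ _ _ _ hx hy := mul_mem_formSpan hD hj hx hy
  toDecomposition := (isInternal_of_projections (formGr hD hj) (iSup_formGr hD hj)
    (formAlgebra hD hj).val.toLinearMap Subtype.val_injective
    (fun n => GradedAlgebra.proj grT n ∘ₗ (formAlgebra hD hj).val.toLinearMap)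
    (fun n x hx => proj_of_mem (formSpan_le hD hj n hx))
    (fun n m h x hx => proj_of_mem_ne (formSpan_le hD hj m hx) h.symm)).chooseDecomposition

theorem map_formGr (hD : IsDifferential grT D) (hj : ∀ a, j a ∈ grT 0) (n : ℕ) :
    (formGr hD hj n).map (formAlgebra hD hj).val.toLinearMap = formSpan j D n := by
  rw [formGr, Submodule.map_comap_eq, inf_eq_right]
  intro x hx
  exact ⟨⟨x, formSpan_le_formAlgebra hD hj n hx⟩, rfl⟩

/-- The calculus on `A` which an embedding of `A` into a differential graded algebra generates. -/
def formCalculus (hD : IsDifferential grT D) (hj : ∀ a, j a ∈ grT 0) (hinj : Function.Injective j) :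
    DifferentialCalculus k A (formGr hD hj) where
  incl := j.codRestrict (formAlgebra hD hj) fun a =>
    formSpan_le_formAlgebra hD hj 0 (by simpa using mem_formSpan j D a [])
  incl_injective a b h := hinj (congrArg Subtype.val h)
  range_incl := by
    apply Submodule.map_injective_of_injective (f := (formAlgebra hD hj).val.toLinearMap)
      Subtype.val_injective
    rw [map_formGr, ← LinearMap.range_comp]
    have : {ω | ∃ (a₀ : A) (a : Fin 0 → A), ω = j a₀ * (List.ofFn fun i => D (j (a i))).prod} =
        (LinearMap.range j.toLinearMap : Set T) := by
      ext ω
      constructor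
      · rintro ⟨a, _, rfl⟩; exact ⟨a, by simp⟩
      · rintro ⟨a, rfl⟩; exact ⟨a, fun i => i.elim0, by simp⟩
    change _ = Submodule.span k _
    rw [this, Submodule.span_eq]
    rfl
  d := D.restrict (p := (formAlgebra hD hj).toSubmodule) (q := (formAlgebra hD hj).toSubmodule)
    (fun x hx => by
      change x ∈ ⨆ n, formSpan j D n at hx
      change D x ∈ ⨆ n, formSpan j D n
      induction hx using Submodule.iSup_induction' with
      | mem n x hx => exact Submodule.mem_iSup_of_mem (n + 1) (d_mem_formSpan hD hj hx)
      | zero => rw [map_zero]; exact zero_mem _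
      | add y z _ _ hy hz => rw [map_add]; exact add_mem hy hz)
  d_mem n ω hω := d_mem_formSpan hD hj hω
  d_d ω := Subtype.ext (hD.d_d ω)
  leibniz n ω η hω := Subtype.ext (hD.leibniz n ω η (formSpan_le hD hj n hω))
  gr_eq_span n := by
    apply Submodule.map_injective_of_injective (f := (formAlgebra hD hj).val.toLinearMap)
      Subtype.val_injective
    rw [map_formGr, Submodule.map_span, formSpan]
    congr 1
    ext ω
    constructor
    · rintro ⟨a₀, a, rfl⟩
      refine ⟨_, ⟨a₀, a, rfl⟩, ?_⟩
      simp only [AlgHom.toLinearMap_apply, map_mul, map_list_prod, List.map_ofFn]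
      rfl
    · rintro ⟨_, ⟨a₀, a, rfl⟩, rfl⟩
      refine ⟨a₀, a, ?_⟩
      simp only [AlgHom.toLinearMap_apply, map_mul, map_list_prod, List.map_ofFn]
      rfl

end Generated

/-! ### The universal property of the maximal prolongation -/

section Universal

variable {k A : Type*} {Ω T : Type v} [Field k] [Ring A] [Algebra k A] [Ring Ω] [Algebra k Ω]
  {gr : ℕ → Submodule k Ω} [GradedAlgebra gr] [Ring T] [Algebra k T]
  {grT : ℕ → Submodule k T} [GradedAlgebra grT] {D : T →ₗ[k] T} {j : A →ₐ[k] T}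

theorem DifferentialCalculus.gr_one (C : DifferentialCalculus k A gr) :
    gr 1 = Submodule.span k {ω | ∃ a b : A, ω = C.incl a * C.d (C.incl b)} := by
  rw [C.gr_eq_span 1]
  congr 1
  ext ω
  constructor
  · rintro ⟨a, b, rfl⟩; exact ⟨a, b 0, by simp⟩
  · rintro ⟨a, b, rfl⟩; exact ⟨a, fun _ => b, by simp⟩

/-- The maximal prolongation maps to each differential graded algebra `T` with an embedding
`j : A → T` that respects the first order calculus. -/
theorem DifferentialCalculus.IsMaximalProlongation.exists_lift {C : DifferentialCalculus k A gr}
    (hmax : C.IsMaximalProlongation) (hD : IsDifferential grT D) (hj : ∀ a, j a ∈ grT 0)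
    (hinj : Function.Injective j) (e : Ω →ₗ[k] T)
    (he : ∀ a b, e (C.incl a * C.d (C.incl b)) = j a * D (j b))
    (he' : ∀ x ∈ gr 1, e x = 0 → x = 0) :
    ∃ φ : Ω →ₐ[k] T, (∀ n, ∀ ω ∈ gr n, φ ω ∈ grT n) ∧ (∀ ω, φ (C.d ω) = D (φ ω)) ∧
      ∀ a, φ (C.incl a) = j a := by
  -- Maximality only concerns calculi on `A`, so `T` is replaced by the differential graded
  -- subalgebra generated by `j`.
  let C' := formCalculus hD hj hinj
  have himg : (gr 1).map e = formSpan j D 1 := by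
    rw [C.gr_one, Submodule.map_span, formSpan]
    congr 1
    ext ω
    constructor
    · rintro ⟨_, ⟨a, b, rfl⟩, rfl⟩; exact ⟨a, fun _ => b, by simp [he]⟩
    · rintro ⟨a, b, rfl⟩; exact ⟨_, ⟨a, b 0, rfl⟩, by simp [he]⟩
  have hmem : ∀ x : gr 1, e x ∈ formSpan j D 1 := fun x => himg ▸ Submodule.mem_map_of_mem x.2
  -- The restriction of `e` to one-forms, which is the isomorphism of first order calculi.
  let e₁ : gr 1 →ₗ[k] formGr hD hj 1 :=
    LinearMap.codRestrict _ (LinearMap.codRestrict (formAlgebra hD hj).toSubmodule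
      (e ∘ₗ (gr 1).subtype) fun x => formSpan_le_formAlgebra hD hj 1 (hmem x)) hmem
  have hb : Function.Bijective e₁ := by
    constructor
    · rw [← LinearMap.ker_eq_bot, LinearMap.ker_eq_bot']
      intro x hx
      exact Subtype.ext (he' x x.2 (congrArg (fun z : formGr hD hj 1 => ((z : formAlgebra hD hj) : T)) hx))
    · rintro ⟨⟨y, hy⟩, hy'⟩
      change y ∈ formSpan j D 1 at hy'
      rw [← himg] at hy'
      obtain ⟨x, hx, rfl⟩ := hy'
      exact ⟨⟨x, hx⟩, rfl⟩
  obtain ⟨φ, h1, h2, h3, -⟩ := hmax (formAlgebra hD hj) (formGr hD hj) C'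
    ⟨LinearEquiv.ofBijective e₁ hb, fun a b γ hγ => Subtype.ext (by
      change e (γ : Ω) = _
      rw [hγ, he]; rfl)⟩
  refine ⟨(formAlgebra hD hj).val.comp φ, fun n ω hω => formSpan_le hD hj n (h1 n ω hω),
    fun ω => ?_, fun a => ?_⟩
  · exact congrArg Subtype.val (h2 ω)
  · exact congrArg Subtype.val (h3 a)

end Universal

section Ext

variable {k A Ω T : Type*} [Field k] [Ring A] [Algebra k A] [Ring Ω] [Algebra k Ω]
  {gr : ℕ → Submodule k Ω} [GradedAlgebra gr] [Ring T] [Algebra k T]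

/-- A calculus is generated as an algebra by the elements a and da. All identities between morphisms
of calculi below are reduced to these generators. -/
theorem DifferentialCalculus.algHom_ext (C : DifferentialCalculus k A gr) {φ ψ : Ω →ₐ[k] T}
    (h : ∀ a, φ (C.incl a) = ψ (C.incl a)) (h' : ∀ a, φ (C.d (C.incl a)) = ψ (C.d (C.incl a))) :
    φ = ψ := by
  refine AlgHom.toLinearMap_injective (linearMap_ext_homogeneous gr fun n x hx => ?_)
  rw [C.gr_eq_formSpan] at hx
  suffices formSpan C.incl C.d n ≤ LinearMap.eqLocus φ.toLinearMap ψ.toLinearMap from this hx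
  refine formSpan_induction fun a₀ l _ => ?_
  simp only [LinearMap.mem_eqLocus, AlgHom.toLinearMap_apply, map_mul, h, map_list_prod,
    List.map_map, Function.comp_def, h']

end Ext

/-! ### The degree zero part of a calculus -/

section DegZero

variable {k A Ω : Type*} [Field k] [Ring A] [Algebra k A] [Ring Ω] [Algebra k Ω]
  {gr : ℕ → Submodule k Ω} [GradedAlgebra gr]

namespace DifferentialCalculus

/-- The algebra `A` is the degree zero part of a calculus on `A`. -/
def zeroEquiv (C : DifferentialCalculus k A gr) : A ≃ₗ[k] gr 0 :=
  LinearEquiv.ofInjective C.incl.toLinearMap C.incl_injective ≪≫ₗ LinearEquiv.ofEq _ _ C.range_incl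

theorem coe_zeroEquiv (C : DifferentialCalculus k A gr) (a : A) :
    (C.zeroEquiv a : Ω) = C.incl a := rfl

/-- The projection of a calculus on `A` onto its degree zero part. -/
def degZeroLin (C : DifferentialCalculus k A gr) : Ω →ₗ[k] A :=
  C.zeroEquiv.symm.toLinearMap ∘ₗ (GradedAlgebra.proj gr 0).codRestrict (gr 0) (proj_mem gr 0)

theorem incl_degZeroLin (C : DifferentialCalculus k A gr) (ω : Ω) :
    C.incl (C.degZeroLin ω) = GradedAlgebra.proj gr 0 ω := by
  rw [← coe_zeroEquiv, degZeroLin, LinearMap.comp_apply, LinearEquiv.coe_coe,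
    LinearEquiv.apply_symm_apply]
  rfl

theorem proj_zero_mul (x y : Ω) : GradedAlgebra.proj gr 0 (x * y) =
    GradedAlgebra.proj gr 0 x * GradedAlgebra.proj gr 0 y :=
  map_mul (GradedRing.projZeroRingHom gr) x y

/-- The projection of a calculus on `A` onto its degree zero part, as an algebra morphism. -/
def degZero (C : DifferentialCalculus k A gr) : Ω →ₐ[k] A :=
  AlgHom.ofLinearMap C.degZeroLin
    (C.incl_injective (by
      rw [incl_degZeroLin, map_one C.incl, proj_of_mem SetLike.GradedOne.one_mem]))
    (fun x y => C.incl_injective (by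
      rw [incl_degZeroLin, map_mul C.incl, incl_degZeroLin, incl_degZeroLin, proj_zero_mul]))

theorem incl_degZero (C : DifferentialCalculus k A gr) (ω : Ω) :
    C.incl (C.degZero ω) = GradedAlgebra.proj gr 0 ω := C.incl_degZeroLin ω

@[simp]
theorem degZero_incl (C : DifferentialCalculus k A gr) (a : A) : C.degZero (C.incl a) = a :=
  C.incl_injective (by rw [incl_degZero, proj_of_mem]; rw [← C.range_incl]; exact ⟨a, rfl⟩)

theorem degZero_of_mem (C : DifferentialCalculus k A gr) {n : ℕ} (hn : n ≠ 0) {ω : Ω}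
    (hω : ω ∈ gr n) : C.degZero ω = 0 :=
  C.incl_injective (by rw [incl_degZero, proj_of_mem_ne hω hn, map_zero])

theorem incl_mem_zero (C : DifferentialCalculus k A gr) (a : A) : C.incl a ∈ gr 0 := by
  rw [← C.range_incl]; exact ⟨a, rfl⟩

theorem exists_incl_of_mem (C : DifferentialCalculus k A gr) {ω : Ω} (hω : ω ∈ gr 0) :
    ∃ a, C.incl a = ω :=
  ⟨C.degZero ω, by rw [incl_degZero, proj_of_mem hω]⟩

end DifferentialCalculus

end DegZero

/-! ### Coassociativity and counitality of the extended coaction -/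

section GradedCommute

variable {k Ω Ω' : Type*} [Field k] [Ring Ω] [Algebra k Ω] [Ring Ω'] [Algebra k Ω']
  {gr : ℕ → Submodule k Ω} [GradedAlgebra gr] {gr' : ℕ → Submodule k Ω'} [GradedAlgebra gr']

theorem neg_one_pow_smul_smul {M : Type*} [AddCommGroup M] [Module k M] (n : ℕ) (x : M) :
    (-1 : k) ^ n • (-1 : k) ^ n • x = x := by
  rw [smul_smul, ← pow_add, Even.neg_one_pow ⟨n, rfl⟩, one_smul]

namespace GradedTensorProduct

theorem includeLeft_mem_tensorGr {i : ℕ} {a : Ω} (ha : a ∈ gr i) :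
    includeLeft gr gr' a ∈ tensorGr gr gr' i :=
  tmul_mem_tensorGr (i := i) (j := 0) ha SetLike.GradedOne.one_mem

theorem includeRight_mem_tensorGr {j : ℕ} {b : Ω'} (hb : b ∈ gr' j) :
    includeRight gr gr' b ∈ tensorGr gr gr' j := by
  have := tmul_mem_tensorGr (k := k) (gr := gr) (gr' := gr') (i := 0) (j := j) (a := 1)
    SetLike.GradedOne.one_mem hb
  rwa [zero_add] at this

theorem includeLeft_commute {i j : ℕ} {a : Ω} {b : Ω'} (ha : a ∈ gr i) (hb : b ∈ gr' j) :
    (includeLeft gr gr' a * includeRight gr gr' b : gr ᵍ⊗[k] gr') =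
      (-1 : k) ^ (j * i) • (includeRight gr gr' b * includeLeft gr gr' a) := by
  rw [includeRight_mul_includeLeft ha hb, neg_one_pow_smul_smul, includeLeft_mul_includeRight]

end GradedTensorProduct

end GradedCommute

/-- A Hopf algebra coacts on itself by its comultiplication. -/
def RightComoduleAlgebra.regular (k H : Type*) [Field k] [Ring H] [HopfAlgebra k H] :
    RightComoduleAlgebra k H H where
  coact := Bialgebra.comulAlgHom k H
  coassoc := Coalgebra.coassoc
  counit := by
    ext h
    exact (congrArg (TensorProduct.rid k H) (Coalgebra.lTensor_counit_comul (R := k) h)).trans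
      (by simp)

namespace CompleteCalculus

open GradedTensorProduct

variable {k H A ΩH ΩA : Type*} [Field k] [Ring H] [HopfAlgebra k H] [Ring A] [Algebra k A]
  [Ring ΩH] [Algebra k ΩH] {grH : ℕ → Submodule k ΩH} [GradedAlgebra grH]
  [Ring ΩA] [Algebra k ΩA] {grA : ℕ → Submodule k ΩA} [GradedAlgebra grA]
  {δ : RightComoduleAlgebra k H A}
  {CH : DifferentialCalculus k H grH} {CA : DifferentialCalculus k A grA}

theorem coact_incl_eq (K : CompleteCalculus δ CH CA) (a : A) :
    K.coact (CA.incl a) = of k grA grH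
      (TensorProduct.map CA.incl.toLinearMap CH.incl.toLinearMap (δ.coact a)) :=
  K.coact_incl a

theorem coact_d_incl (K : CompleteCalculus δ CH CA) (a : A) :
    K.coact (CA.d (CA.incl a)) = of k grA grH
      (TensorProduct.map (CA.d ∘ₗ CA.incl.toLinearMap) CH.incl.toLinearMap (δ.coact a) +
        TensorProduct.map CA.incl.toLinearMap (CH.d ∘ₗ CH.incl.toLinearMap) (δ.coact a)) := by
  rw [K.coact_d, coact_incl_eq]
  induction δ.coact a using TensorProduct.induction_on with
  | zero => simp
  | tmul x h =>
    have := tensorD_tmul_of_mem (gr' := grH) CA.d CH.d (CA.incl_mem_zero x) (CH.incl h)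
    simpa [tmul] using this
  | add x y hx hy => simp only [map_add, hx, hy]; abel

section Coassoc

variable (K : CompleteCalculus δ CH CA)
  (D : CompleteCalculus (RightComoduleAlgebra.regular k H) CH CH)

/-- The morphism `Δ_A ⊗ id` into the threefold graded tensor product. -/
def coactLeft : grA ᵍ⊗[k] grH →ₐ[k] tensorGr grA grH ᵍ⊗[k] grH :=
  lift grA grH ((includeLeft (tensorGr grA grH) grH).comp K.coact)
    (includeRight (tensorGr grA grH) grH) fun i j a b => by
      rw [units_smul_eq (k := k)]
      exact includeLeft_commute (K.coact_mem i a a.2) b.2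

variable (grA grH) in
/-- The inclusion of the last two factors into the threefold graded tensor product. -/
def includeLastTwo : grH ᵍ⊗[k] grH →ₐ[k] tensorGr grA grH ᵍ⊗[k] grH :=
  lift grH grH ((includeLeft (tensorGr grA grH) grH).comp (includeRight grA grH))
    (includeRight (tensorGr grA grH) grH) fun i j a b => by
      rw [units_smul_eq (k := k)]
      exact includeLeft_commute (includeRight_mem_tensorGr a.2) b.2

/-- Passing b ⊗ c costs the signs of b and of c, whose degrees add up to j. This is the commutation
that defining id ⊗ Δ as an algebra morphism requires. -/
theorem includeLeft_commute_includeLastTwo {i j : ℕ} {a : ΩA} (ha : a ∈ grA i)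
    {t : grH ᵍ⊗[k] grH} (ht : t ∈ tensorGr grH grH j) :
    (includeLeft (tensorGr grA grH) grH (includeLeft grA grH a)) * includeLastTwo grH grA t =
      (-1 : k) ^ (j * i) • (includeLastTwo grH grA t *
        includeLeft (tensorGr grA grH) grH (includeLeft grA grH a)) := by
  induction ht using Submodule.span_induction with
  | mem x hx =>
    obtain ⟨p, q, b, c, rfl, hb, hc, rfl⟩ := hx
    rw [includeLastTwo, lift_tmul, AlgHom.comp_apply, ← mul_assoc, ← map_mul,
      includeLeft_commute ha hb, map_smul, smul_mul_assoc, map_mul, mul_assoc,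
      includeLeft_commute (includeLeft_mem_tensorGr ha) hc, mul_smul_comm, smul_smul, ← pow_add,
      ← add_mul, mul_assoc]
  | zero => simp
  | add x y _ _ hx hy => simp only [map_add, mul_add, add_mul, hx, hy, smul_add]
  | smul c x _ hx => rw [map_smul, mul_smul_comm, hx, smul_mul_assoc, smul_comm]

variable (grA) in
/-- The morphism `id ⊗ Δ` into the threefold graded tensor product. -/
def comulRight : grA ᵍ⊗[k] grH →ₐ[k] tensorGr grA grH ᵍ⊗[k] grH :=
  lift grA grH ((includeLeft (tensorGr grA grH) grH).comp (includeLeft grA grH))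
    ((includeLastTwo grH grA).comp D.coact) fun i j a b => by
      rw [units_smul_eq (k := k)]
      exact includeLeft_commute_includeLastTwo a.2 (D.coact_mem j b b.2)

variable (grA grH) in
/-- The threefold graded tensor product as a threefold tensor product. -/
def threefold : (tensorGr grA grH ᵍ⊗[k] grH) ≃ₗ[k] (ΩA ⊗[k] ΩH) ⊗[k] ΩH :=
  (of k (tensorGr grA grH) grH).symm ≪≫ₗ
    TensorProduct.congr (of k grA grH).symm (LinearEquiv.refl k ΩH)

theorem threefold_coactLeft (t : ΩA ⊗[k] ΩH) :
    threefold grH grA (K.coactLeft (of k grA grH t)) =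
      TensorProduct.map (toTensor K.coact.toLinearMap) LinearMap.id t := by
  induction t using TensorProduct.induction_on with
  | zero => simp
  | tmul a b =>
    have h : K.coactLeft (tmul k a b) = tmul k (K.coact a) b :=
      includeLeft_mul_includeRight (K.coact a) b
    rw [h]
    rfl
  | add x y hx hy => simp only [map_add, hx, hy]

theorem threefold_comulRight (t : ΩA ⊗[k] ΩH) :
    threefold grH grA (comulRight grA D (of k grA grH t)) =
      (TensorProduct.assoc k ΩA ΩH ΩH).symm
        (TensorProduct.map LinearMap.id (toTensor D.coact.toLinearMap) t) := by
  induction t using TensorProduct.induction_on with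
  | zero => simp
  | tmul a b =>
    have h : comulRight grA D (tmul k a b) =
      includeLeft (tensorGr grA grH) grH (includeLeft grA grH a) *
        includeLastTwo grH grA (of k grH grH (toTensor D.coact.toLinearMap b)) := rfl
    rw [h, TensorProduct.map_tmul, LinearMap.id_apply]
    induction toTensor D.coact.toLinearMap b using TensorProduct.induction_on with
    | zero => simp
    | tmul b c =>
      have h : includeLastTwo grH grA (tmul k b c) =
        includeLeft (tensorGr grA grH) grH (includeRight grA grH b) *
          includeRight (tensorGr grA grH) grH c := rfl
      rw [h, ← mul_assoc, ← map_mul, includeLeft_mul_includeRight, includeLeft_mul_includeRight]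
      rfl
    | add x y hx hy => simp only [map_add, mul_add, hx, hy, TensorProduct.tmul_add]
  | add x y hx hy => simp only [map_add, hx, hy]

/-- Both sides are algebra morphisms, so they are compared on a and da. There each is a sum of
images of the double coaction of A, and coassociativity of `δ` applies term by term. -/
theorem coactLeft_comp_coact : K.coactLeft.comp K.coact = (comulRight grA D).comp K.coact := by
  have hco : ∀ a, TensorProduct.map δ.coact.toLinearMap LinearMap.id (δ.coact a) =
      (TensorProduct.assoc k A H H).symm
        (TensorProduct.map LinearMap.id Coalgebra.comul (δ.coact a)) := fun a => by
    rw [LinearEquiv.eq_symm_apply]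
    exact LinearMap.congr_fun δ.coassoc a
  -- Evaluated at δ(a), this is f(a₀) ⊗ g(a₁) ⊗ h(a₂). The maps will be inclusions, with at most one
  -- of them followed by the differential.
  let F (f : A →ₗ[k] ΩA) (g h : H →ₗ[k] ΩH) : A ⊗[k] H →ₗ[k] (ΩA ⊗[k] ΩH) ⊗[k] ΩH :=
    TensorProduct.map (TensorProduct.map f g) h ∘ₗ
      TensorProduct.map δ.coact.toLinearMap LinearMap.id
  have hF : ∀ (f : A →ₗ[k] ΩA) (g h : H →ₗ[k] ΩH) (a : A), F f g h (δ.coact a) =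
      (TensorProduct.assoc k ΩA ΩH ΩH).symm (TensorProduct.map f (TensorProduct.map g h)
        (TensorProduct.map LinearMap.id Coalgebra.comul (δ.coact a))) := by
    intro f g h a
    simp only [F, LinearMap.comp_apply, hco]
    induction TensorProduct.map LinearMap.id Coalgebra.comul (δ.coact a)
      using TensorProduct.induction_on with
    | zero => simp
    | tmul x t =>
      induction t using TensorProduct.induction_on with
      | zero => simp
      | tmul y z => simp
      | add x y hx hy => simp only [map_add, TensorProduct.tmul_add, hx, hy]
    | add x y hx hy => simp only [map_add, hx, hy]
  refine CA.algHom_ext (fun a => (threefold grH grA).injective ?_)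
    (fun a => (threefold grH grA).injective ?_)
  · rw [AlgHom.comp_apply, AlgHom.comp_apply, coact_incl_eq, threefold_coactLeft,
      threefold_comulRight]
    trans F CA.incl.toLinearMap CH.incl.toLinearMap CH.incl.toLinearMap (δ.coact a)
    · induction δ.coact a using TensorProduct.induction_on with
      | zero => simp
      | tmul x h => simp [F, K.coact_incl]
      | add x y hx hy => simp only [map_add, hx, hy]
    · rw [hF]
      congr 1
      induction δ.coact a using TensorProduct.induction_on with
      | zero => simp
      | tmul x h =>
        have := D.coact_incl h
        simp only [TensorProduct.map_tmul, this, LinearMap.id_apply, AlgHom.toLinearMap_apply]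
        rfl
      | add x y hx hy => simp only [map_add, hx, hy]
  · have hK : ∀ x, toTensor K.coact.toLinearMap (CA.d (CA.incl x)) = _ := K.coact_d_incl
    have hD : ∀ x, toTensor D.coact.toLinearMap (CH.d (CH.incl x)) = _ := D.coact_d_incl
    rw [AlgHom.comp_apply, AlgHom.comp_apply, coact_d_incl, threefold_coactLeft,
      threefold_comulRight]
    -- One summand for each tensor factor on which the differential can fall; no signs occur since
    -- the other factors have degree zero.
    trans F (CA.d ∘ₗ CA.incl.toLinearMap) CH.incl.toLinearMap CH.incl.toLinearMap (δ.coact a) +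
      F CA.incl.toLinearMap (CH.d ∘ₗ CH.incl.toLinearMap) CH.incl.toLinearMap (δ.coact a) +
      F CA.incl.toLinearMap CH.incl.toLinearMap (CH.d ∘ₗ CH.incl.toLinearMap) (δ.coact a)
    · rw [map_add]
      congr 1
      · induction δ.coact a using TensorProduct.induction_on with
        | zero => simp
        | tmul x h =>
          simp only [TensorProduct.map_tmul, LinearMap.comp_apply, AlgHom.toLinearMap_apply, hK, F,
            LinearMap.id_apply]
          exact TensorProduct.add_tmul _ _ _
        | add x y hx hy => simp only [map_add, hx, hy]; abel
      · induction δ.coact a using TensorProduct.induction_on with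
        | zero => simp
        | tmul x h => simp [F, K.coact_incl]
        | add x y hx hy => simp only [map_add, hx, hy]
    · rw [hF, hF, hF, map_add, map_add, add_assoc, ← map_add (TensorProduct.assoc k ΩA ΩH ΩH).symm]
      congr 2
      · induction δ.coact a using TensorProduct.induction_on with
        | zero => simp
        | tmul x h =>
          simp only [TensorProduct.map_tmul, D.coact_incl, LinearMap.id_apply,
            AlgHom.toLinearMap_apply, LinearMap.comp_apply]
          rfl
        | add x y hx hy => simp only [map_add, hx, hy]
      · induction δ.coact a using TensorProduct.induction_on with
        | zero => simp
        | tmul x h =>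
          simp only [TensorProduct.map_tmul, LinearMap.comp_apply, AlgHom.toLinearMap_apply, hD,
            LinearMap.id_apply]
          exact (TensorProduct.tmul_add _ _ _).symm
        | add x y hx hy => simp only [map_add] at hx hy ⊢; rw [← hx, ← hy]; abel

/-- The extended coaction is coassociative. -/
theorem coassoc : (TensorProduct.assoc k ΩA ΩH ΩH).toLinearMap ∘ₗ
      TensorProduct.map (toTensor K.coact.toLinearMap) LinearMap.id ∘ₗ
        toTensor K.coact.toLinearMap =
    TensorProduct.map LinearMap.id (toTensor D.coact.toLinearMap) ∘ₗ
      toTensor K.coact.toLinearMap := by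
  ext ω
  have h := congrArg (threefold grH grA) (AlgHom.congr_fun (K.coactLeft_comp_coact D) ω)
  have h1 := K.threefold_coactLeft (toTensor K.coact.toLinearMap ω)
  have h2 := threefold_comulRight (grA := grA) D (toTensor K.coact.toLinearMap ω)
  have h3 := h1.symm.trans (h.trans h2)
  rw [LinearEquiv.eq_symm_apply] at h3
  exact h3

end Coassoc

/-! ### Counitality of the extended coaction -/

section Counit

variable (K : CompleteCalculus δ CH CA)

variable (CH) in
/-- The counit of `H`, extended by zero to the forms of positive degree. -/
def formCounit : ΩH →ₐ[k] k := (Bialgebra.counitAlgHom k H).comp CH.degZero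

theorem formCounit_incl (h : H) : formCounit CH (CH.incl h) = Coalgebra.counit h := by
  simp [formCounit]

theorem formCounit_of_mem {n : ℕ} (hn : n ≠ 0) {ω : ΩH} (hω : ω ∈ grH n) :
    formCounit CH ω = 0 := by
  rw [formCounit, AlgHom.comp_apply, CH.degZero_of_mem hn hω, map_zero]

theorem formCounit_d (h : H) : formCounit CH (CH.d (CH.incl h)) = 0 :=
  formCounit_of_mem one_ne_zero (CH.d_mem 0 _ (CH.incl_mem_zero h))

variable (grA CH) in
/-- The morphism `id ⊗ ε` on the graded tensor product. -/
def counitRight : grA ᵍ⊗[k] grH →ₐ[k] ΩA :=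
  lift grA grH (AlgHom.id k ΩA) ((Algebra.ofId k ΩA).comp (formCounit CH)) fun i j a b => by
    rw [units_smul_eq (k := k)]
    obtain rfl | hj := eq_or_ne j 0
    · simpa using (Algebra.commutes _ _).symm
    · simp [formCounit_of_mem hj b.2]

theorem counitRight_of (t : ΩA ⊗[k] ΩH) : counitRight grA CH (of k grA grH t) =
    TensorProduct.rid k ΩA (TensorProduct.map LinearMap.id (formCounit CH).toLinearMap t) := by
  induction t using TensorProduct.induction_on with
  | zero => simp
  | tmul a b =>
    change a * algebraMap k ΩA (formCounit CH b) = _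
    rw [← Algebra.commutes, ← Algebra.smul_def]
    simp
  | add x y hx hy => simp only [map_add, hx, hy]

/-- Checked on generators: for da the summand a₀ ⊗ da₁ dies because the counit vanishes in positive
degree, and the counit axiom of `δ` handles the rest. -/
theorem counit : (TensorProduct.rid k ΩA).toLinearMap ∘ₗ
    TensorProduct.map LinearMap.id (formCounit CH).toLinearMap ∘ₗ
      toTensor K.coact.toLinearMap = LinearMap.id := by
  have hδ : ∀ (f : A →ₗ[k] ΩA) (a : A), TensorProduct.rid k ΩA
      (TensorProduct.map f Coalgebra.counit (δ.coact a)) = f a := fun f a => by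
    conv_rhs => rw [← LinearMap.id_apply (R := k) a, ← δ.counit]
    simp only [LinearMap.comp_apply, AlgHom.toLinearMap_apply]
    induction δ.coact a using TensorProduct.induction_on with
    | zero => simp
    | tmul x h => simp
    | add x y hx hy => simp only [map_add, hx, hy]
  have h : (counitRight grA CH).comp K.coact = AlgHom.id k ΩA := by
    refine CA.algHom_ext (fun a => ?_) (fun a => ?_)
    · rw [AlgHom.comp_apply, coact_incl_eq, counitRight_of, AlgHom.id_apply]
      refine Eq.trans ?_ (hδ CA.incl.toLinearMap a)
      induction δ.coact a using TensorProduct.induction_on with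
      | zero => simp
      | tmul x h => simp [formCounit_incl]
      | add x y hx hy => simp only [map_add, hx, hy]
    · rw [AlgHom.comp_apply, coact_d_incl, counitRight_of, AlgHom.id_apply]
      refine Eq.trans ?_ (hδ (CA.d ∘ₗ CA.incl.toLinearMap) a)
      induction δ.coact a using TensorProduct.induction_on with
      | zero => simp
      | tmul x h => simp [formCounit_incl, formCounit_d]
      | add x y hx hy => simp only [map_add] at hx hy ⊢; rw [← hx, ← hy]; abel
  ext ω
  exact (counitRight_of _).symm.trans (AlgHom.congr_fun h ω)

variable (CH) in
/-- The morphism `ε ⊗ id` on the graded tensor square. -/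
def counitLeft : grH ᵍ⊗[k] grH →ₐ[k] ΩH :=
  lift grH grH ((Algebra.ofId k ΩH).comp (formCounit CH)) (AlgHom.id k ΩH) fun i j a b => by
    rw [units_smul_eq (k := k)]
    obtain rfl | hj := eq_or_ne i 0
    · simpa using (Algebra.commutes _ _)
    · simp [formCounit_of_mem hj a.2]

theorem counitLeft_of (t : ΩH ⊗[k] ΩH) : counitLeft CH (of k grH grH t) =
    TensorProduct.lid k ΩH (TensorProduct.map (formCounit CH).toLinearMap LinearMap.id t) := by
  induction t using TensorProduct.induction_on with
  | zero => simp
  | tmul a b =>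
    change algebraMap k ΩH (formCounit CH a) * b = _
    rw [← Algebra.smul_def]
    simp
  | add x y hx hy => simp only [map_add, hx, hy]

theorem counit_left (D : CompleteCalculus (RightComoduleAlgebra.regular k H) CH CH) :
    (TensorProduct.lid k ΩH).toLinearMap ∘ₗ
    TensorProduct.map (formCounit CH).toLinearMap LinearMap.id ∘ₗ
      toTensor D.coact.toLinearMap = LinearMap.id := by
  have hδ : ∀ (f : H →ₗ[k] ΩH) (a : H), TensorProduct.lid k ΩH
      (TensorProduct.map Coalgebra.counit f
        ((RightComoduleAlgebra.regular k H).coact a)) = f a := fun f a => by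
    have h1 : Coalgebra.counit.rTensor H (Coalgebra.comul (R := k) a) = 1 ⊗ₜ[k] a :=
      Coalgebra.rTensor_counit_comul (R := k) a
    have h2 := congrArg (fun t => TensorProduct.lid k ΩH (f.lTensor k t)) h1
    simp only [LinearMap.lTensor_tmul, TensorProduct.lid_tmul, one_smul] at h2
    rw [← h2]
    change _ = TensorProduct.lid k ΩH ((f.lTensor k ∘ₗ Coalgebra.counit.rTensor H) _)
    rw [LinearMap.lTensor_comp_rTensor]
    rfl
  have h : (counitLeft CH).comp D.coact = AlgHom.id k ΩH := by
    refine CH.algHom_ext (fun a => ?_) (fun a => ?_)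
    · rw [AlgHom.comp_apply, coact_incl_eq, counitLeft_of, AlgHom.id_apply]
      refine Eq.trans ?_ (hδ CH.incl.toLinearMap a)
      induction (RightComoduleAlgebra.regular k H).coact a using TensorProduct.induction_on with
      | zero => simp
      | tmul x h => simp [formCounit_incl]
      | add x y hx hy => simp only [map_add, hx, hy]
    · rw [AlgHom.comp_apply, coact_d_incl, counitLeft_of, AlgHom.id_apply]
      refine Eq.trans ?_ (hδ (CH.d ∘ₗ CH.incl.toLinearMap) a)
      induction (RightComoduleAlgebra.regular k H).coact a using TensorProduct.induction_on with
      | zero => simp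
      | tmul x h => simp [formCounit_incl, formCounit_d]
      | add x y hx hy => simp only [map_add] at hx hy ⊢; rw [← hx, ← hy]; abel
  ext ω
  exact (counitLeft_of _).symm.trans (AlgHom.congr_fun h ω)

end Counit

end CompleteCalculus

/-! ### The comultiplication of the maximal prolongation -/

namespace DifferentialCalculus

open GradedTensorProduct

section Comul

variable {k H : Type*} {Ω : Type v} [Field k] [Ring H] [HopfAlgebra k H] [Ring Ω] [Algebra k Ω]
  {gr : ℕ → Submodule k Ω} [GradedAlgebra gr]

/-- The morphism `H → Ω(H) ⊗ Ω(H)` given by the comultiplication of `H`. -/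
def comulZero (C : DifferentialCalculus k H gr) : H →ₐ[k] gr ᵍ⊗[k] gr :=
  (Algebra.TensorProduct.lift ((includeLeft gr gr).comp C.incl) ((includeRight gr gr).comp C.incl)
    fun x y => by
      have h := includeLeft_commute (C.incl_mem_zero x) (C.incl_mem_zero y)
      rwa [mul_zero, pow_zero, one_smul] at h).comp (Bialgebra.comulAlgHom k H)

theorem comulZero_apply (C : DifferentialCalculus k H gr) (h : H) :
    C.comulZero h = of k gr gr (TensorProduct.map C.incl.toLinearMap C.incl.toLinearMap
      (Coalgebra.comul (R := k) h)) := by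
  simp only [comulZero, AlgHom.comp_apply, Bialgebra.comulAlgHom_apply]
  induction Coalgebra.comul (R := k) h using TensorProduct.induction_on with
  | zero => simp
  | tmul x y => exact includeLeft_mul_includeRight _ _
  | add x y hx hy => simp only [map_add, hx, hy]

theorem comulZero_mem (C : DifferentialCalculus k H gr) (h : H) :
    C.comulZero h ∈ tensorGr gr gr 0 := by
  rw [comulZero_apply]
  induction Coalgebra.comul (R := k) h using TensorProduct.induction_on with
  | zero => rw [map_zero, map_zero]; exact zero_mem _
  | tmul x y =>
    have := tmul_mem_tensorGr (C.incl_mem_zero x) (C.incl_mem_zero y)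
    rwa [zero_add] at this
  | add x y hx hy => rw [map_add, map_add]; exact add_mem hx hy

/-- The morphism ε ⊗ id is a retraction. Injectivity makes the generated differential algebra a
calculus on H itself, as maximality requires. -/
theorem comulZero_injective (C : DifferentialCalculus k H gr) :
    Function.Injective C.comulZero := by
  intro x y h
  refine C.incl_injective ?_
  have key : ∀ x, CompleteCalculus.counitLeft C (C.comulZero x) = C.incl x := fun x => by
    rw [comulZero_apply, CompleteCalculus.counitLeft_of]
    have h1 : Coalgebra.counit.rTensor H (Coalgebra.comul (R := k) x) = 1 ⊗ₜ[k] x :=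
      Coalgebra.rTensor_counit_comul (R := k) x
    have h2 := congrArg (fun t => TensorProduct.lid k Ω (C.incl.toLinearMap.lTensor k t)) h1
    simp only [LinearMap.lTensor_tmul, TensorProduct.lid_tmul, one_smul] at h2
    refine Eq.trans ?_ h2
    induction Coalgebra.comul (R := k) x using TensorProduct.induction_on with
    | zero => simp
    | tmul x y => simp [CompleteCalculus.formCounit_incl]
    | add x y hx hy => simp only [map_add, hx, hy]
  rw [← key x, ← key y, h]

theorem tensorD_comulZero (C : DifferentialCalculus k H gr) (h : H) :
    tensorD gr gr C.d C.d (C.comulZero h) = of k gr gr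
      (TensorProduct.map (C.d ∘ₗ C.incl.toLinearMap) C.incl.toLinearMap
          (Coalgebra.comul (R := k) h) +
        TensorProduct.map C.incl.toLinearMap (C.d ∘ₗ C.incl.toLinearMap)
          (Coalgebra.comul (R := k) h)) := by
  rw [comulZero_apply]
  induction Coalgebra.comul (R := k) h using TensorProduct.induction_on with
  | zero => simp
  | tmul x h =>
    have := tensorD_tmul_of_mem (gr' := gr) C.d C.d (C.incl_mem_zero x) (C.incl h)
    simpa [tmul] using this
  | add x y hx hy => simp only [map_add, hx, hy]; abel

/-- Covariance is stated with the ungraded product of H ⊗ Ω(H). The products involved agree with the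
graded ones, since the factor that crosses has degree zero. -/
theorem of_map_mul_left (C : DifferentialCalculus k H gr) (x : H ⊗[k] H) (y : H ⊗[k] Ω) :
    of k gr gr (TensorProduct.map C.incl.toLinearMap LinearMap.id
        (TensorProduct.map LinearMap.id C.incl.toLinearMap x * y)) =
      of k gr gr (TensorProduct.map C.incl.toLinearMap C.incl.toLinearMap x) *
        of k gr gr (TensorProduct.map C.incl.toLinearMap LinearMap.id y) := by
  induction x using TensorProduct.induction_on with
  | zero => simp
  | add x x' hx hx' => simp only [map_add, add_mul, hx, hx']
  | tmul a b =>
    induction y using TensorProduct.induction_on with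
    | zero => simp
    | add x x' hx hx' => simp only [map_add, mul_add, hx, hx']
    | tmul c ω =>
      have := tmul_mul_tmul_left (k := k) (gr := gr) (C.incl_mem_zero b) (C.incl a) (C.incl c) ω
      simpa using this.symm

theorem of_map_mul_right (C : DifferentialCalculus k H gr) (x : H ⊗[k] H) (y : Ω ⊗[k] H) :
    of k gr gr (TensorProduct.map LinearMap.id C.incl.toLinearMap
        (TensorProduct.map C.incl.toLinearMap LinearMap.id x * y)) =
      of k gr gr (TensorProduct.map C.incl.toLinearMap C.incl.toLinearMap x) *
        of k gr gr (TensorProduct.map LinearMap.id C.incl.toLinearMap y) := by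
  induction x using TensorProduct.induction_on with
  | zero => simp
  | add x x' hx hx' => simp only [map_add, add_mul, hx, hx']
  | tmul a b =>
    induction y using TensorProduct.induction_on with
    | zero => simp
    | add x x' hx hx' => simp only [map_add, mul_add, hx, hx']
    | tmul ω c =>
      have := tmul_mul_tmul_left (k := k) (gr := gr) (C.incl_mem_zero b) (C.incl a) ω (C.incl c)
      simpa using this.symm

/-- The comultiplication of `H` extends to the maximal prolongation of a bicovariant calculus. -/
theorem exists_comul {C : DifferentialCalculus k H gr} (hbicov : C.IsBicovariant)
    (hmax : C.IsMaximalProlongation) :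
    Nonempty (CompleteCalculus (RightComoduleAlgebra.regular k H) C C) := by
  obtain ⟨⟨cL, -, hL1, hL2, hL3⟩, ⟨cR, -, -, hR2, hR3⟩⟩ := hbicov
  let p : Ω →ₗ[k] gr 1 := (GradedAlgebra.proj gr 1).codRestrict (gr 1) (proj_mem gr 1)
  have hp : ∀ x (hx : x ∈ gr 1), p x = ⟨x, hx⟩ := fun x hx => Subtype.ext (proj_of_mem hx)
  -- On one-forms the comultiplication must be the sum of the left and the right coaction, by the
  -- Leibniz rule for dΔ(h).
  let e : Ω →ₗ[k] gr ᵍ⊗[k] gr := (of k gr gr).toLinearMap ∘ₗ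
    (TensorProduct.map C.incl.toLinearMap LinearMap.id ∘ₗ
        TensorProduct.map LinearMap.id (gr 1).subtype ∘ₗ cL +
      TensorProduct.map LinearMap.id C.incl.toLinearMap ∘ₗ
        TensorProduct.map (gr 1).subtype LinearMap.id ∘ₗ cR) ∘ₗ p
  have he : ∀ a b, e (C.incl a * C.d (C.incl b)) =
      C.comulZero a * tensorD gr gr C.d C.d (C.comulZero b) := by
    intro a b
    have hb : C.d (C.incl b) ∈ gr 1 := C.d_mem 0 _ (C.incl_mem_zero b)
    have hab : C.incl a * C.d (C.incl b) ∈ gr 1 := by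
      simpa using SetLike.mul_mem_graded (C.incl_mem_zero a) hb
    have h1 := hL2 a 1 ⟨_, hb⟩ ⟨_, hab⟩ (by simp)
    have h2 := hR2 a 1 ⟨_, hb⟩ ⟨_, hab⟩ (by simp)
    rw [hL3 b ⟨_, hb⟩ rfl, Bialgebra.comul_one, Algebra.TensorProduct.one_def,
      TensorProduct.map_tmul, LinearMap.id_apply, AlgHom.toLinearMap_apply, map_one,
      ← Algebra.TensorProduct.one_def, mul_one] at h1
    rw [hR3 b ⟨_, hb⟩ rfl, Bialgebra.comul_one, Algebra.TensorProduct.one_def,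
      TensorProduct.map_tmul, LinearMap.id_apply, AlgHom.toLinearMap_apply, map_one,
      ← Algebra.TensorProduct.one_def, mul_one] at h2
    simp only [e, LinearMap.comp_apply, LinearMap.add_apply, hp _ hab, h1, h2,
      LinearEquiv.coe_coe, map_add]
    rw [of_map_mul_left, of_map_mul_right, ← mul_add, comulZero_apply, tensorD_comulZero, add_comm,
      map_add]
    congr 3
    · rw [← LinearMap.comp_apply, ← TensorProduct.map_comp]; rfl
    · rw [← LinearMap.comp_apply, ← TensorProduct.map_comp]; rfl
  -- Applying ε ⊗ id kills the right coaction, whose first factor is a one-form, and turns the left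
  -- coaction back into `x`.
  have he' : ∀ x ∈ gr 1, e x = 0 → x = 0 := by
    intro x hx h
    have h1 := congrArg (CompleteCalculus.counitLeft C) h
    simp only [e, LinearMap.comp_apply, LinearEquiv.coe_coe, hp x hx,
      CompleteCalculus.counitLeft_of, LinearMap.add_apply, map_add, map_zero] at h1
    have h2 : TensorProduct.map (CompleteCalculus.formCounit C).toLinearMap LinearMap.id
        (TensorProduct.map LinearMap.id C.incl.toLinearMap
          (TensorProduct.map (gr 1).subtype LinearMap.id (cR ⟨x, hx⟩))) = 0 := by
      induction cR ⟨x, hx⟩ using TensorProduct.induction_on with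
      | zero => simp
      | tmul y z => simp [CompleteCalculus.formCounit_of_mem one_ne_zero y.2]
      | add y z hy hz => simp only [map_add, hy, hz, add_zero]
    rw [h2, map_zero, add_zero] at h1
    have h3 := congrArg (gr 1).subtype (LinearMap.congr_fun hL1 ⟨x, hx⟩)
    change _ = x at h3
    rw [← h3, ← h1]
    simp only [LinearMap.comp_apply, LinearEquiv.coe_coe]
    induction cL ⟨x, hx⟩ using TensorProduct.induction_on with
    | zero => simp
    | tmul y z => simp [CompleteCalculus.formCounit_incl]
    | add y z hy hz => simp only [map_add, hy, hz]
  obtain ⟨φ, h1, h2, h3⟩ := hmax.exists_lift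
    (C.isDifferential.tensorD C.isDifferential) C.comulZero_mem C.comulZero_injective e he he'
  exact ⟨⟨φ, h1, h2, fun a => (h3 a).trans (C.comulZero_apply a)⟩⟩

end Comul

end DifferentialCalculus

/-! ### Convolution inverses on graded coalgebras -/

section GradedCoalgebra

open WithConv

variable {k Ω R : Type*} [Field k] [Ring Ω] [Algebra k Ω] [Ring R] [Algebra k R]

theorem convSum_apply {ι : Type*} (s : Finset ι) (f : ι → WithConv (Ω →ₗ[k] R)) (ω : Ω) :
    (∑ i ∈ s, f i) ω = ∑ i ∈ s, f i ω := by
  classical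
  induction s using Finset.induction_on with
  | empty => simp
  | insert i s hi ih =>
    rw [Finset.sum_insert hi, Finset.sum_insert hi, ← ih]; rfl

/-- The coalgebra structure is compatible with the grading. -/
structure IsGradedCoalgebra (gr : ℕ → Submodule k Ω) [Coalgebra k Ω] : Prop where
  comul_mem : ∀ (n : ℕ) (ω : Ω), ω ∈ gr n → Coalgebra.comul (R := k) ω ∈
    Submodule.span k {t | ∃ (i j : ℕ) (a b : Ω), i + j = n ∧ a ∈ gr i ∧ b ∈ gr j ∧ t = a ⊗ₜ[k] b}
  counit_eq_zero : ∀ (n : ℕ) (ω : Ω), 0 < n → ω ∈ gr n → Coalgebra.counit (R := k) ω = 0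

variable {gr : ℕ → Submodule k Ω} {grR : ℕ → Submodule k R} [Coalgebra k Ω]

namespace IsGradedCoalgebra

theorem apply_comul_mem (h : IsGradedCoalgebra gr) {X : Type*} [AddCommGroup X] [Module k X]
    (F : Ω ⊗[k] Ω →ₗ[k] X) (M : Submodule k X) {n : ℕ}
    (hF : ∀ i j, i + j = n → ∀ a ∈ gr i, ∀ b ∈ gr j, F (a ⊗ₜ b) ∈ M) {ω : Ω} (hω : ω ∈ gr n) :
    F (Coalgebra.comul (R := k) ω) ∈ M := by
  suffices Submodule.span k _ ≤ M.comap F from this (h.comul_mem n ω hω)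
  rw [Submodule.span_le]
  rintro _ ⟨i, j, a, b, hij, ha, hb, rfl⟩
  exact hF i j hij a ha b hb

theorem conv_mem (h : IsGradedCoalgebra gr) (f g : WithConv (Ω →ₗ[k] R)) (M : Submodule k R) {n : ℕ}
    (hF : ∀ i j, i + j = n → ∀ a ∈ gr i, ∀ b ∈ gr j, f a * g b ∈ M) {ω : Ω} (hω : ω ∈ gr n) :
    (f * g) ω ∈ M := by
  rw [LinearMap.convMul_apply]
  exact h.apply_comul_mem (LinearMap.mul' k R ∘ₗ TensorProduct.map f.ofConv g.ofConv) M
    (fun i j hij a ha b hb => by simpa using hF i j hij a ha b hb) hω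

theorem conv_congr (h : IsGradedCoalgebra gr) {f g f' g' : WithConv (Ω →ₗ[k] R)} {n : ℕ}
    (hf : ∀ i ≤ n, ∀ a ∈ gr i, f a = f' a) (hg : ∀ i ≤ n, ∀ a ∈ gr i, g a = g' a)
    {ω : Ω} (hω : ω ∈ gr n) : (f * g) ω = (f' * g') ω := by
  rw [← sub_eq_zero, ← Submodule.mem_bot k, LinearMap.convMul_apply, LinearMap.convMul_apply]
  refine h.apply_comul_mem (LinearMap.mul' k R ∘ₗ TensorProduct.map f.ofConv g.ofConv -
    LinearMap.mul' k R ∘ₗ TensorProduct.map f'.ofConv g'.ofConv) ⊥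
    (fun i j hij a ha b hb => ?_) hω
  simp [hf i (by omega) a ha, hg j (by omega) b hb]

theorem conv_degree (h : IsGradedCoalgebra gr) [SetLike.GradedMonoid grR]
    {f g : WithConv (Ω →ₗ[k] R)} (hf : ∀ n, ∀ ω ∈ gr n, f ω ∈ grR n)
    (hg : ∀ n, ∀ ω ∈ gr n, g ω ∈ grR n) (n : ℕ) (ω : Ω) (hω : ω ∈ gr n) :
    (f * g) ω ∈ grR n := by
  refine h.conv_mem f g (grR n) ?_ hω
  rintro i j rfl a ha b hb
  exact SetLike.mul_mem_graded (hf i a ha) (hg j b hb)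

theorem one_degree (h : IsGradedCoalgebra gr) [SetLike.GradedMonoid grR] (n : ℕ) (ω : Ω)
    (hω : ω ∈ gr n) : (1 : WithConv (Ω →ₗ[k] R)) ω ∈ grR n := by
  rw [LinearMap.convOne_apply]
  obtain rfl | hn := Nat.eq_zero_or_pos n
  · rw [Algebra.algebraMap_eq_smul_one]
    exact Submodule.smul_mem _ _ SetLike.GradedOne.one_mem
  · rw [h.counit_eq_zero n ω hn hω, map_zero]; exact zero_mem _

theorem pow_degree (h : IsGradedCoalgebra gr) [SetLike.GradedMonoid grR]
    {f : WithConv (Ω →ₗ[k] R)} (hf : ∀ n, ∀ ω ∈ gr n, f ω ∈ grR n) (i : ℕ) :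
    ∀ n, ∀ ω ∈ gr n, (f ^ i) ω ∈ grR n := by
  induction i with
  | zero => rw [pow_zero]; exact h.one_degree
  | succ i ih => rw [pow_succ]; exact h.conv_degree ih hf

/-- Orders of vanishing add under convolution; this is the source of the local nilpotence used to
sum the geometric series. -/
theorem conv_eq_zero (h : IsGradedCoalgebra gr) {f g : WithConv (Ω →ₗ[k] R)} {p : ℕ}
    (hf : ∀ i < p, ∀ ω ∈ gr i, f ω = 0) (q : ℕ) (hg : ∀ i < q, ∀ ω ∈ gr i, g ω = 0) {n : ℕ}
    (hn : n < p + q) {ω : Ω} (hω : ω ∈ gr n) : (f * g) ω = 0 := by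
  refine (Submodule.mem_bot k).1 (h.conv_mem f g ⊥ (fun i j hij a ha b hb => ?_) hω)
  rw [Submodule.mem_bot]
  by_cases hi : i < p
  · rw [hf i hi a ha, zero_mul]
  · rw [hg j (by omega) b hb, mul_zero]

theorem pow_eq_zero (h : IsGradedCoalgebra gr) {f : WithConv (Ω →ₗ[k] R)}
    (hf : ∀ ω ∈ gr 0, f ω = 0) (m : ℕ) : ∀ n < m, ∀ ω ∈ gr n, (f ^ m) ω = 0 := by
  induction m with
  | zero => intro n hn; omega
  | succ m ih =>
    intro n hn ω hω
    rw [pow_succ]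
    refine h.conv_eq_zero ih 1 (fun i hi => ?_) hn hω
    obtain rfl : i = 0 := by omega
    exact hf

/-- A map that is left convolution invertible in degree zero is left convolution invertible. -/
theorem exists_leftInverse (h : IsGradedCoalgebra gr) [GradedAlgebra gr] [SetLike.GradedMonoid grR]
    {f s : WithConv (Ω →ₗ[k] R)} (hf : ∀ n, ∀ ω ∈ gr n, f ω ∈ grR n)
    (hs : ∀ n, ∀ ω ∈ gr n, s ω ∈ grR n)
    (hsf : ∀ ω ∈ gr 0, (s * f) ω = (1 : WithConv (Ω →ₗ[k] R)) ω) :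
    ∃ l : WithConv (Ω →ₗ[k] R), (∀ n, ∀ ω ∈ gr n, l ω ∈ grR n) ∧ l * f = 1 ∧
      ∀ ω ∈ gr 0, l ω = s ω := by
  -- Since s * f = 1 − ν and ν vanishes in degree zero, νᵐ vanishes in degrees below m. Hence the
  -- series Σ νⁱ * s is finite in each degree and is a left inverse of f.
  set ν : WithConv (Ω →ₗ[k] R) := 1 - s * f with hν
  have hν0 : ∀ ω ∈ gr 0, ν ω = 0 := fun ω hω => by
    change (1 : WithConv (Ω →ₗ[k] R)) ω - (s * f) ω = 0
    rw [hsf ω hω, sub_self]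
  have hνdeg : ∀ n, ∀ ω ∈ gr n, ν ω ∈ grR n := fun n ω hω =>
    sub_mem (h.one_degree n ω hω) (h.conv_degree hs hf n ω hω)
  let L (m : ℕ) : WithConv (Ω →ₗ[k] R) := (∑ i ∈ Finset.range (m + 1), ν ^ i) * s
  -- The limit of the series: on degree n the terms with i ≤ n suffice.
  let l : WithConv (Ω →ₗ[k] R) := toConv
    (DirectSum.toModule k ℕ R (fun n => (L n).ofConv ∘ₗ (gr n).subtype) ∘ₗ
      (DirectSum.decomposeLinearEquiv gr).toLinearMap)
  have hl : ∀ n, ∀ ω ∈ gr n, l ω = L n ω := fun n ω hω => by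
    change DirectSum.toModule k ℕ R _ (DirectSum.decompose gr ω) = _
    rw [DirectSum.decompose_of_mem gr hω, ← DirectSum.lof_eq_of k, DirectSum.toModule_lof]
    rfl
  have hL : ∀ n, ∀ m ≥ n, ∀ ω ∈ gr n, L m ω = L n ω := by
    intro n m hm
    induction m, hm using Nat.le_induction with
    | base => exact fun _ _ => rfl
    | succ m hm ih =>
      intro ω hω
      rw [← ih ω hω]
      have h1 : L (m + 1) = L m + ν ^ (m + 1) * s := by
        change (∑ i ∈ Finset.range (m + 1 + 1), ν ^ i) * s = _
        rw [Finset.sum_range_succ, add_mul]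
      have h2 : (ν ^ (m + 1) * s) ω = 0 :=
        h.conv_eq_zero (h.pow_eq_zero hν0 (m + 1)) 0 (fun i hi => by omega) (n := n) (by omega) hω
      rw [h1]
      change L m ω + (ν ^ (m + 1) * s) ω = _
      rw [h2, add_zero]
  refine ⟨l, fun n ω hω => ?_, ?_, fun ω hω => ?_⟩
  · rw [hl n ω hω]
    refine h.conv_degree (fun n ω hω => ?_) hs n ω hω
    rw [convSum_apply]
    exact sum_mem fun i _ => h.pow_degree hνdeg i n ω hω
  · refine WithConv.ext (linearMap_ext_homogeneous gr fun n ω hω => ?_)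
    have h1 : (l * f) ω = (L n * f) ω :=
      h.conv_congr (fun i hi a ha => by rw [hl i a ha, hL i n hi a ha]) (fun _ _ _ _ => rfl) hω
    have h2 : L n * f = 1 - ν ^ (n + 1) := by
      change (∑ i ∈ Finset.range (n + 1), ν ^ i) * s * f = _
      rw [mul_assoc, show s * f = 1 - ν by rw [hν, sub_sub_cancel], geom_sum_mul_neg]
    refine h1.trans ?_
    rw [h2]
    change (1 : WithConv (Ω →ₗ[k] R)) ω - (ν ^ (n + 1)) ω = _
    rw [h.pow_eq_zero hν0 (n + 1) n (Nat.lt_succ_self n) ω hω, sub_zero]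
  · rw [hl 0 ω hω]
    change ((∑ i ∈ Finset.range 1, ν ^ i) * s) ω = s ω
    simp

/-- A map that is convolution invertible in degree zero is convolution invertible. -/
theorem exists_inverse (h : IsGradedCoalgebra gr) [GradedAlgebra gr] [SetLike.GradedMonoid grR]
    {f s : WithConv (Ω →ₗ[k] R)} (hf : ∀ n, ∀ ω ∈ gr n, f ω ∈ grR n)
    (hs : ∀ n, ∀ ω ∈ gr n, s ω ∈ grR n)
    (hsf : ∀ ω ∈ gr 0, (s * f) ω = (1 : WithConv (Ω →ₗ[k] R)) ω)
    (hfs : ∀ ω ∈ gr 0, (f * s) ω = (1 : WithConv (Ω →ₗ[k] R)) ω) :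
    ∃ l : WithConv (Ω →ₗ[k] R), (∀ n, ∀ ω ∈ gr n, l ω ∈ grR n) ∧ l * f = 1 ∧ f * l = 1 ∧
      ∀ ω ∈ gr 0, l ω = s ω := by
  obtain ⟨l, hl, hlf, hls⟩ := h.exists_leftInverse hf hs hsf
  -- The left inverse `l` agrees with `s` in degree zero, so it has a left inverse in turn; the
  -- latter must be `f`.
  obtain ⟨l', -, hl', -⟩ := h.exists_leftInverse (f := l) (s := f) hl hf fun ω hω => by
    rw [← hfs ω hω]
    refine h.conv_congr (fun _ _ _ _ => rfl) (fun i hi a ha => ?_) hω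
    obtain rfl : i = 0 := by omega
    exact hls a ha
  have : l' = f := by rw [← mul_one l', ← hlf, ← mul_assoc, hl', one_mul]
  exact ⟨l, hl, hlf, this ▸ hl', hls⟩

end IsGradedCoalgebra

end GradedCoalgebra

/-! ### Existence of the differential graded Hopf algebra structure -/

/-- A coalgebra structure with its counit axioms stated through the unitors. -/
abbrev coalgebraOfUnitors {k Q : Type*} [Field k] [AddCommGroup Q] [Module k Q]
    (c : Q →ₗ[k] Q ⊗[k] Q) (ε : Q →ₗ[k] k)
    (coassoc : (TensorProduct.assoc k Q Q Q).toLinearMap ∘ₗ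
        TensorProduct.map c LinearMap.id ∘ₗ c = TensorProduct.map LinearMap.id c ∘ₗ c)
    (left : (TensorProduct.lid k Q).toLinearMap ∘ₗ TensorProduct.map ε LinearMap.id ∘ₗ c =
      LinearMap.id)
    (right : (TensorProduct.rid k Q).toLinearMap ∘ₗ TensorProduct.map LinearMap.id ε ∘ₗ c =
      LinearMap.id) : Coalgebra k Q where
  comul := c
  counit := ε
  coassoc := coassoc
  rTensor_counit_comp_comul := by
    ext q
    refine (TensorProduct.lid k Q).injective ?_
    exact (LinearMap.congr_fun left q).trans (by simp)
  lTensor_counit_comp_comul := by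
    ext q
    refine (TensorProduct.rid k Q).injective ?_
    exact (LinearMap.congr_fun right q).trans (by simp)

section Existence

variable {k H : Type*} {Ω : Type v} [Field k] [Ring H] [HopfAlgebra k H] [Ring Ω] [Algebra k Ω]
  {gr : ℕ → Submodule k Ω} [GradedAlgebra gr] {C : DifferentialCalculus k H gr}

/-- The coalgebra structure given by an extension of the comultiplication. -/
abbrev CompleteCalculus.coalgebra
    (D : CompleteCalculus (RightComoduleAlgebra.regular k H) C C) : Coalgebra k Ω :=
  coalgebraOfUnitors (toTensor D.coact.toLinearMap) (CompleteCalculus.formCounit C).toLinearMap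
    (D.coassoc D) (CompleteCalculus.counit_left D) D.counit

theorem CompleteCalculus.isGradedCoalgebra
    (D : CompleteCalculus (RightComoduleAlgebra.regular k H) C C) :
    letI := D.coalgebra
    IsGradedCoalgebra gr :=
  letI := D.coalgebra
  { comul_mem := D.coact_mem
    counit_eq_zero := fun _ _ hn hω => CompleteCalculus.formCounit_of_mem hn.ne' hω }

open WithConv in
/-- The differential graded Hopf algebra structure on the maximal prolongation of a bicovariant
first order calculus. -/
theorem DifferentialCalculus.nonempty_hopfExtension (hbicov : C.IsBicovariant)
    (hmax : C.IsMaximalProlongation) : Nonempty C.HopfExtension := by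
  obtain ⟨D⟩ := exists_comul hbicov hmax
  let _ := D.coalgebra
  -- The antipode of H extended by zero: a convolution inverse of the identity in degree zero only,
  -- which is then corrected in higher degrees.
  let s : WithConv (Ω →ₗ[k] Ω) :=
    toConv (C.incl.toLinearMap ∘ₗ HopfAlgebra.antipode k ∘ₗ C.degZero.toLinearMap)
  have hs_incl : ∀ h, s (C.incl h) = C.incl (HopfAlgebra.antipode k h) := fun h => by
    change C.incl (HopfAlgebra.antipode k (C.degZero (C.incl h))) = _
    rw [C.degZero_incl]
  have hcomul : ∀ h, Coalgebra.comul (R := k) (C.incl h) =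
    TensorProduct.map C.incl.toLinearMap C.incl.toLinearMap (Coalgebra.comul (R := k) h) :=
    D.coact_incl
  have hone : ∀ h, (1 : WithConv (Ω →ₗ[k] Ω)) (C.incl h) =
      algebraMap k Ω (Coalgebra.counit (R := k) h) := fun h =>
    congrArg (algebraMap k Ω) (CompleteCalculus.formCounit_incl h)
  obtain ⟨S, hSdeg, hS1, hS2, hS0⟩ := D.isGradedCoalgebra.exists_inverse (grR := gr)
    (f := toConv LinearMap.id) (s := s) (fun n ω hω => hω)
    (fun n ω hω => by
      obtain rfl | hn := eq_or_ne n 0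
      · obtain ⟨h, rfl⟩ := C.exists_incl_of_mem hω
        rw [hs_incl]; exact C.incl_mem_zero _
      · have : s ω = 0 := by
          change C.incl (HopfAlgebra.antipode k (C.degZero ω)) = 0
          rw [C.degZero_of_mem hn hω, map_zero, map_zero]
        rw [this]; exact zero_mem _)
    (fun ω hω => by
      obtain ⟨h, rfl⟩ := C.exists_incl_of_mem hω
      rw [LinearMap.convMul_apply, hcomul, hone, ← AlgHom.commutes C.incl,
        ← HopfAlgebra.mul_antipode_rTensor_comul_apply]
      induction Coalgebra.comul (R := k) h using TensorProduct.induction_on with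
      | zero => simp
      | tmul x y =>
        simp only [TensorProduct.map_tmul, AlgHom.toLinearMap_apply, LinearMap.mul'_apply,
          LinearMap.rTensor_tmul, map_mul]
        rw [hs_incl]; rfl
      | add x y hx hy => simp only [map_add, hx, hy])
    (fun ω hω => by
      obtain ⟨h, rfl⟩ := C.exists_incl_of_mem hω
      rw [LinearMap.convMul_apply, hcomul, hone, ← AlgHom.commutes C.incl,
        ← HopfAlgebra.mul_antipode_lTensor_comul_apply]
      induction Coalgebra.comul (R := k) h using TensorProduct.induction_on with
      | zero => simp
      | tmul x y =>
        simp only [TensorProduct.map_tmul, AlgHom.toLinearMap_apply, LinearMap.mul'_apply,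
          LinearMap.lTensor_tmul, map_mul]
        rw [hs_incl]; rfl
      | add x y hx hy => simp only [map_add, hx, hy])
  exact ⟨{
    comul := D.coact
    comul_mem := D.coact_mem
    comul_d := D.coact_d
    comul_incl := D.coact_incl
    counit := CompleteCalculus.formCounit C
    counit_incl := CompleteCalculus.formCounit_incl
    counit_eq_zero := fun _ _ hn hω => CompleteCalculus.formCounit_of_mem hn.ne' hω
    coassoc := D.coassoc D
    counit_comul := CompleteCalculus.counit_left D
    comul_counit := D.counit
    antipode := S.ofConv
    antipode_mem := hSdeg
    antipode_incl := fun h => (hS0 _ (C.incl_mem_zero h)).trans (hs_incl h)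
    antipode_mul := congrArg ofConv hS1
    mul_antipode := congrArg ofConv hS2 }⟩

end Existence

/-! ### Coaction and graded coalgebra underlying an arbitrary extension -/

namespace DifferentialCalculus.HopfExtension

variable {k H Ω : Type*} [Field k] [Ring H] [HopfAlgebra k H] [Ring Ω] [Algebra k Ω]
  {gr : ℕ → Submodule k Ω} [GradedAlgebra gr] {C : DifferentialCalculus k H gr}

/-- The comultiplication of a differential graded Hopf algebra as a coaction. -/
def toComplete (E : C.HopfExtension) :
    CompleteCalculus (RightComoduleAlgebra.regular k H) C C where
  coact := E.comul
  coact_mem := E.comul_mem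
  coact_d := E.comul_d
  coact_incl := E.comul_incl

/-- The counit of an extension is forced, so counitality of the coaction, proved with `formCounit`,
holds for every extension. -/
theorem counit_eq (E : C.HopfExtension) : E.counit = CompleteCalculus.formCounit C := by
  refine C.algHom_ext (fun h => ?_) (fun h => ?_)
  · rw [E.counit_incl, CompleteCalculus.formCounit_incl]
  · rw [CompleteCalculus.formCounit_d,
      E.counit_eq_zero 1 _ one_pos (C.d_mem 0 _ (C.incl_mem_zero h))]

/-- The underlying coalgebra of a differential graded Hopf algebra. -/
abbrev coalgebra (E : C.HopfExtension) : Coalgebra k Ω :=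
  coalgebraOfUnitors (toTensor E.comul.toLinearMap) E.counit.toLinearMap
    E.coassoc E.counit_comul E.comul_counit

theorem isGradedCoalgebra (E : C.HopfExtension) :
    letI := E.coalgebra
    IsGradedCoalgebra gr :=
  letI := E.coalgebra
  { comul_mem := E.comul_mem
    counit_eq_zero := E.counit_eq_zero }

end DifferentialCalculus.HopfExtension

/-! ### Flatness -/

section Flat

variable {k : Type*} {R : Type v} [Field k] [Ring R] [Algebra k R] {B : Subalgebra k R}

theorem balancedRel_map_mem {N N' : Type*}
    [AddCommGroup N] [Module k N] [Module B N] [IsScalarTower k B N]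
    [AddCommGroup N'] [Module k N'] [Module B N'] [IsScalarTower k B N'] (g : N →ₗ[B] N')
    {t : R ⊗[k] N} (ht : t ∈ balancedRel B N) :
    TensorProduct.map LinearMap.id (g.restrictScalars k) t ∈ balancedRel B N' := by
  suffices balancedRel B N ≤ (balancedRel B N').comap
    (TensorProduct.map LinearMap.id (g.restrictScalars k)) from this ht
  rw [balancedRel, Submodule.span_le]
  rintro _ ⟨r, b, m, rfl⟩
  exact Submodule.subset_span ⟨r, b, g m, by simp⟩

instance Shrink.isScalarTower {k S N : Type*} [Small.{w} N] [SMul k S] [AddCommMonoid N]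
    [SMul k N] [SMul S N] [IsScalarTower k S N] : IsScalarTower k S (Shrink.{w} N) where
  smul_assoc c s x := (equivShrink N).symm.injective (by simp [smul_assoc])

/-- Exactness of R ⊗_B ker g → R ⊗_B N → R ⊗_B N', expressed through representatives over k.
Flatness is available only for modules in the universe of R, so small modules are first replaced by
their shrunk copies. -/
theorem IsFaithfullyFlatRight.mem_of_map_mem (hB : IsFaithfullyFlatRight B) {N : Type w} {N' : Type w'}
    [AddCommGroup N] [Module k N] [Module B N] [IsScalarTower k B N]
    [AddCommGroup N'] [Module k N'] [Module B N'] [IsScalarTower k B N']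
    [Small.{v} N] [Small.{v} N'] (g : N →ₗ[B] N') {t : R ⊗[k] N}
    (ht : TensorProduct.map LinearMap.id (g.restrictScalars k) t ∈ balancedRel B N') :
    t ∈ balancedRel B N ⊔ LinearMap.range (TensorProduct.map (LinearMap.id : R →ₗ[k] R)
      ((LinearMap.ker g).subtype.restrictScalars k)) := by
  let eN : Shrink.{v} N ≃ₗ[B] N := Shrink.linearEquiv.{v} B N
  let eN' : Shrink.{v} N' ≃ₗ[B] N' := Shrink.linearEquiv.{v} B N'
  let eK : Shrink.{v} (LinearMap.ker g) ≃ₗ[B] LinearMap.ker g :=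
    Shrink.linearEquiv.{v} B (LinearMap.ker g)
  let f₁ : Shrink.{v} (LinearMap.ker g) →ₗ[B] Shrink.{v} N :=
    eN.symm.toLinearMap ∘ₗ (LinearMap.ker g).subtype ∘ₗ eK.toLinearMap
  let g₁ : Shrink.{v} N →ₗ[B] Shrink.{v} N' := eN'.symm.toLinearMap ∘ₗ g ∘ₗ eN.toLinearMap
  have hex : Function.Exact f₁ g₁ := by
    intro x
    constructor
    · intro h
      have h' : g (eN x) = 0 := by simpa [g₁] using h
      exact ⟨eK.symm ⟨eN x, h'⟩, by simp [f₁]⟩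
    · rintro ⟨y, rfl⟩
      simp [f₁, g₁]
  have hex' := (hB _ _ _ f₁ g₁).1 hex
  let t₁ : R ⊗[k] Shrink.{v} N :=
    TensorProduct.map LinearMap.id (eN.symm.toLinearMap.restrictScalars k) t
  have ht₁ : BalancedTensor.map B g₁ (Submodule.Quotient.mk t₁) = 0 := by
    change Submodule.Quotient.mk (TensorProduct.map _ _ t₁) = _
    rw [Submodule.Quotient.mk_eq_zero]
    have := balancedRel_map_mem (eN'.symm.toLinearMap) ht
    convert this using 1
    simp only [t₁, ← LinearMap.comp_apply, ← TensorProduct.map_comp]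
    congr 2
    ext x
    simp [g₁]
  obtain ⟨u, hu⟩ := (hex' _).1 ht₁
  obtain ⟨u, rfl⟩ := Submodule.Quotient.mk_surjective _ u
  change Submodule.Quotient.mk (TensorProduct.map _ _ u) = _ at hu
  rw [Submodule.Quotient.eq] at hu
  have h2 := balancedRel_map_mem eN.toLinearMap hu
  rw [map_sub] at h2
  have h3 : TensorProduct.map LinearMap.id (eN.toLinearMap.restrictScalars k) t₁ = t := by
    simp only [t₁, ← LinearMap.comp_apply, ← TensorProduct.map_comp]
    have : eN.toLinearMap.restrictScalars k ∘ₗ eN.symm.toLinearMap.restrictScalars k =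
      LinearMap.id := by ext x; simp
    rw [this]
    simp
  rw [h3] at h2
  refine Submodule.mem_sup.2 ⟨_, neg_mem h2, _,
    ⟨TensorProduct.map LinearMap.id (eK.toLinearMap.restrictScalars k) u, rfl⟩, ?_⟩
  have h4 : TensorProduct.map LinearMap.id (eN.toLinearMap.restrictScalars k)
      (TensorProduct.map LinearMap.id (f₁.restrictScalars k) u) =
      TensorProduct.map (LinearMap.id : R →ₗ[k] R) ((LinearMap.ker g).subtype.restrictScalars k)
        (TensorProduct.map LinearMap.id (eK.toLinearMap.restrictScalars k) u) := by
    simp only [← LinearMap.comp_apply, ← TensorProduct.map_comp]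
    congr 2
    ext x
    simp [f₁]
  rw [h4]
  abel

end Flat

/-! ### Hopf modules over a Hopf-Galois extension -/

section Twist

variable {k H : Type*} [Field k] [Ring H] [HopfAlgebra k H]

/-- The inverse of the antipode. -/
def antipodeInv (hS : Function.Bijective (HopfAlgebra.antipode k : H →ₗ[k] H)) : H →ₗ[k] H :=
  (LinearEquiv.ofBijective _ hS).symm.toLinearMap

variable (hS : Function.Bijective (HopfAlgebra.antipode k : H →ₗ[k] H))

theorem antipode_antipodeInv (h : H) : HopfAlgebra.antipode k (antipodeInv hS h) = h :=
  (LinearEquiv.ofBijective _ hS).apply_symm_apply h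

theorem antipodeInv_antipode (h : H) : antipodeInv hS (HopfAlgebra.antipode k h) = h :=
  (LinearEquiv.ofBijective _ hS).symm_apply_apply h

theorem antipodeInv_mul (x y : H) :
    antipodeInv hS (x * y) = antipodeInv hS y * antipodeInv hS x :=
  hS.1 (by
    rw [HopfAlgebra.antipode_mul_antidistrib, antipode_antipodeInv, antipode_antipodeInv,
      antipode_antipodeInv])

/-- The map `x ⊗ y ↦ x S(y)`. -/
def mulAntipode (k H : Type*) [Field k] [Ring H] [HopfAlgebra k H] : H ⊗[k] H →ₗ[k] H :=
  LinearMap.mul' k H ∘ₗ TensorProduct.map LinearMap.id (HopfAlgebra.antipode k)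

/-- The map `x ⊗ y ↦ S⁻¹(y) x`. -/
def antipodeInvMul : H ⊗[k] H →ₗ[k] H :=
  LinearMap.mul' k H ∘ₗ TensorProduct.map (antipodeInv hS) LinearMap.id ∘ₗ
    (TensorProduct.comm k H H).toLinearMap

theorem mulAntipode_comul (h : H) : mulAntipode k H (Coalgebra.comul (R := k) h) =
    algebraMap k H (Coalgebra.counit (R := k) h) :=
  HopfAlgebra.mul_antipode_lTensor_comul_apply h

theorem antipodeInvMul_comul (h : H) : antipodeInvMul hS (Coalgebra.comul (R := k) h) =
    algebraMap k H (Coalgebra.counit (R := k) h) := by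
  refine hS.1 ?_
  rw [Algebra.algebraMap_eq_smul_one, map_smul, HopfAlgebra.antipode_one,
    ← Algebra.algebraMap_eq_smul_one, ← HopfAlgebra.mul_antipode_rTensor_comul_apply]
  induction Coalgebra.comul (R := k) h using TensorProduct.induction_on with
  | zero => simp
  | tmul x y =>
    simp [antipodeInvMul, HopfAlgebra.antipode_mul_antidistrib, antipode_antipodeInv]
  | add x y hx hy => simp only [map_add, hx, hy]

variable {P : Type*} [Ring P] [Algebra k P] (ρ : RightComoduleAlgebra k H P)

namespace RightComoduleAlgebra

/-- Serves for both x₁S(x₂) and S⁻¹(x₂)x₁, which are the two maps `μ` in use. -/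
theorem map_assoc_coact (μ : H ⊗[k] H →ₗ[k] H)
    (hμ : ∀ h, μ (Coalgebra.comul (R := k) h) = algebraMap k H (Coalgebra.counit (R := k) h))
    (x : P) : TensorProduct.map LinearMap.id μ (TensorProduct.assoc k P H H
      (TensorProduct.map ρ.coact.toLinearMap LinearMap.id (ρ.coact x))) = x ⊗ₜ[k] 1 := by
  have h1 := LinearMap.congr_fun ρ.coassoc x
  simp only [LinearMap.comp_apply, LinearEquiv.coe_coe, AlgHom.toLinearMap_apply] at h1
  rw [h1]
  have h2 := congrArg (fun y : P => y ⊗ₜ[k] (1 : H)) (LinearMap.congr_fun ρ.counit x)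
  refine Eq.trans ?_ h2
  simp only [LinearMap.comp_apply, LinearEquiv.coe_coe, AlgHom.toLinearMap_apply]
  induction ρ.coact x using TensorProduct.induction_on with
  | zero => simp
  | tmul y h => simp [hμ, Algebra.algebraMap_eq_smul_one, TensorProduct.smul_tmul]
  | add x y hx hy => simp only [map_add, hx, hy, TensorProduct.add_tmul]

/-- The map `x ⊗ h ↦ x₀ ⊗ x₁ S(h)`. -/
def twist : P ⊗[k] H →ₗ[k] P ⊗[k] H :=
  LinearMap.mul' k (P ⊗[k] H) ∘ₗ TensorProduct.map ρ.coact.toLinearMap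
    ((Algebra.TensorProduct.includeRight : H →ₐ[k] P ⊗[k] H).toLinearMap ∘ₗ
      HopfAlgebra.antipode k)

theorem twist_tmul (x : P) (h : H) :
    ρ.twist (x ⊗ₜ h) = ρ.coact x * (1 ⊗ₜ[k] HopfAlgebra.antipode k h) := rfl

/-- The map `x ⊗ h ↦ x₀ ⊗ S⁻¹(h) x₁`. -/
def untwist : P ⊗[k] H →ₗ[k] P ⊗[k] H :=
  LinearMap.mul' k (P ⊗[k] H) ∘ₗ TensorProduct.map
    ((Algebra.TensorProduct.includeRight : H →ₐ[k] P ⊗[k] H).toLinearMap ∘ₗ antipodeInv hS)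
    ρ.coact.toLinearMap ∘ₗ (TensorProduct.comm k P H).toLinearMap

theorem untwist_tmul (x : P) (h : H) :
    ρ.untwist hS (x ⊗ₜ h) = (1 ⊗ₜ[k] antipodeInv hS h) * ρ.coact x := rfl

theorem twist_eq (t : P ⊗[k] H) : ρ.twist t =
    TensorProduct.map LinearMap.id (mulAntipode k H) (TensorProduct.assoc k P H H
      (TensorProduct.map ρ.coact.toLinearMap LinearMap.id t)) := by
  induction t using TensorProduct.induction_on with
  | zero => simp
  | add x y hx hy => simp only [map_add, hx, hy]
  | tmul x h =>
    rw [twist_tmul, TensorProduct.map_tmul, AlgHom.toLinearMap_apply]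
    induction ρ.coact x using TensorProduct.induction_on with
    | zero => simp
    | tmul y z => simp [mulAntipode]
    | add x y hx hy => simp only [map_add, add_mul, TensorProduct.add_tmul, hx, hy]

theorem untwist_eq (t : P ⊗[k] H) : ρ.untwist hS t =
    TensorProduct.map LinearMap.id (antipodeInvMul hS) (TensorProduct.assoc k P H H
      (TensorProduct.map ρ.coact.toLinearMap LinearMap.id t)) := by
  induction t using TensorProduct.induction_on with
  | zero => simp
  | add x y hx hy => simp only [map_add, hx, hy]
  | tmul x h =>
    rw [untwist_tmul, TensorProduct.map_tmul, AlgHom.toLinearMap_apply]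
    induction ρ.coact x using TensorProduct.induction_on with
    | zero => simp
    | tmul y z => simp [antipodeInvMul]
    | add x y hx hy => simp only [map_add, mul_add, TensorProduct.add_tmul, hx, hy]

theorem twist_coact (x : P) : ρ.twist (ρ.coact x) = x ⊗ₜ 1 := by
  rw [twist_eq, ρ.map_assoc_coact _ mulAntipode_comul]

theorem untwist_coact (x : P) : ρ.untwist hS (ρ.coact x) = x ⊗ₜ 1 := by
  rw [untwist_eq, ρ.map_assoc_coact _ (antipodeInvMul_comul hS)]

/-- The left side is x₀y₀ ⊗ x₁y₁S(y₂), and y₁S(y₂) collapses. The twist thus moves the coaction from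
the right factor to the left one. -/
theorem twist_mul_coact (x y : P) :
    ρ.twist ((x ⊗ₜ 1) * ρ.coact y) = ρ.coact x * (y ⊗ₜ 1) := by
  rw [← ρ.twist_coact y]
  induction ρ.coact y using TensorProduct.induction_on with
  | zero => simp
  | tmul z h => simp [twist_tmul, mul_assoc]
  | add s t hs ht => simp only [mul_add, map_add, hs, ht]

theorem untwist_twist (t : P ⊗[k] H) : ρ.untwist hS (ρ.twist t) = t := by
  induction t using TensorProduct.induction_on with
  | zero => simp
  | add x y hx hy => simp only [map_add, hx, hy]
  | tmul x h =>
    have key : ∀ t : P ⊗[k] H, ρ.untwist hS (t * (1 ⊗ₜ[k] HopfAlgebra.antipode k h)) =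
        (1 ⊗ₜ h) * ρ.untwist hS t := fun t => by
      induction t using TensorProduct.induction_on with
      | zero => simp
      | add x y hx hy => simp only [map_add, add_mul, mul_add, hx, hy]
      | tmul y z =>
        rw [Algebra.TensorProduct.tmul_mul_tmul, untwist_tmul, untwist_tmul, mul_one,
          antipodeInv_mul, antipodeInv_antipode, ← mul_assoc,
          Algebra.TensorProduct.tmul_mul_tmul, mul_one]
    rw [twist_tmul, key, untwist_coact, Algebra.TensorProduct.tmul_mul_tmul, one_mul, mul_one]

/-- The canonical map `x ⊗ y ↦ x y₀ ⊗ y₁` on the tensor product over the ground field. -/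
def can : P ⊗[k] P →ₗ[k] P ⊗[k] H :=
  LinearMap.mul' k (P ⊗[k] H) ∘ₗ TensorProduct.map
    (Algebra.TensorProduct.includeLeft : P →ₐ[k] P ⊗[k] H).toLinearMap ρ.coact.toLinearMap

theorem can_tmul (x y : P) : ρ.can (x ⊗ₜ y) = (x ⊗ₜ 1) * ρ.coact y := rfl

/-- The canonical map `x ⊗ y ↦ x₀ y ⊗ x₁` on the tensor product over the ground field. -/
def can' : P ⊗[k] P →ₗ[k] P ⊗[k] H :=
  LinearMap.mul' k (P ⊗[k] H) ∘ₗ TensorProduct.map ρ.coact.toLinearMap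
    (Algebra.TensorProduct.includeLeft : P →ₐ[k] P ⊗[k] H).toLinearMap

theorem can'_tmul (x y : P) : ρ.can' (x ⊗ₜ y) = ρ.coact x * (y ⊗ₜ 1) := rfl

theorem twist_can (t : P ⊗[k] P) : ρ.twist (ρ.can t) = ρ.can' t := by
  induction t using TensorProduct.induction_on with
  | zero => simp
  | add x y hx hy => simp only [map_add, hx, hy]
  | tmul x y => rw [can_tmul, can'_tmul, twist_mul_coact]

end RightComoduleAlgebra

end Twist

/-! ### Injectivity of the canonical map for modules over a Hopf-Galois extension -/

namespace RightComoduleAlgebra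

section Galois

variable {k H A : Type*} [Field k] [Ring H] [HopfAlgebra k H] [Ring A] [Algebra k A]
  {δ : RightComoduleAlgebra k H A}

theorem galoisMap_mk (t : A ⊗[k] A) :
    galoisMap δ.coact (Algebra.TensorProduct.includeLeft : A →ₐ[k] A ⊗[k] H)
      (Submodule.Quotient.mk t) = δ.can t := rfl

theorem IsQuantumPrincipalBundle.mem_of_can_eq_zero (hδ : δ.IsQuantumPrincipalBundle)
    {t : A ⊗[k] A} (ht : δ.can t = 0) : t ∈ balancedRel δ.coinvariants A := by
  rw [← galoisMap_mk] at ht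
  rw [← Submodule.Quotient.mk_eq_zero]
  exact hδ.galois.1 (by rw [ht, map_zero])

theorem IsQuantumPrincipalBundle.can_surjective (hδ : δ.IsQuantumPrincipalBundle) :
    Function.Surjective δ.can := fun y => by
  obtain ⟨x, rfl⟩ := hδ.galois.2 y
  obtain ⟨x, rfl⟩ := Submodule.Quotient.mk_surjective _ x
  exact ⟨x, (galoisMap_mk x).symm⟩

/-- The twist is injective because the antipode is bijective, so both canonical maps have the same
kernel. -/
theorem IsQuantumPrincipalBundle.mem_of_can'_eq_zero (hδ : δ.IsQuantumPrincipalBundle)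
    (hS : Function.Bijective (HopfAlgebra.antipode k : H →ₗ[k] H))
    {t : A ⊗[k] A} (ht : δ.can' t = 0) : t ∈ balancedRel δ.coinvariants A := by
  refine hδ.mem_of_can_eq_zero ?_
  rw [← δ.untwist_twist hS (δ.can t), twist_can, ht, map_zero]

/-- A linear lift of the translation map for the second canonical map. The inverse antipode enters
because the twist sends 1 ⊗ h to 1 ⊗ S(h). -/
theorem IsQuantumPrincipalBundle.exists_translation (hδ : δ.IsQuantumPrincipalBundle)
    (hS : Function.Bijective (HopfAlgebra.antipode k : H →ₗ[k] H)) :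
    ∃ T : H →ₗ[k] A ⊗[k] A, ∀ h, δ.can' (T h) = 1 ⊗ₜ h := by
  obtain ⟨r, hr⟩ := LinearMap.exists_rightInverse_of_surjective δ.can
    (LinearMap.range_eq_top.2 hδ.can_surjective)
  refine ⟨r ∘ₗ (Algebra.TensorProduct.includeRight : H →ₐ[k] A ⊗[k] H).toLinearMap ∘ₗ
    antipodeInv hS, fun h => ?_⟩
  rw [← twist_can]
  have := LinearMap.congr_fun hr (1 ⊗ₜ antipodeInv hS h)
  simp only [LinearMap.comp_apply, LinearMap.id_apply] at this
  simp [this, twist_tmul, antipode_antipodeInv]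

variable (N : Type*) [AddCommGroup N] [Module k N] [Module A N] [IsScalarTower k A N]

variable (k A) in
/-- The action `a ⊗ n ↦ a n`. -/
def actionMap : A ⊗[k] N →ₗ[k] N := TensorProduct.lift (Algebra.lsmul k k N).toLinearMap

@[simp]
theorem actionMap_tmul (a : A) (n : N) : actionMap k A N (a ⊗ₜ n) = a • n := rfl

variable (δ) in
/-- The map `a ⊗ n ↦ a₀ n ⊗ a₁`. -/
def coactAction : A ⊗[k] N →ₗ[k] N ⊗[k] H :=
  TensorProduct.map (actionMap k A N) LinearMap.id ∘ₗ
    (TensorProduct.rightComm k A H N).toLinearMap ∘ₗ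
    TensorProduct.map δ.coact.toLinearMap LinearMap.id

/-- The assignment n ⊗ h ↦ T(h)·n, where T lifts the translation map and the second factor of T(h)
acts on n, is a left inverse modulo the relations. By applying the B-linear map x ↦ xn, the
verification reduces to N = A and n = 1. -/
theorem IsQuantumPrincipalBundle.mem_of_coactAction_eq_zero (hδ : δ.IsQuantumPrincipalBundle)
    (hS : Function.Bijective (HopfAlgebra.antipode k : H →ₗ[k] H)) {t : A ⊗[k] N}
    (ht : δ.coactAction N t = 0) : t ∈ balancedRel δ.coinvariants N := by
  obtain ⟨T, hT⟩ := hδ.exists_translation hS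
  let Γ : N ⊗[k] H →ₗ[k] A ⊗[k] N := TensorProduct.map LinearMap.id (actionMap k A N) ∘ₗ
    (TensorProduct.assoc k A A N).toLinearMap ∘ₗ TensorProduct.map T LinearMap.id ∘ₗ
    (TensorProduct.comm k N H).toLinearMap
  -- The section x ⊗ h ↦ T(h)(1 ⊗ x) of `can'`. As `can'` maps both Z(δ(a)) and a ⊗ 1 to δ(a), these
  -- two differ by relations.
  let Z : A ⊗[k] H →ₗ[k] A ⊗[k] A := LinearMap.mul' k (A ⊗[k] A) ∘ₗ TensorProduct.map T
    (Algebra.TensorProduct.includeRight : A →ₐ[k] A ⊗[k] A).toLinearMap ∘ₗ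
    (TensorProduct.comm k A H).toLinearMap
  have hZ : ∀ t, δ.can' (Z t) = t := fun t => by
    induction t using TensorProduct.induction_on with
    | zero => simp
    | add x y hx hy => simp only [map_add, hx, hy]
    | tmul x h =>
      have key : ∀ u : A ⊗[k] A, δ.can' (u * (1 ⊗ₜ x)) = δ.can' u * (x ⊗ₜ 1) := fun u => by
        induction u using TensorProduct.induction_on with
        | zero => simp
        | add x y hx hy => simp only [map_add, add_mul, hx, hy]
        | tmul y z => simp [can'_tmul, mul_assoc]
      change δ.can' (T h * (1 ⊗ₜ x)) = _
      rw [key, hT]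
      simp
  have hΓ : ∀ t, Γ (δ.coactAction N t) - t ∈ balancedRel δ.coinvariants N := fun t => by
    induction t using TensorProduct.induction_on with
    | zero => simp
    | add x y hx hy => simp only [map_add]; rw [add_sub_add_comm]; exact add_mem hx hy
    | tmul a n =>
      let g : A →ₗ[δ.coinvariants] N := (LinearMap.toSpanSingleton A N n).restrictScalars _
      have h1 : Γ (δ.coactAction N (a ⊗ₜ n)) =
          TensorProduct.map LinearMap.id (g.restrictScalars k) (Z (δ.coact a)) := by
        simp only [coactAction, LinearMap.comp_apply, TensorProduct.map_tmul,
          LinearMap.id_apply, AlgHom.toLinearMap_apply]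
        induction δ.coact a using TensorProduct.induction_on with
        | zero => simp
        | add x y hx hy => simp only [map_add, TensorProduct.add_tmul, hx, hy]
        | tmul x h =>
          change TensorProduct.map LinearMap.id (actionMap k A N) (TensorProduct.assoc k A A N
            (T h ⊗ₜ (x • n))) = TensorProduct.map LinearMap.id _ (T h * (1 ⊗ₜ x))
          induction T h using TensorProduct.induction_on with
          | zero => simp
          | add x y hx hy => simp only [map_add, TensorProduct.add_tmul, add_mul, hx, hy]
          | tmul y z => simp [g, mul_smul]
      have h2 : Z (δ.coact a) - a ⊗ₜ 1 ∈ balancedRel δ.coinvariants A := by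
        refine hδ.mem_of_can'_eq_zero hS ?_
        rw [map_sub, hZ, can'_tmul, ← Algebra.TensorProduct.one_def, mul_one, sub_self]
      have h3 := balancedRel_map_mem g h2
      rw [map_sub, ← h1] at h3
      simpa [g] using h3
  have := hΓ t
  rw [ht, map_zero, zero_sub] at this
  simpa using neg_mem this

variable {P : Type*} [Ring P] [Algebra k P]
  (ρ : RightComoduleAlgebra k H P) (ι : A →ₐ[k] P) (V : Type*) [AddCommGroup V] [Module k V]

/-- The map `a ⊗ (p ⊗ v) ↦ (a p₀ ⊗ p₁) ⊗ v`. -/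
def canTensor : A ⊗[k] (P ⊗[k] V) →ₗ[k] (P ⊗[k] H) ⊗[k] V :=
  TensorProduct.map (ρ.can ∘ₗ TensorProduct.map ι.toLinearMap LinearMap.id) LinearMap.id ∘ₗ
    (TensorProduct.assoc k A P V).symm.toLinearMap

theorem canTensor_tmul (a : A) (p : P) (v : V) :
    canTensor ρ ι V (a ⊗ₜ (p ⊗ₜ v)) = ((ι a ⊗ₜ 1) * ρ.coact p) ⊗ₜ v := rfl

/-- The twist converts ap₀ ⊗ p₁ ⊗ v into a₀p ⊗ a₁ ⊗ v, which is the map treated above for the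
A-module P ⊗ V. -/
theorem IsQuantumPrincipalBundle.mem_of_canTensor_eq_zero [Module A P] [IsScalarTower k A P]
    (hδ : δ.IsQuantumPrincipalBundle)
    (hS : Function.Bijective (HopfAlgebra.antipode k : H →ₗ[k] H))
    (hι : ∀ (a : A) (p : P), a • p = ι a * p)
    (hρ : ∀ a, ρ.coact (ι a) = TensorProduct.map ι.toLinearMap LinearMap.id (δ.coact a))
    {t : A ⊗[k] (P ⊗[k] V)} (ht : canTensor ρ ι V t = 0) :
    t ∈ balancedRel δ.coinvariants (P ⊗[k] V) := by
  refine hδ.mem_of_coactAction_eq_zero _ hS ?_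
  suffices h : ∀ t, δ.coactAction (P ⊗[k] V) t = TensorProduct.rightComm k P H V
      (TensorProduct.map ρ.twist LinearMap.id (canTensor ρ ι V t)) by
    rw [h, ht, map_zero, map_zero]
  clear ht t
  intro t
  induction t using TensorProduct.induction_on with
  | zero => simp
  | add x y hx hy => simp only [map_add, hx, hy]
  | tmul a n =>
    induction n using TensorProduct.induction_on with
    | zero => simp
    | add x y hx hy => simp only [TensorProduct.tmul_add, map_add, hx, hy]
    | tmul p v =>
      rw [canTensor_tmul, TensorProduct.map_tmul, twist_mul_coact, hρ]
      simp only [coactAction, LinearMap.comp_apply, TensorProduct.map_tmul,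
          LinearMap.id_apply, AlgHom.toLinearMap_apply, LinearEquiv.coe_coe]
      induction δ.coact a using TensorProduct.induction_on with
      | zero => simp
      | add x y hx hy => simp only [map_add, TensorProduct.add_tmul, add_mul, hx, hy]
      | tmul x h => simp [hι, TensorProduct.smul_tmul']

end Galois

end RightComoduleAlgebra

/-! ### Truncations of graded spaces -/

section Truncation

variable {k Ω : Type*} [Field k] [Ring Ω] [Algebra k Ω] (gr : ℕ → Submodule k Ω) [GradedAlgebra gr]

/-- The projection onto the part of degree at least `n`. -/
def projGE (n : ℕ) : Ω →ₗ[k] Ω :=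
  LinearMap.id - ∑ i ∈ Finset.range n, GradedAlgebra.proj gr i

variable {gr}

theorem projGE_of_lt {n m : ℕ} (h : m < n) {x : Ω} (hx : x ∈ gr m) : projGE gr n x = 0 := by
  rw [projGE, LinearMap.sub_apply, LinearMap.sum_apply,
    Finset.sum_eq_single_of_mem m (Finset.mem_range.2 h)
      (fun i _ hi => proj_of_mem_ne hx hi.symm), proj_of_mem hx, LinearMap.id_apply, sub_self]

theorem projGE_of_le {n m : ℕ} (h : n ≤ m) {x : Ω} (hx : x ∈ gr m) : projGE gr n x = x := by
  rw [projGE, LinearMap.sub_apply, LinearMap.sum_apply, Finset.sum_eq_zero, sub_zero,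
    LinearMap.id_apply]
  intro i hi
  exact proj_of_mem_ne hx (by have := Finset.mem_range.1 hi; omega)

theorem projGE_zero : projGE gr 0 = LinearMap.id := by simp [projGE]

theorem projGE_succ (n : ℕ) :
    projGE gr n = GradedAlgebra.proj gr n + projGE gr (n + 1) := by
  simp only [projGE, Finset.sum_range_succ]
  abel

theorem projGE_succ_comp_projGE (n : ℕ) : projGE gr (n + 1) ∘ₗ projGE gr n = projGE gr (n + 1) := by
  refine linearMap_ext_homogeneous gr fun m x hx => ?_
  rw [LinearMap.comp_apply]
  rcases Nat.lt_or_ge m n with h | h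
  · rw [projGE_of_lt h hx, projGE_of_lt (by omega) hx, map_zero]
  · rw [projGE_of_le h hx]

end Truncation

section LeftMul

variable {k P V W : Type*} [Field k] [Ring P] [Algebra k P] [AddCommGroup V] [Module k V]
  [AddCommGroup W] [Module k W]

variable (k V) in
/-- Left multiplication on the first tensor factor. -/
def mulFst (x : P) : P ⊗[k] V →ₗ[k] P ⊗[k] V :=
  TensorProduct.map (LinearMap.mulLeft k x) LinearMap.id

@[simp]
theorem mulFst_tmul (x y : P) (v : V) : mulFst k V x (y ⊗ₜ v) = (x * y) ⊗ₜ v := rfl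

theorem map_mulFst (f : V →ₗ[k] W) (x : P) (t : P ⊗[k] V) :
    TensorProduct.map LinearMap.id f (mulFst k V x t) =
      mulFst k W x (TensorProduct.map LinearMap.id f t) := by
  induction t using TensorProduct.induction_on with
  | zero => simp
  | tmul y v => simp
  | add s t hs ht => simp only [map_add, hs, ht]

end LeftMul

namespace CompleteCalculus

open GradedTensorProduct

variable {k H A ΩH ΩA : Type*} [Field k] [Ring H] [HopfAlgebra k H] [Ring A] [Algebra k A]
  [Ring ΩH] [Algebra k ΩH] {grH : ℕ → Submodule k ΩH} [GradedAlgebra grH]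
  [Ring ΩA] [Algebra k ΩA] {grA : ℕ → Submodule k ΩA} [GradedAlgebra grA]
  {δ : RightComoduleAlgebra k H A}
  {CH : DifferentialCalculus k H grH} {CA : DifferentialCalculus k A grA}

/-- The extended coaction as a linear map into the tensor product. -/
abbrev coactLin (K : CompleteCalculus δ CH CA) : ΩA →ₗ[k] ΩA ⊗[k] ΩH := toTensor K.coact.toLinearMap

theorem of_coactLin (K : CompleteCalculus δ CH CA) (x : ΩA) :
    of k grA grH (K.coactLin x) = K.coact x := rfl

theorem of_mulFst (x : ΩA) (t : ΩA ⊗[k] ΩH) :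
    of k grA grH (mulFst k ΩH x t) = includeLeft grA grH x * of k grA grH t := by
  induction t using TensorProduct.induction_on with
  | zero => simp
  | tmul y v => exact (includeLeft_mul_tmul x y v).symm
  | add s t hs ht => simp only [map_add, mul_add, hs, ht]

theorem coactLin_incl (K : CompleteCalculus δ CH CA) (a : A) : K.coactLin (CA.incl a) =
    TensorProduct.map CA.incl.toLinearMap CH.incl.toLinearMap (δ.coact a) := K.coact_incl a

theorem apply_coactLin_mem (K : CompleteCalculus δ CH CA) {X : Type*} [AddCommGroup X] [Module k X]
    (F : ΩA ⊗[k] ΩH →ₗ[k] X) (M : Submodule k X) {n : ℕ}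
    (hF : ∀ i j, i + j = n → ∀ a ∈ grA i, ∀ b ∈ grH j, F (a ⊗ₜ b) ∈ M) {ω : ΩA}
    (hω : ω ∈ grA n) : F (K.coactLin ω) ∈ M := by
  have h : tensorGr grA grH n ≤ M.comap (F ∘ₗ (of k grA grH).symm.toLinearMap) := by
    rw [tensorGr, Submodule.span_le]
    rintro _ ⟨i, j, a, b, hij, ha, hb, rfl⟩
    exact hF i j hij a ha b hb
  exact h (K.coact_mem n ω hω)

theorem apply_coactLin_eq_zero (K : CompleteCalculus δ CH CA) {X : Type*} [AddCommGroup X]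
    [Module k X] (F : ΩA ⊗[k] ΩH →ₗ[k] X) {n : ℕ}
    (hF : ∀ i j, i + j = n → ∀ a ∈ grA i, ∀ b ∈ grH j, F (a ⊗ₜ b) = 0) {ω : ΩA}
    (hω : ω ∈ grA n) : F (K.coactLin ω) = 0 :=
  (Submodule.mem_bot k).1 (K.apply_coactLin_mem F ⊥
    (fun i j hij a ha b hb => (Submodule.mem_bot k).2 (hF i j hij a ha b hb)) hω)

/-! ### The degree zero coaction -/

variable (grA CH) in
/-- The projection of the graded tensor product `Ω(A) ⊗ Ω(H)` onto `Ω(A) ⊗ H`. -/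
def tensorDegZero : grA ᵍ⊗[k] grH →ₐ[k] ΩA ⊗[k] H :=
  lift grA grH Algebra.TensorProduct.includeLeft
    (Algebra.TensorProduct.includeRight.comp CH.degZero) fun i j a b => by
      rw [units_smul_eq (k := k)]
      obtain rfl | hj := eq_or_ne j 0
      · simp
      · simp [CH.degZero_of_mem hj b.2]

theorem tensorDegZero_of (t : ΩA ⊗[k] ΩH) : tensorDegZero grA CH (of k grA grH t) =
    TensorProduct.map LinearMap.id CH.degZero.toLinearMap t := by
  induction t using TensorProduct.induction_on with
  | zero => simp
  | tmul a b =>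
    change (a ⊗ₜ[k] (1 : H)) * ((1 : ΩA) ⊗ₜ[k] CH.degZero b) = _
    simp
  | add x y hx hy => simp only [map_add, hx, hy]

variable (K : CompleteCalculus δ CH CA)
  (D : CompleteCalculus (RightComoduleAlgebra.regular k H) CH CH)

theorem degZero_comul (q : ΩH) :
    TensorProduct.map CH.degZero.toLinearMap CH.degZero.toLinearMap (D.coactLin q) =
      Coalgebra.comul (R := k) (CH.degZero q) := by
  suffices TensorProduct.map CH.degZero.toLinearMap CH.degZero.toLinearMap ∘ₗ D.coactLin =
      Coalgebra.comul (R := k) ∘ₗ CH.degZero.toLinearMap from LinearMap.congr_fun this q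
  refine linearMap_ext_homogeneous grH fun n q hq => ?_
  simp only [LinearMap.comp_apply, AlgHom.toLinearMap_apply]
  obtain rfl | hn := eq_or_ne n 0
  · obtain ⟨h, rfl⟩ := CH.exists_incl_of_mem hq
    rw [coactLin_incl, ← LinearMap.comp_apply, ← TensorProduct.map_comp, CH.degZero_incl]
    have : CH.degZero.toLinearMap ∘ₗ CH.incl.toLinearMap = LinearMap.id := by ext; simp
    rw [this, TensorProduct.map_id]
    rfl
  · rw [CH.degZero_of_mem hn hq, map_zero]
    refine D.apply_coactLin_eq_zero _ (fun i j hij a ha b hb => ?_) hq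
    obtain rfl | hi := eq_or_ne i 0
    · simp [CH.degZero_of_mem (by omega : j ≠ 0) hb]
    · simp [CH.degZero_of_mem hi ha]

theorem coassoc_apply (x : ΩA) : TensorProduct.map K.coactLin LinearMap.id (K.coactLin x) =
    (TensorProduct.assoc k ΩA ΩH ΩH).symm
      (TensorProduct.map LinearMap.id D.coactLin (K.coactLin x)) := by
  rw [LinearEquiv.eq_symm_apply]
  exact LinearMap.congr_fun (K.coassoc D) x

theorem counit_apply (x : ΩA) : TensorProduct.rid k ΩA
    (TensorProduct.map LinearMap.id (formCounit CH).toLinearMap (K.coactLin x)) = x :=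
  LinearMap.congr_fun K.counit x

/-- The coaction of `H` on `Ω(A)`. -/
def zeroCoaction : RightComoduleAlgebra k H ΩA where
  coact := (tensorDegZero grA CH).comp K.coact
  coassoc := by
    ext x
    have hz : ∀ y, ((tensorDegZero grA CH).comp K.coact).toLinearMap y =
      TensorProduct.map LinearMap.id CH.degZero.toLinearMap (K.coactLin y) := fun y =>
      tensorDegZero_of (K.coactLin y)
    simp only [LinearMap.comp_apply, LinearEquiv.coe_coe, hz]
    have h1 := congrArg (TensorProduct.map (LinearMap.id : ΩA →ₗ[k] ΩA)
      (TensorProduct.map CH.degZero.toLinearMap CH.degZero.toLinearMap))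
      (LinearMap.congr_fun (K.coassoc D) x)
    simp only [LinearMap.comp_apply, LinearEquiv.coe_coe] at h1
    trans TensorProduct.map (LinearMap.id : ΩA →ₗ[k] ΩA)
      (TensorProduct.map CH.degZero.toLinearMap CH.degZero.toLinearMap)
      (TensorProduct.assoc k ΩA ΩH ΩH (TensorProduct.map K.coactLin LinearMap.id (K.coactLin x)))
    · induction K.coactLin x using TensorProduct.induction_on with
      | zero => simp
      | add x y hx hy => simp only [map_add, hx, hy]
      | tmul y q =>
        simp only [TensorProduct.map_tmul, hz, LinearMap.id_apply]
        induction K.coactLin y using TensorProduct.induction_on with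
        | zero => simp
        | add x y hx hy => simp only [map_add, TensorProduct.add_tmul, hx, hy]
        | tmul z r => simp
    · refine h1.trans ?_
      induction K.coactLin x using TensorProduct.induction_on with
      | zero => simp
      | add x y hx hy => simp only [map_add, hx, hy]
      | tmul y q =>
        simp only [TensorProduct.map_tmul, LinearMap.id_apply, AlgHom.toLinearMap_apply]
        rw [degZero_comul]
  counit := by
    ext x
    refine Eq.trans ?_ (K.counit_apply x)
    have hz : ((tensorDegZero grA CH).comp K.coact).toLinearMap x =
      TensorProduct.map LinearMap.id CH.degZero.toLinearMap (K.coactLin x) :=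
      tensorDegZero_of (K.coactLin x)
    simp only [LinearMap.comp_apply, LinearEquiv.coe_coe, hz]
    induction K.coactLin x using TensorProduct.induction_on with
    | zero => simp
    | add x y hx hy => simp only [map_add, hx, hy]
    | tmul y q => simp [formCounit]

theorem zeroCoaction_apply (x : ΩA) : (K.zeroCoaction D).coact x =
    TensorProduct.map LinearMap.id CH.degZero.toLinearMap (K.coactLin x) :=
  tensorDegZero_of (K.coactLin x)

theorem zeroCoaction_incl (a : A) : (K.zeroCoaction D).coact (CA.incl a) =
    TensorProduct.map CA.incl.toLinearMap LinearMap.id (δ.coact a) := by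
  rw [zeroCoaction_apply, coactLin_incl]
  induction δ.coact a using TensorProduct.induction_on with
  | zero => simp
  | tmul a b => simp
  | add x y hx hy => simp only [map_add, hx, hy]

/-- The left coaction of `H` on `Ω(H)`. -/
def leftCoaction : ΩH →ₗ[k] H ⊗[k] ΩH :=
  TensorProduct.map CH.degZero.toLinearMap LinearMap.id ∘ₗ D.coactLin

theorem leftCoaction_one : D.leftCoaction 1 = 1 ⊗ₜ 1 := by
  have h : D.coactLin 1 = 1 ⊗ₜ 1 := map_one D.coact
  rw [leftCoaction, LinearMap.comp_apply, h]
  simp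

/-- The left coaction of H preserves the degree of forms, hence commutes with truncation. -/
theorem leftCoaction_projGE (n : ℕ) : D.leftCoaction ∘ₗ projGE grH n =
    TensorProduct.map LinearMap.id (projGE grH n) ∘ₗ D.leftCoaction := by
  refine linearMap_ext_homogeneous grH fun m q hq => ?_
  rw [LinearMap.comp_apply, LinearMap.comp_apply]
  rcases Nat.lt_or_ge m n with h | h
  · rw [projGE_of_lt h hq, map_zero, leftCoaction, LinearMap.comp_apply, ← LinearMap.comp_apply]
    refine (D.apply_coactLin_eq_zero _ (fun i j hij a ha b hb => ?_) hq).symm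
    simp [projGE_of_lt (by omega : j < n) hb]
  · rw [projGE_of_le h hq, ← sub_eq_zero]
    refine D.apply_coactLin_eq_zero
      (TensorProduct.map CH.degZero.toLinearMap LinearMap.id -
        TensorProduct.map LinearMap.id (projGE grH n) ∘ₗ
          TensorProduct.map CH.degZero.toLinearMap LinearMap.id) (fun i j hij a ha b hb => ?_) hq
    obtain rfl | hi := eq_or_ne i 0
    · simp [projGE_of_le (by omega : n ≤ j) hb]
    · simp [CH.degZero_of_mem hi ha]

theorem map_zeroCoaction (x : ΩA) :
    TensorProduct.map (K.zeroCoaction D).coact.toLinearMap LinearMap.id (K.coactLin x) =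
      (TensorProduct.assoc k ΩA H ΩH).symm
        (TensorProduct.map LinearMap.id D.leftCoaction (K.coactLin x)) := by
  have h := congrArg (TensorProduct.map (TensorProduct.map (LinearMap.id : ΩA →ₗ[k] ΩA)
    CH.degZero.toLinearMap) (LinearMap.id : ΩH →ₗ[k] ΩH)) (K.coassoc_apply D x)
  refine Eq.trans ?_ (h.trans ?_)
  · induction K.coactLin x using TensorProduct.induction_on with
    | zero => simp
    | add x y hx hy => simp only [map_add, hx, hy]
    | tmul y q => simp [zeroCoaction_apply]
  · induction K.coactLin x using TensorProduct.induction_on with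
    | zero => simp
    | add x y hx hy => simp only [map_add, hx, hy]
    | tmul y q =>
      simp only [TensorProduct.map_tmul, LinearMap.id_apply, leftCoaction, LinearMap.comp_apply]
      induction D.coactLin q using TensorProduct.induction_on with
      | zero => simp
      | add x y hx hy => simp only [map_add, TensorProduct.tmul_add, hx, hy]
      | tmul y q => simp

/-! ### Surjectivity of the graded Galois map -/

/-- The degree `n` part of the image of the graded Galois map. -/
def galoisSpan (n : ℕ) : Submodule k (grA ᵍ⊗[k] grH) :=
  Submodule.span k {t | ∃ (i j : ℕ) (x y : ΩA), i + j = n ∧ x ∈ grA i ∧ y ∈ grA j ∧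
    t = includeLeft grA grH x * K.coact y}

variable {K}

theorem galoisSpan_induction {n : ℕ} {M : Submodule k (grA ᵍ⊗[k] grH)}
    (h : ∀ i j, i + j = n → ∀ x ∈ grA i, ∀ y ∈ grA j, includeLeft grA grH x * K.coact y ∈ M) :
    K.galoisSpan n ≤ M := by
  rw [galoisSpan, Submodule.span_le]
  rintro _ ⟨i, j, x, y, hij, hx, hy, rfl⟩
  exact h i j hij x hx y hy

theorem mem_galoisSpan {i j : ℕ} {x y : ΩA} (hx : x ∈ grA i) (hy : y ∈ grA j) :
    includeLeft grA grH x * K.coact y ∈ K.galoisSpan (i + j) :=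
  Submodule.subset_span ⟨i, j, x, y, rfl, hx, hy, rfl⟩

theorem includeLeft_mul_mem {i n : ℕ} {x : ΩA} (hx : x ∈ grA i) {t : grA ᵍ⊗[k] grH}
    (ht : t ∈ K.galoisSpan n) : includeLeft grA grH x * t ∈ K.galoisSpan (i + n) := by
  suffices K.galoisSpan n ≤ (K.galoisSpan (i + n)).comap
    (LinearMap.mulLeft k (includeLeft grA grH x)) from this ht
  refine galoisSpan_induction ?_
  rintro p q rfl y hy z hz
  rw [Submodule.mem_comap, LinearMap.mulLeft_apply, ← mul_assoc, ← map_mul, ← add_assoc]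
  exact mem_galoisSpan (SetLike.mul_mem_graded hx hy) hz

theorem mul_coact_mem {j n : ℕ} {y : ΩA} (hy : y ∈ grA j) {t : grA ᵍ⊗[k] grH}
    (ht : t ∈ K.galoisSpan n) : t * K.coact y ∈ K.galoisSpan (n + j) := by
  suffices K.galoisSpan n ≤ (K.galoisSpan (n + j)).comap
    (LinearMap.mulRight k (K.coact y)) from this ht
  refine galoisSpan_induction ?_
  rintro p q rfl x hx z hz
  rw [Submodule.mem_comap, LinearMap.mulRight_apply, mul_assoc, ← map_mul, add_assoc]
  exact mem_galoisSpan hx (SetLike.mul_mem_graded hz hy)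

/-- Here (1 ⊗ q)(xΔ(y)) = ± x(1 ⊗ q)Δ(y), and the image is stable under left multiplication by Ω(A)
and right multiplication by Δ(Ω(A)). So the elements q with 1 ⊗ q in the image can be multiplied. -/
theorem includeRight_mul_mem {m n : ℕ} {q : ΩH} (hq : q ∈ grH m)
    (hq' : includeRight grA grH q ∈ K.galoisSpan m) {t : grA ᵍ⊗[k] grH}
    (ht : t ∈ K.galoisSpan n) : includeRight grA grH q * t ∈ K.galoisSpan (m + n) := by
  suffices K.galoisSpan n ≤ (K.galoisSpan (m + n)).comap
    (LinearMap.mulLeft k (includeRight grA grH q)) from this ht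
  refine galoisSpan_induction ?_
  rintro i j rfl x hx y hy
  rw [Submodule.mem_comap, LinearMap.mulLeft_apply, ← mul_assoc,
    includeRight_mul_includeLeft hx hq, ← includeLeft_mul_includeRight, smul_mul_assoc, mul_assoc,
    add_left_comm]
  exact Submodule.smul_mem _ _ (includeLeft_mul_mem hx (mul_coact_mem hy hq'))

/-- Since Δ commutes with the differentials, d(xΔ(y)) = dx Δ(y) ± x Δ(dy). This carries 1 ⊗ h to 1 ⊗
dh within the image. -/
theorem d_mem_galoisSpan {n : ℕ} {t : grA ᵍ⊗[k] grH} (ht : t ∈ K.galoisSpan n) :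
    tensorD grA grH CA.d CH.d t ∈ K.galoisSpan (n + 1) := by
  suffices K.galoisSpan n ≤ (K.galoisSpan (n + 1)).comap (tensorD grA grH CA.d CH.d) from this ht
  have hD := CA.isDifferential.tensorD CH.isDifferential
  refine galoisSpan_induction ?_
  rintro i j rfl x hx y hy
  have h1 : CH.d 1 = 0 := by
    have h := CH.leibniz 0 1 1 SetLike.GradedOne.one_mem
    simpa using h
  have h2 : tensorD grA grH CA.d CH.d (includeLeft grA grH x) = includeLeft grA grH (CA.d x) := by
    have := tensorD_tmul_of_mem (gr' := grH) CA.d CH.d hx 1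
    rw [h1, tmul, tmul, tmul, TensorProduct.tmul_zero, map_zero, smul_zero, add_zero] at this
    exact this
  rw [Submodule.mem_comap, hD.leibniz i _ _ (includeLeft_mem_tensorGr hx), h2, ← K.coact_d]
  refine add_mem ?_ (Submodule.smul_mem _ _ ?_)
  · rw [add_right_comm]; exact mem_galoisSpan (CA.d_mem _ _ hx) hy
  · rw [add_assoc]; exact mem_galoisSpan hx (CA.d_mem _ _ hy)

theorem of_map_can_mem (t : A ⊗[k] A) : of k grA grH
    (TensorProduct.map CA.incl.toLinearMap CH.incl.toLinearMap (δ.can t)) ∈ K.galoisSpan 0 := by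
  obtain ⟨F, hF⟩ : ∃ F : A ⊗[k] A →ₗ[k] grA ᵍ⊗[k] grH, F = (of k grA grH).toLinearMap ∘ₗ
    TensorProduct.map CA.incl.toLinearMap CH.incl.toLinearMap ∘ₗ δ.can := ⟨_, rfl⟩
  suffices h : F t ∈ K.galoisSpan 0 by rw [hF] at h; exact h
  induction t using TensorProduct.induction_on with
  | zero => rw [map_zero]; exact Submodule.zero_mem _
  | add x y hx hy => rw [map_add]; exact Submodule.add_mem _ hx hy
  | tmul x y =>
    have h2 : F (x ⊗ₜ y) = includeLeft grA grH (CA.incl x) * K.coact (CA.incl y) := by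
      rw [hF, LinearMap.comp_apply, LinearMap.comp_apply, LinearEquiv.coe_coe,
        RightComoduleAlgebra.can_tmul, coact_incl_eq, ← of_mulFst]
      refine congrArg (of k grA grH) ?_
      induction δ.coact y using TensorProduct.induction_on with
      | zero => simp
      | tmul z h => simp
      | add x y hx hy => simp only [map_add, mul_add, hx, hy]
    rw [h2, ← Nat.add_zero 0]
    exact mem_galoisSpan (CA.incl_mem_zero x) (CA.incl_mem_zero y)

theorem includeRight_incl_mem (hδ : δ.IsQuantumPrincipalBundle) (h : H) :
    includeRight grA grH (CH.incl h) ∈ K.galoisSpan 0 := by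
  obtain ⟨t, ht⟩ := hδ.can_surjective (1 ⊗ₜ h)
  have h1 : includeRight grA grH (CH.incl h) = of k grA grH
      (TensorProduct.map CA.incl.toLinearMap CH.incl.toLinearMap (δ.can t)) := by
    rw [ht]; simp
  rw [h1]
  exact of_map_can_mem t

theorem includeRight_d_incl_mem (hδ : δ.IsQuantumPrincipalBundle) (h : H) :
    includeRight grA grH (CH.d (CH.incl h)) ∈ K.galoisSpan 1 := by
  have h0 : CA.d 1 = 0 := by
    have h := CA.leibniz 0 1 1 SetLike.GradedOne.one_mem
    simpa using h
  have h1 := tensorD_tmul_of_mem (k := k) (gr := grA) (gr' := grH) CA.d CH.d (i := 0)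
    (a := 1) SetLike.GradedOne.one_mem (CH.incl h)
  have h2 : tensorD grA grH CA.d CH.d (includeRight grA grH (CH.incl h)) =
      includeRight grA grH (CH.d (CH.incl h)) := by
    rw [h0, tmul, tmul, tmul, TensorProduct.zero_tmul, map_zero, zero_add, pow_zero, one_smul] at h1
    exact h1
  rw [← h2]
  exact d_mem_galoisSpan (includeRight_incl_mem hδ h)

theorem includeRight_mem_galoisSpan (hδ : δ.IsQuantumPrincipalBundle) {n : ℕ} {q : ΩH}
    (hq : q ∈ grH n) : includeRight grA grH q ∈ K.galoisSpan n := by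
  rw [CH.gr_eq_formSpan] at hq
  suffices formSpan CH.incl CH.d n ≤ (K.galoisSpan n).comap (includeRight grA grH).toLinearMap from
    this hq
  refine formSpan_induction ?_
  rintro h l rfl
  rw [Submodule.mem_comap, AlgHom.toLinearMap_apply, map_mul]
  have key : includeRight grA grH (l.map fun a => CH.d (CH.incl a)).prod ∈
      K.galoisSpan l.length := by
    clear hq
    induction l with
    | nil =>
      rw [List.map_nil, List.prod_nil, ← map_one CH.incl]
      exact includeRight_incl_mem hδ 1
    | cons a l ih =>
      rw [List.map_cons, List.prod_cons, map_mul, List.length_cons, add_comm]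
      exact includeRight_mul_mem (CH.d_mem 0 _ (CH.incl_mem_zero a))
        (includeRight_d_incl_mem hδ a) ih
  have := includeRight_mul_mem (CH.incl_mem_zero h) (includeRight_incl_mem hδ h) key
  rwa [zero_add] at this

variable (K)

/-- The map `x ⊗ y ↦ x Δ(y)` on the tensor product over the ground field. -/
def gradedCan : ΩA ⊗[k] ΩA →ₗ[k] ΩA ⊗[k] ΩH :=
  (of k grA grH).symm.toLinearMap ∘ₗ LinearMap.mul' k (grA ᵍ⊗[k] grH) ∘ₗ
    TensorProduct.map (includeLeft grA grH).toLinearMap K.coact.toLinearMap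

theorem gradedGalois_mk (t : ΩA ⊗[k] ΩA) :
    K.gradedGalois (Submodule.Quotient.mk t) = of k grA grH (K.gradedCan t) := rfl

theorem gradedCan_tmul (x y : ΩA) : K.gradedCan (x ⊗ₜ y) = mulFst k ΩH x (K.coactLin y) := by
  refine (of k grA grH).injective ?_
  rw [of_mulFst]
  rfl

theorem gradedCan_surjective (hδ : δ.IsQuantumPrincipalBundle) :
    Function.Surjective K.gradedCan := by
  have h : ∀ n, ∀ t ∈ K.galoisSpan n, ∃ u, of k grA grH (K.gradedCan u) = t := by
    intro n t ht
    suffices K.galoisSpan n ≤ LinearMap.range ((of k grA grH).toLinearMap ∘ₗ K.gradedCan) from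
      this ht
    refine galoisSpan_induction fun i j _ x _ y _ => ⟨x ⊗ₜ y, rfl⟩
  rw [← LinearMap.range_eq_top, eq_top_iff]
  rintro t -
  suffices h : ∀ t : grA ᵍ⊗[k] grH, ∃ u, of k grA grH (K.gradedCan u) = t from
    h (of k grA grH t)
  intro t
  induction t using induction_homogeneous with
  | zero => exact ⟨0, by simp⟩
  | add x y hx hy =>
    obtain ⟨u, rfl⟩ := hx
    obtain ⟨u', rfl⟩ := hy
    exact ⟨u + u', by simp⟩
  | tmul i j a ha b hb =>
    rw [← includeLeft_mul_includeRight]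
    exact h _ _ (includeLeft_mul_mem ha (includeRight_mem_galoisSpan hδ hb))

end CompleteCalculus

/-! ### Injectivity of the graded Galois map -/

/-- Every form is a finite sum of products a⁰da¹⋯daⁿ, with scalars absorbed into a⁰, so Ω is an
image of a set of lists over A. This brings Ω(A) within reach of the flatness hypothesis, which
concerns the universe of A. -/
theorem DifferentialCalculus.small {k : Type*} {A : Type u} {Ω : Type*} [Field k] [Ring A]
    [Algebra k A] [Ring Ω] [Algebra k Ω] {gr : ℕ → Submodule k Ω} [GradedAlgebra gr]
    (C : DifferentialCalculus k A gr) : Small.{u} Ω := by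
  let m : A × List A → Ω := fun p => C.incl p.1 * (p.2.map fun a => C.d (C.incl a)).prod
  let f : List (A × List A) → Ω := fun l => (l.map m).sum
  have hadd : ∀ x ∈ Set.range f, ∀ y ∈ Set.range f, x + y ∈ Set.range f := by
    rintro _ ⟨l, rfl⟩ _ ⟨l', rfl⟩
    exact ⟨l ++ l', by simp [f]⟩
  have hsmul : ∀ (c : k), ∀ x ∈ Set.range f, c • x ∈ Set.range f := by
    rintro c _ ⟨l, rfl⟩
    refine ⟨l.map fun p => (c • p.1, p.2), ?_⟩
    simp [f, m, Function.comp_def, List.smul_sum]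
  let S : Submodule k Ω :=
    { carrier := Set.range f
      zero_mem' := ⟨[], rfl⟩
      add_mem' := fun hx hy => hadd _ hx _ hy
      smul_mem' := hsmul }
  have hS : ∀ n, gr n ≤ S := fun n => by
    rw [C.gr_eq_formSpan]
    refine formSpan_induction fun a l hl => ⟨[(a, l)], by simp [f, m]⟩
  have hf : Function.Surjective f := fun x => by
    have : (⊤ : Submodule k Ω) ≤ S := by
      rw [← iSup_gr_eq_top gr]
      exact iSup_le hS
    exact this (Submodule.mem_top : x ∈ _)
  exact small_of_surjective hf

theorem TensorProduct.small_of_surjective {k M N V : Type*} [Field k] [AddCommGroup M] [Module k M]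
    [AddCommGroup N] [Module k N] [AddCommGroup V] [Module k V] [Small.{u} M] [Small.{u} N]
    (φ : M ⊗[k] N →ₗ[k] V) (hφ : Function.Surjective φ) : Small.{u} V := by
  let f : List (M × N) → V := fun l => φ (l.map fun p => p.1 ⊗ₜ[k] p.2).sum
  have hf : Function.Surjective f := fun x => by
    obtain ⟨t, rfl⟩ := hφ x
    induction t using TensorProduct.induction_on with
    | zero => exact ⟨[], by simp [f]⟩
    | tmul x y => exact ⟨[(x, y)], by simp [f]⟩
    | add x y hx hy =>
      obtain ⟨l, hl⟩ := hx
      obtain ⟨l', hl'⟩ := hy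
      exact ⟨l ++ l', by rw [map_add, ← hl, ← hl']; simp [f]⟩
  exact _root_.small_of_surjective hf

theorem balancedRel_mulFst_mem {k P M : Type*} [Field k] [Ring P] [Algebra k P]
    {B : Subalgebra k P} [AddCommGroup M] [Module k M] [Module B M] [IsScalarTower k B M] (x : P)
    {t : P ⊗[k] M} (ht : t ∈ balancedRel B M) : mulFst k M x t ∈ balancedRel B M := by
  suffices balancedRel B M ≤ (balancedRel B M).comap (mulFst k M x) from this ht
  rw [balancedRel, Submodule.span_le]
  rintro _ ⟨r, b, m, rfl⟩
  exact Submodule.subset_span ⟨x * r, b, m, by simp [mul_assoc]⟩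

theorem mul'_eq_zero_of_mem_balancedRel {k P : Type*} [Field k] [Ring P] [Algebra k P]
    {B : Subalgebra k P} {t : P ⊗[k] P} (ht : t ∈ balancedRel B P) : LinearMap.mul' k P t = 0 := by
  suffices balancedRel B P ≤ LinearMap.ker (LinearMap.mul' k P) from this ht
  rw [balancedRel, Submodule.span_le]
  rintro _ ⟨r, b, m, rfl⟩
  simp [Subalgebra.smul_def, mul_assoc]

theorem mem_range_map_subtype_ker {k V W Q : Type*} [Field k] [AddCommGroup V] [Module k V]
    [AddCommGroup W] [Module k W] [AddCommGroup Q] [Module k Q] (g : V →ₗ[k] W) {t : V ⊗[k] Q}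
    (ht : TensorProduct.map g LinearMap.id t = 0) :
    t ∈ LinearMap.range (TensorProduct.map (LinearMap.ker g).subtype (LinearMap.id : Q →ₗ[k] Q)) :=
  (Module.Flat.rTensor_exact Q (LinearMap.exact_subtype_ker_map g) t).1 ht

/-! ### Combining Hopf module injectivity with flatness -/

namespace CompleteCalculus

open GradedTensorProduct

variable {k H ΩH ΩA : Type*} {A : Type u} [Field k] [Ring H] [HopfAlgebra k H] [Ring A]
  [Algebra k A]
  [Ring ΩH] [Algebra k ΩH] {grH : ℕ → Submodule k ΩH} [GradedAlgebra grH]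
  [Ring ΩA] [Algebra k ΩA] {grA : ℕ → Submodule k ΩA} [GradedAlgebra grA]
  {δ : RightComoduleAlgebra k H A}
  {CH : DifferentialCalculus k H grH} {CA : DifferentialCalculus k A grA}
  (K : CompleteCalculus δ CH CA)
  (D : CompleteCalculus (RightComoduleAlgebra.regular k H) CH CH)

theorem gradedCan_mulFst (x : ΩA) (t : ΩA ⊗[k] ΩA) :
    K.gradedCan (mulFst k ΩA x t) = mulFst k ΩH x (K.gradedCan t) := by
  induction t using TensorProduct.induction_on with
  | zero => simp
  | add x y hx hy => simp only [map_add, hx, hy]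
  | tmul y z =>
    refine (of k grA grH).injective ?_
    rw [mulFst_tmul, gradedCan_tmul, gradedCan_tmul, of_mulFst, of_mulFst, of_mulFst, map_mul,
      mul_assoc]

theorem mul_coactLin_of_mem {b x : ΩA} (hb : b ∈ K.basicForms) :
    K.coactLin (b * x) = mulFst k ΩH b (K.coactLin x) := by
  refine (of k grA grH).injective ?_
  rw [of_coactLin, of_mulFst, of_coactLin, map_mul]
  congr 1

theorem incl_mem_basicForms {b : A} (hb : b ∈ δ.coinvariants) : CA.incl b ∈ K.basicForms := by
  change K.coact (CA.incl b) = _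
  have hb' : δ.coact b = b ⊗ₜ 1 := hb
  rw [coact_incl_eq, hb']
  simp

theorem gradedCan_eq_zero_of_mem {t : ΩA ⊗[k] ΩA} (ht : t ∈ balancedRel K.basicForms ΩA) :
    K.gradedCan t = 0 := by
  refine (of k grA grH).injective ?_
  rw [← gradedGalois_mk, (Submodule.Quotient.mk_eq_zero _).2 ht, map_zero, map_zero]

/-- Counitality: applying ε to xy₀ ⊗ y₁ gives xy. The product of a tensor is therefore determined by
its image under χ. -/
theorem mul'_eq_gradedCan (t : ΩA ⊗[k] ΩA) : LinearMap.mul' k ΩA t = TensorProduct.rid k ΩA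
    (TensorProduct.map LinearMap.id (formCounit CH).toLinearMap (K.gradedCan t)) := by
  induction t using TensorProduct.induction_on with
  | zero => simp
  | add x y hx hy => simp only [map_add, hx, hy]
  | tmul x y =>
    have h : ∀ t : ΩA ⊗[k] k, TensorProduct.rid k ΩA (mulFst k k x t) =
      x * TensorProduct.rid k ΩA t := fun t => by
      induction t using TensorProduct.induction_on with
      | zero => simp
      | add x y hx hy => simp only [map_add, mul_add, hx, hy]
      | tmul y c => simp
    rw [gradedCan_tmul, map_mulFst, h, counit_apply, LinearMap.mul'_apply]

/-- The map `a ⊗ x ↦ a Δ(x)` for `a ∈ A`. -/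
def inclCan : A ⊗[k] ΩA →ₗ[k] ΩA ⊗[k] ΩH :=
  K.gradedCan ∘ₗ TensorProduct.map CA.incl.toLinearMap LinearMap.id

/-- Coassociativity with the middle factor projected to H. It shows that the canonical map of the
Hopf module Ω(A) ⊗ Ω(H), evaluated on (id ⊗ Δ)u, depends on `u` only through aΔ(x). -/
theorem canTensor_map (f : ΩH →ₗ[k] ΩH) (u : A ⊗[k] ΩA) :
    RightComoduleAlgebra.canTensor (K.zeroCoaction D) CA.incl ΩH
      (TensorProduct.map LinearMap.id (TensorProduct.map LinearMap.id f ∘ₗ K.coactLin) u) =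
    TensorProduct.map LinearMap.id f ((TensorProduct.assoc k ΩA H ΩH).symm
      (TensorProduct.map LinearMap.id D.leftCoaction (K.inclCan u))) := by
  induction u using TensorProduct.induction_on with
  | zero => simp
  | add x y hx hy => simp only [map_add, hx, hy]
  | tmul a p =>
    have h1 : ∀ t : ΩA ⊗[k] ΩH, RightComoduleAlgebra.canTensor (K.zeroCoaction D) CA.incl ΩH
        (a ⊗ₜ TensorProduct.map LinearMap.id f t) =
        TensorProduct.map (LinearMap.mulLeft k (CA.incl a ⊗ₜ[k] (1 : H))) f
          (TensorProduct.map (K.zeroCoaction D).coact.toLinearMap LinearMap.id t) := fun t => by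
      induction t using TensorProduct.induction_on with
      | zero => simp
      | add x y hx hy => simp only [map_add, TensorProduct.tmul_add, hx, hy]
      | tmul x q => simp [RightComoduleAlgebra.canTensor_tmul]
    rw [TensorProduct.map_tmul, LinearMap.comp_apply, LinearMap.id_apply, h1, map_zeroCoaction,
      inclCan, LinearMap.comp_apply, TensorProduct.map_tmul, gradedCan_tmul]
    simp only [AlgHom.toLinearMap_apply, LinearMap.id_apply]
    induction K.coactLin p using TensorProduct.induction_on with
    | zero => simp
    | add x y hx hy => simp only [map_add, hx, hy]
    | tmul x q =>
      simp only [TensorProduct.map_tmul, mulFst_tmul, LinearMap.id_apply]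
      induction D.leftCoaction q using TensorProduct.induction_on with
      | zero => simp
      | add x y hx hy => simp only [map_add, TensorProduct.tmul_add, hx, hy]
      | tmul h q => simp

/-- Hopf module injectivity puts (id ⊗ g)u among the relations over B; flatness then places u in A ⊗
ker g up to such relations, and relations over B become relations over Ω(B). -/
theorem exists_sub_mem_of_canTensor_eq_zero (hδ : δ.IsQuantumPrincipalBundle)
    (hS : Function.Bijective (HopfAlgebra.antipode k : H →ₗ[k] H))
    (g : ΩA →ₗ[k] ΩA ⊗[k] ΩH)
    (hg : ∀ b ∈ K.basicForms, ∀ x, g (b * x) = mulFst k ΩH b (g x)) {u : A ⊗[k] ΩA}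
    (hu : RightComoduleAlgebra.canTensor (K.zeroCoaction D) CA.incl ΩH
      (TensorProduct.map LinearMap.id g u) = 0) :
    ∃ s : A ⊗[k] LinearMap.ker g, TensorProduct.map CA.incl.toLinearMap LinearMap.id u -
      TensorProduct.map CA.incl.toLinearMap (LinearMap.ker g).subtype s ∈
        balancedRel K.basicForms ΩA := by
  let : Module A ΩA := Module.compHom ΩA CA.incl.toRingHom
  have : IsScalarTower k A ΩA := ⟨fun c a x => by
    change CA.incl (c • a) * x = c • (CA.incl a * x)
    rw [map_smul, smul_mul_assoc]⟩
  have := CA.small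
  -- Surjectivity of χ bounds this space by Ω(A) ⊗ Ω(A), whatever the universe of Ω(H).
  have : Small.{u} (ΩA ⊗[k] ΩH) :=
    TensorProduct.small_of_surjective K.gradedCan (K.gradedCan_surjective hδ)
  have h1 := hδ.mem_of_canTensor_eq_zero (K.zeroCoaction D) CA.incl ΩH hS (fun a p => rfl)
    (K.zeroCoaction_incl D) hu
  let g' : ΩA →ₗ[δ.coinvariants] ΩA ⊗[k] ΩH :=
    { g with
      map_smul' := fun b x => by
        change g (CA.incl b * x) = b • g x
        rw [hg _ (K.incl_mem_basicForms b.2)]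
        induction g x using TensorProduct.induction_on with
        | zero => simp
        | add x y hx hy => simp only [map_add, smul_add, hx, hy]
        | tmul y z => rfl }
  have h2 := hδ.faithfullyFlat.mem_of_map_mem g' (t := u) h1
  obtain ⟨r, hr, _, ⟨s, rfl⟩, rfl⟩ := Submodule.mem_sup.1 h2
  let e : LinearMap.ker g' →ₗ[k] LinearMap.ker g :=
    ((LinearMap.ker g').subtype.restrictScalars k).codRestrict (LinearMap.ker g) fun x => x.2
  refine ⟨TensorProduct.map LinearMap.id e s, ?_⟩
  have hs : TensorProduct.map CA.incl.toLinearMap (LinearMap.ker g).subtype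
      (TensorProduct.map LinearMap.id e s) = TensorProduct.map CA.incl.toLinearMap LinearMap.id
        (TensorProduct.map LinearMap.id ((LinearMap.ker g').subtype.restrictScalars k) s) := by
    rw [TensorProduct.map_map, TensorProduct.map_map]
    rfl
  rw [map_add, hs, add_sub_cancel_right]
  suffices balancedRel δ.coinvariants ΩA ≤ (balancedRel K.basicForms ΩA).comap
    (TensorProduct.map CA.incl.toLinearMap LinearMap.id) from this hr
  rw [balancedRel, Submodule.span_le]
  rintro _ ⟨a, b, x, rfl⟩
  refine Submodule.subset_span ⟨CA.incl a, ⟨CA.incl b, K.incl_mem_basicForms b.2⟩, x, ?_⟩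
  rw [map_sub, TensorProduct.map_tmul, TensorProduct.map_tmul, AlgHom.toLinearMap_apply,
    AlgHom.toLinearMap_apply, map_mul]
  rfl

end CompleteCalculus

/-! ### Horizontal forms, and descent along the filtration by degree in Ω(H) -/

namespace CompleteCalculus

open GradedTensorProduct

variable {k H ΩH ΩA : Type*} {A : Type u} [Field k] [Ring H] [HopfAlgebra k H] [Ring A]
  [Algebra k A]
  [Ring ΩH] [Algebra k ΩH] {grH : ℕ → Submodule k ΩH} [GradedAlgebra grH]
  [Ring ΩA] [Algebra k ΩA] {grA : ℕ → Submodule k ΩA} [GradedAlgebra grA]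
  {δ : RightComoduleAlgebra k H A}
  {CH : DifferentialCalculus k H grH} {CA : DifferentialCalculus k A grA}
  (K : CompleteCalculus δ CH CA)
  (D : CompleteCalculus (RightComoduleAlgebra.regular k H) CH CH)

/-- The coaction, with the part of degree less than `n` in `Ω(H)` removed. -/
def truncCoact (n : ℕ) : ΩA →ₗ[k] ΩA ⊗[k] ΩH :=
  TensorProduct.map LinearMap.id (projGE grH n) ∘ₗ K.coactLin

theorem truncCoact_mul (n : ℕ) {b : ΩA} (hb : b ∈ K.basicForms) (x : ΩA) :
    K.truncCoact n (b * x) = mulFst k ΩH b (K.truncCoact n x) := by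
  rw [truncCoact, LinearMap.comp_apply, mul_coactLin_of_mem K hb, map_mulFst, LinearMap.comp_apply]

theorem truncCoact_of_lt {n m : ℕ} (h : m < n) {x : ΩA} (hx : x ∈ grA m) :
    K.truncCoact n x = 0 := by
  refine K.apply_coactLin_eq_zero (TensorProduct.map LinearMap.id (projGE grH n))
    (fun i j hij a ha b hb => ?_) hx
  rw [TensorProduct.map_tmul, projGE_of_lt (by omega) hb, TensorProduct.tmul_zero]

theorem ker_truncCoact_zero : LinearMap.ker (K.truncCoact 0) = ⊥ := by
  rw [LinearMap.ker_eq_bot']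
  intro x hx
  rw [truncCoact, projGE_zero, TensorProduct.map_id, LinearMap.id_comp] at hx
  rw [← K.counit_apply x, hx, map_zero, map_zero]

/-- The horizontal forms. -/
def horizontal : Submodule k ΩA := LinearMap.ker (K.truncCoact 1)

theorem mem_horizontal {x : ΩA} : x ∈ K.horizontal ↔ K.coactLin x =
    TensorProduct.map LinearMap.id CH.incl.toLinearMap ((K.zeroCoaction D).coact x) := by
  have h : projGE grH 1 = LinearMap.id - CH.incl.toLinearMap ∘ₗ CH.degZero.toLinearMap := by
    ext q
    simp [projGE, DifferentialCalculus.incl_degZero]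
  have h2 : K.truncCoact 1 x = K.coactLin x -
      TensorProduct.map LinearMap.id CH.incl.toLinearMap ((K.zeroCoaction D).coact x) := by
    rw [zeroCoaction_apply, truncCoact, h, LinearMap.comp_apply, TensorProduct.map_map]
    generalize K.coactLin x = t
    induction t using TensorProduct.induction_on with
    | zero => simp
    | add x y hx hy => rw [map_add, map_add, hx, hy]; abel
    | tmul y q => simp [TensorProduct.tmul_sub]
  rw [horizontal, LinearMap.mem_ker, h2, sub_eq_zero]

theorem mul_mem_horizontal {x y : ΩA} (hx : x ∈ K.horizontal) (hy : y ∈ K.horizontal)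
    (D : CompleteCalculus (RightComoduleAlgebra.regular k H) CH CH) : x * y ∈ K.horizontal := by
  rw [mem_horizontal K D] at *
  refine (of k grA grH).injective ?_
  have h := congrArg₂ (· * ·) (congrArg (of k grA grH) hx) (congrArg (of k grA grH) hy)
  rw [of_coactLin, of_coactLin] at h
  rw [of_coactLin, map_mul, h, map_mul]
  generalize (K.zeroCoaction D).coact x = s
  generalize (K.zeroCoaction D).coact y = t
  induction s using TensorProduct.induction_on with
  | zero => simp
  | add x y hx hy => simp only [map_add, add_mul, hx, hy]
  | tmul x h =>
    induction t using TensorProduct.induction_on with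
    | zero => simp
    | add x y hx hy => simp only [map_add, mul_add, hx, hy]
    | tmul y h' =>
      have := tmul_mul_tmul_left (k := k) (gr := grA) (gr' := grH) (CH.incl_mem_zero h) x y
        (CH.incl h')
      simpa [tmul] using this

theorem incl_mem_horizontal (a : A) : CA.incl a ∈ K.horizontal :=
  K.truncCoact_of_lt Nat.zero_lt_one (CA.incl_mem_zero a)

/-- A form of degree at most n has no coproduct component of bidegree (i, j) with i ≥ 1 and j ≥ n.
-/
theorem map_projGE_coactLin (n : ℕ) :
    TensorProduct.map (projGE grH 1) (projGE grH n) ∘ₗ D.coactLin ∘ₗ projGE grH (n + 1) =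
      TensorProduct.map (projGE grH 1) (projGE grH n) ∘ₗ D.coactLin := by
  refine linearMap_ext_homogeneous grH fun m q hq => ?_
  simp only [LinearMap.comp_apply]
  rcases Nat.lt_or_ge m (n + 1) with h | h
  · rw [projGE_of_lt h hq, map_zero, map_zero]
    refine (D.apply_coactLin_eq_zero _ (fun i j hij a ha b hb => ?_) hq).symm
    rw [TensorProduct.map_tmul]
    obtain rfl | hi := Nat.eq_zero_or_pos i
    · rw [projGE_of_lt Nat.zero_lt_one ha, TensorProduct.zero_tmul]
    · rw [projGE_of_lt (by omega) hb, TensorProduct.tmul_zero]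
  · rw [projGE_of_le h hq]

/-- By coassociativity, applying the coaction truncated at degree 1 to the first factor only
involves components of Δ(y) of degree at least n + 1 in Ω(H), which vanish. So the first factor is
horizontal, as kernels are preserved by tensoring over a field. -/
theorem truncCoact_mem_range {n : ℕ} {y : ΩA} (hy : K.truncCoact (n + 1) y = 0)
    (D : CompleteCalculus (RightComoduleAlgebra.regular k H) CH CH) :
    K.truncCoact n y ∈ LinearMap.range
      (TensorProduct.map K.horizontal.subtype (LinearMap.id : ΩH →ₗ[k] ΩH)) := by
  refine mem_range_map_subtype_ker _ ?_
  have h1 : TensorProduct.map (K.truncCoact 1) LinearMap.id (K.truncCoact n y) =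
      (TensorProduct.assoc k ΩA ΩH ΩH).symm (TensorProduct.map LinearMap.id
        (TensorProduct.map (projGE grH 1) (projGE grH n) ∘ₗ D.coactLin) (K.coactLin y)) := by
    have h := congrArg (TensorProduct.map (TensorProduct.map (LinearMap.id : ΩA →ₗ[k] ΩA)
      (projGE grH 1)) (projGE grH n)) (K.coassoc_apply D y)
    refine Eq.trans ?_ (h.trans ?_)
    · rw [truncCoact, truncCoact]
      simp only [LinearMap.comp_apply, ← TensorProduct.map_comp, ← LinearMap.comp_apply (f :=
        TensorProduct.map _ _) (g := TensorProduct.map _ _), LinearMap.id_comp, LinearMap.comp_id]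
    · generalize K.coactLin y = t
      induction t using TensorProduct.induction_on with
      | zero => simp
      | add x y hx hy => simp only [map_add, hx, hy]
      | tmul x q =>
        simp only [TensorProduct.map_tmul, LinearMap.comp_apply, LinearMap.id_apply]
        generalize D.coactLin q = t
        induction t using TensorProduct.induction_on with
        | zero => simp
        | add x y hx hy => simp only [map_add, TensorProduct.tmul_add, hx, hy]
        | tmul x q => simp
  have h2 : TensorProduct.map (LinearMap.id : ΩA →ₗ[k] ΩA)
      (TensorProduct.map (projGE grH 1) (projGE grH n) ∘ₗ D.coactLin) (K.coactLin y) =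
      TensorProduct.map (LinearMap.id : ΩA →ₗ[k] ΩA)
        (TensorProduct.map (projGE grH 1) (projGE grH n) ∘ₗ D.coactLin)
        (K.truncCoact (n + 1) y) := by
    rw [truncCoact, LinearMap.comp_apply, TensorProduct.map_map,
      LinearMap.comp_assoc, map_projGE_coactLin, LinearMap.comp_id]
  rw [h1, h2, hy, map_zero, map_zero]

theorem inclCan_tmul (a : A) (x : ΩA) :
    K.inclCan (a ⊗ₜ x) = mulFst k ΩH (CA.incl a) (K.coactLin x) :=
  K.gradedCan_tmul _ _

/-- The formula is x ⊗ 1 = (1 ⊗ S⁻¹(x₁))ρ(x₀) for the H-coaction ρ. Writing 1 ⊗ S⁻¹(x₁) as a sum of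
aδ(b) gives t = Σ a ⊗ bx₀. Its second factors are horizontal, so the full coaction agrees with ρ on
them. -/
theorem exists_inclCan_eq (hδ : δ.IsQuantumPrincipalBundle)
    (hS : Function.Bijective (HopfAlgebra.antipode k : H →ₗ[k] H)) {x : ΩA}
    (hx : x ∈ K.horizontal)
    (D : CompleteCalculus (RightComoduleAlgebra.regular k H) CH CH) :
    ∃ t : A ⊗[k] ΩA, K.inclCan t = x ⊗ₜ 1 ∧
      RightComoduleAlgebra.can (K.zeroCoaction D)
        (TensorProduct.map CA.incl.toLinearMap LinearMap.id t) = x ⊗ₜ 1 := by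
  let ρ := K.zeroCoaction D
  let c : A ⊗[k] K.horizontal →ₗ[k] ΩA ⊗[k] H :=
    ρ.can ∘ₗ TensorProduct.map CA.incl.toLinearMap K.horizontal.subtype
  have h1 : ∀ t, K.inclCan (TensorProduct.map LinearMap.id K.horizontal.subtype t) =
      TensorProduct.map LinearMap.id CH.incl.toLinearMap (c t) := fun t => by
    induction t using TensorProduct.induction_on with
    | zero => simp
    | add x y hx hy => simp only [map_add, hx, hy]
    | tmul a y =>
      rw [TensorProduct.map_tmul, inclCan_tmul, Submodule.subtype_apply,
        (K.mem_horizontal D).1 y.2, ← map_mulFst]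
      refine congrArg _ ?_
      change _ = (CA.incl a ⊗ₜ 1) * ρ.coact y
      generalize ρ.coact y = t
      induction t using TensorProduct.induction_on with
      | zero => simp
      | add x y hx hy => simp only [map_add, mul_add, hx, hy]
      | tmul a y => simp
  have h2 : ∀ s : K.horizontal ⊗[k] H, ∃ t, c t = ρ.untwist hS
      (TensorProduct.map K.horizontal.subtype LinearMap.id s) := fun s => by
    induction s using TensorProduct.induction_on with
    | zero => exact ⟨0, by simp⟩
    | add x y hx hy =>
      obtain ⟨t, ht⟩ := hx
      obtain ⟨t', ht'⟩ := hy
      exact ⟨t + t', by simp only [map_add, ht, ht']⟩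
    | tmul y h =>
      obtain ⟨u, hu⟩ := hδ.can_surjective (1 ⊗ₜ antipodeInv hS h)
      let m : A →ₗ[k] K.horizontal :=
        (LinearMap.mulRight k (y : ΩA) ∘ₗ CA.incl.toLinearMap).codRestrict K.horizontal
          fun a => K.mul_mem_horizontal (K.incl_mem_horizontal a) y.2 D
      refine ⟨TensorProduct.map LinearMap.id m u, ?_⟩
      rw [TensorProduct.map_tmul, RightComoduleAlgebra.untwist_tmul]
      have h3 : c (TensorProduct.map LinearMap.id m u) =
          TensorProduct.map CA.incl.toLinearMap LinearMap.id (δ.can u) * ρ.coact y := by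
        clear hu
        induction u using TensorProduct.induction_on with
        | zero => simp
        | add x y hx hy => simp only [map_add, add_mul, hx, hy]
        | tmul a b =>
          change (CA.incl a ⊗ₜ 1) * ρ.coact (CA.incl b * y) = _
          rw [map_mul, K.zeroCoaction_incl, RightComoduleAlgebra.can_tmul, ← mul_assoc]
          refine congrArg (· * ρ.coact (y : ΩA)) ?_
          generalize δ.coact b = t
          induction t using TensorProduct.induction_on with
          | zero => simp
          | add x y hx hy => simp only [map_add, mul_add, hx, hy]
          | tmul x y => simp
      rw [h3, hu]
      simp
  have h3 : ∃ s : K.horizontal ⊗[k] H,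
      -- The case n = 0 of `truncCoact_mem_range`: the coaction maps horizontal forms to Hor ⊗ Ω(H),
      -- which is then projected to Hor ⊗ H.
      TensorProduct.map K.horizontal.subtype LinearMap.id s = ρ.coact x := by
    obtain ⟨s, hs⟩ := K.truncCoact_mem_range (n := 0) hx D
    refine ⟨TensorProduct.map LinearMap.id CH.degZero.toLinearMap s, ?_⟩
    rw [truncCoact, projGE_zero, TensorProduct.map_id, LinearMap.id_comp] at hs
    rw [K.zeroCoaction_apply, ← hs]
    simp only [TensorProduct.map_map, LinearMap.id_comp, LinearMap.comp_id]
  obtain ⟨s, hs⟩ := h3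
  obtain ⟨t, ht⟩ := h2 s
  rw [hs, RightComoduleAlgebra.untwist_coact] at ht
  refine ⟨TensorProduct.map LinearMap.id K.horizontal.subtype t, ?_, ?_⟩
  · rw [h1, ht]
    simp
  · rw [← ht, TensorProduct.map_map, LinearMap.comp_id, LinearMap.id_comp]
    rfl

/-- Horizontal forms are linear combinations of products of elements of `A` and basic forms. -/
theorem horizontal_le_span (hδ : δ.IsQuantumPrincipalBundle)
    (hS : Function.Bijective (HopfAlgebra.antipode k : H →ₗ[k] H))
    (D : CompleteCalculus (RightComoduleAlgebra.regular k H) CH CH) {x : ΩA}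
    (hx : x ∈ K.horizontal) :
    x ∈ Submodule.span k {y | ∃ (a : A) (b : K.basicForms), y = CA.incl a * b} := by
  obtain ⟨t, ht, ht'⟩ := K.exists_inclCan_eq hδ hS hx D
  -- The kernel of Δ − j is Ω(B). Both Δ and j send t to x ⊗ 1 ⊗ 1 under the canonical map, so
  -- flatness puts t in A ⊗ Ω(B) modulo relations; multiplying out returns x.
  let j : ΩA →ₗ[k] ΩA ⊗[k] ΩH := (TensorProduct.mk k ΩA ΩH).flip 1
  have hj : ∀ b y, j (b * y) = mulFst k ΩH b (j y) := fun b y => rfl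
  have hu : RightComoduleAlgebra.canTensor (K.zeroCoaction D) CA.incl ΩH
      (TensorProduct.map LinearMap.id (K.coactLin - j) t) = 0 := by
    have h1 := K.canTensor_map D LinearMap.id t
    rw [TensorProduct.map_id, LinearMap.id_comp, ht, TensorProduct.map_id, LinearMap.id_apply,
      TensorProduct.map_tmul, leftCoaction_one, TensorProduct.assoc_symm_tmul, LinearMap.id_apply] at h1
    have h2 : ∀ u : A ⊗[k] ΩA, RightComoduleAlgebra.canTensor (K.zeroCoaction D) CA.incl ΩH
        (TensorProduct.map LinearMap.id j u) = RightComoduleAlgebra.can (K.zeroCoaction D)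
          (TensorProduct.map CA.incl.toLinearMap LinearMap.id u) ⊗ₜ 1 := fun u => by
      induction u using TensorProduct.induction_on with
      | zero => simp
      | add x y hx hy => simp only [map_add, TensorProduct.add_tmul, hx, hy]
      | tmul a y => rfl
    have h3 : TensorProduct.map (LinearMap.id : A →ₗ[k] A) (K.coactLin - j) =
        TensorProduct.map LinearMap.id K.coactLin - TensorProduct.map LinearMap.id j :=
      LinearMap.lTensor_sub _ _
    rw [h3, LinearMap.sub_apply, map_sub, h1, h2, ht', sub_self]
  obtain ⟨s, hs⟩ := K.exists_sub_mem_of_canTensor_eq_zero D hδ hS (K.coactLin - j)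
    (fun b hb y => by
      rw [LinearMap.sub_apply, LinearMap.sub_apply, mul_coactLin_of_mem K hb, hj, map_sub]) hu
  have hs' := mul'_eq_zero_of_mem_balancedRel hs
  have hx' : LinearMap.mul' k ΩA (TensorProduct.map CA.incl.toLinearMap LinearMap.id t) = x := by
    rw [K.mul'_eq_gradedCan]
    change TensorProduct.rid k ΩA (TensorProduct.map _ _ (K.inclCan t)) = _
    rw [ht]
    simp
  rw [map_sub, hx', sub_eq_zero] at hs'
  rw [hs']
  clear hs hs'
  induction s using TensorProduct.induction_on with
  | zero => rw [map_zero, map_zero]; exact Submodule.zero_mem _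
  | add x y hx hy => rw [map_add, map_add]; exact Submodule.add_mem _ hx hy
  | tmul a y =>
    refine Submodule.subset_span ⟨a, ⟨y, ?_⟩, rfl⟩
    have hy : K.coactLin y - j y = 0 := y.2
    exact congrArg (of k grA grH) (sub_eq_zero.1 hy)

/-- Horizontal forms are sums of ab with b basic, and ab ⊗ p ≡ a ⊗ bp. The first tensor factor is
thereby brought into A, where flatness over B applies. -/
theorem exists_incl_tmul (hδ : δ.IsQuantumPrincipalBundle)
    (hS : Function.Bijective (HopfAlgebra.antipode k : H →ₗ[k] H))
    (D : CompleteCalculus (RightComoduleAlgebra.regular k H) CH CH)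
    (z : K.horizontal ⊗[k] ΩA) : ∃ u : A ⊗[k] ΩA,
      TensorProduct.map K.horizontal.subtype LinearMap.id z -
        TensorProduct.map CA.incl.toLinearMap LinearMap.id u ∈ balancedRel K.basicForms ΩA := by
  induction z using TensorProduct.induction_on with
  | zero => exact ⟨0, by simp⟩
  | add x y hx hy =>
    obtain ⟨u, hu⟩ := hx
    obtain ⟨u', hu'⟩ := hy
    refine ⟨u + u', ?_⟩
    rw [map_add, map_add, add_sub_add_comm]
    exact Submodule.add_mem _ hu hu'
  | tmul x p =>
    obtain ⟨x, hx⟩ := x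
    rw [TensorProduct.map_tmul, Submodule.subtype_apply, LinearMap.id_apply]
    change ∃ u, x ⊗ₜ[k] p - _ ∈ _
    have hx' := K.horizontal_le_span hδ hS D hx
    clear hx
    induction hx' using Submodule.span_induction with
    | zero => exact ⟨0, by simp⟩
    | add x y _ _ hx hy =>
      obtain ⟨u, hu⟩ := hx
      obtain ⟨u', hu'⟩ := hy
      refine ⟨u + u', ?_⟩
      rw [TensorProduct.add_tmul, map_add, add_sub_add_comm]
      exact Submodule.add_mem _ hu hu'
    | smul c x _ hx =>
      obtain ⟨u, hu⟩ := hx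
      refine ⟨c • u, ?_⟩
      rw [map_smul, ← TensorProduct.smul_tmul', ← smul_sub]
      exact Submodule.smul_mem _ _ hu
    | mem x hx =>
      obtain ⟨a, b, rfl⟩ := hx
      exact ⟨a ⊗ₜ (b * p), Submodule.subset_span ⟨_, b, p, rfl⟩⟩

/-- Write 1 ⊗ q as a sum of xΔ(y) of total degree n. If x has positive degree, the coaction of y has
no component of degree n in Ω(H), so only terms with x in A contribute to the truncation. -/
theorem exists_inclCan_eq_proj (hδ : δ.IsQuantumPrincipalBundle) (n : ℕ) :
    ∃ T : ΩH →ₗ[k] A ⊗[k] ΩA, ∀ q,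
      TensorProduct.map LinearMap.id (projGE grH n) (K.inclCan (T q)) =
        1 ⊗ₜ GradedAlgebra.proj grH n q := by
  let Φ : A ⊗[k] ΩA →ₗ[k] ΩA ⊗[k] ΩH :=
    TensorProduct.map LinearMap.id (projGE grH n) ∘ₗ K.inclCan
  have h1 : ∀ q ∈ grH n, (1 : ΩA) ⊗ₜ[k] q ∈ LinearMap.range Φ := fun q hq => by
    have h2 : K.galoisSpan n ≤ (LinearMap.range Φ).comap
        (TensorProduct.map LinearMap.id (projGE grH n) ∘ₗ (of k grA grH).symm.toLinearMap) := by
      refine galoisSpan_induction fun i j hij x hx y hy => ?_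
      have h3 : (TensorProduct.map LinearMap.id (projGE grH n) ∘ₗ
          (of k grA grH).symm.toLinearMap) (includeLeft grA grH x * K.coact y) =
          mulFst k ΩH x (K.truncCoact n y) := by
        rw [← of_coactLin, ← of_mulFst, LinearMap.comp_apply, LinearEquiv.coe_coe,
          LinearEquiv.symm_apply_apply, map_mulFst]
        rfl
      rw [Submodule.mem_comap, h3]
      obtain rfl | hi := Nat.eq_zero_or_pos i
      · obtain ⟨a, rfl⟩ := CA.exists_incl_of_mem hx
        refine ⟨a ⊗ₜ y, ?_⟩
        rw [LinearMap.comp_apply, inclCan_tmul, map_mulFst]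
        rfl
      · rw [K.truncCoact_of_lt (by omega) hy, map_zero]
        exact Submodule.zero_mem _
    have h3 := h2 (includeRight_mem_galoisSpan hδ hq)
    have h4 : (TensorProduct.map LinearMap.id (projGE grH n) ∘ₗ
        (of k grA grH).symm.toLinearMap) (includeRight grA grH q) =
        (1 : ΩA) ⊗ₜ[k] projGE grH n q := rfl
    rwa [Submodule.mem_comap, h4, projGE_of_le le_rfl hq] at h3
  obtain ⟨s, hs⟩ := LinearMap.exists_rightInverse_of_surjective Φ.rangeRestrict
    Φ.range_rangeRestrict
  let p : ΩH →ₗ[k] LinearMap.range Φ :=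
    (TensorProduct.mk k ΩA ΩH 1 ∘ₗ GradedAlgebra.proj grH n).codRestrict (LinearMap.range Φ)
      fun q => h1 _ (proj_mem grH n q)
  exact ⟨s ∘ₗ p, fun q => congrArg Subtype.val (LinearMap.congr_fun hs (p q))⟩

/-- The span of the tensors `x ⊗ y` with `y` in the kernel of the truncated coaction. -/
def kerSpan (n : ℕ) : Submodule k (ΩA ⊗[k] ΩA) :=
  LinearMap.range (TensorProduct.map (LinearMap.id : ΩA →ₗ[k] ΩA)
    (LinearMap.ker (K.truncCoact n)).subtype)

theorem mulFst_mem_kerSpan {n : ℕ} {t : ΩA ⊗[k] ΩA} (ht : t ∈ K.kerSpan n) (x : ΩA) :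
    mulFst k ΩA x t ∈ K.kerSpan n := by
  obtain ⟨s, rfl⟩ := ht
  exact ⟨TensorProduct.map (LinearMap.mulLeft k x) LinearMap.id s, by
    rw [mulFst, TensorProduct.map_map, TensorProduct.map_map]; rfl⟩

theorem mulFst_mem_sup {n : ℕ} {t : ΩA ⊗[k] ΩA}
    (ht : t ∈ balancedRel K.basicForms ΩA ⊔ K.kerSpan n) (x : ΩA) :
    mulFst k ΩA x t ∈ balancedRel K.basicForms ΩA ⊔ K.kerSpan n := by
  obtain ⟨r, hr, s, hs, rfl⟩ := Submodule.mem_sup.1 ht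
  rw [map_add]
  exact Submodule.add_mem_sup (balancedRel_mulFst_mem x hr) (K.mulFst_mem_kerSpan hs x)

/-- The map `x ⊗ q ↦ x T(q)`. -/
def mulLift (T : ΩH →ₗ[k] A ⊗[k] ΩA) : ΩA ⊗[k] ΩH →ₗ[k] ΩA ⊗[k] ΩA :=
  TensorProduct.map (LinearMap.mul' k ΩA) LinearMap.id ∘ₗ
    (TensorProduct.assoc k ΩA ΩA ΩA).symm.toLinearMap ∘ₗ
    TensorProduct.map LinearMap.id (TensorProduct.map CA.incl.toLinearMap LinearMap.id ∘ₗ T)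

theorem mulLift_tmul (T : ΩH →ₗ[k] A ⊗[k] ΩA) (x : ΩA) (q : ΩH) :
    mulLift (CA := CA) T (x ⊗ₜ q) =
      mulFst k ΩA x (TensorProduct.map CA.incl.toLinearMap LinearMap.id (T q)) := by
  simp only [mulLift, LinearMap.comp_apply, TensorProduct.map_tmul, LinearEquiv.coe_coe]
  generalize TensorProduct.map CA.incl.toLinearMap LinearMap.id (T q) = t
  induction t using TensorProduct.induction_on with
  | zero => simp
  | add x y hx hy => simp only [map_add, TensorProduct.tmul_add, hx, hy]
  | tmul y z => rfl

theorem mulFst_mul (x y : ΩA) (t : ΩA ⊗[k] ΩA) :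
    mulFst k ΩA (x * y) t = mulFst k ΩA x (mulFst k ΩA y t) := by
  induction t using TensorProduct.induction_on with
  | zero => simp
  | add x y hx hy => simp only [map_add, hx, hy]
  | tmul z q => simp only [mulFst_tmul, mul_assoc]

theorem mulLift_mulFst (T : ΩH →ₗ[k] A ⊗[k] ΩA) (x : ΩA) (t : ΩA ⊗[k] ΩH) :
    mulLift (CA := CA) T (mulFst k ΩH x t) = mulFst k ΩA x (mulLift (CA := CA) T t) := by
  induction t using TensorProduct.induction_on with
  | zero => simp
  | add x y hx hy => simp only [map_add, hx, hy]
  | tmul y q =>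
    rw [mulFst_tmul, mulLift_tmul, mulLift_tmul, mulFst_mul]

/-- The subtracted term has the same truncated coaction as y and its first factors are horizontal.
Modulo relations the difference is thus some u in A ⊗ Ω(A) with vanishing truncated canonical image,
to which Hopf module injectivity and flatness apply. -/
theorem one_tmul_sub_mulLift_mem (hδ : δ.IsQuantumPrincipalBundle)
    (hS : Function.Bijective (HopfAlgebra.antipode k : H →ₗ[k] H))
    (D : CompleteCalculus (RightComoduleAlgebra.regular k H) CH CH) {n : ℕ}
    {T : ΩH →ₗ[k] A ⊗[k] ΩA} (hT : ∀ q,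
      TensorProduct.map LinearMap.id (projGE grH n) (K.inclCan (T q)) =
        1 ⊗ₜ GradedAlgebra.proj grH n q) {y : ΩA} (hy : K.truncCoact (n + 1) y = 0) :
    1 ⊗ₜ y - mulLift (CA := CA) T (K.truncCoact n y) ∈
      balancedRel K.basicForms ΩA ⊔ K.kerSpan n := by
  -- As the components of degree above n vanish, only degree n survives; there `T` is an exact lift.
  have hgn : TensorProduct.map LinearMap.id (GradedAlgebra.proj grH n) (K.truncCoact n y) =
      K.truncCoact n y := by
    have h1 : K.truncCoact n y =
        TensorProduct.map LinearMap.id (GradedAlgebra.proj grH n) (K.coactLin y) := by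
      have h2 : K.truncCoact n = TensorProduct.map LinearMap.id (GradedAlgebra.proj grH n) ∘ₗ
          K.coactLin + K.truncCoact (n + 1) := by
        rw [truncCoact, truncCoact, projGE_succ n, TensorProduct.map_add_right, LinearMap.add_comp]
      rw [h2, LinearMap.add_apply, hy, add_zero, LinearMap.comp_apply]
    rw [h1, TensorProduct.map_map, LinearMap.id_comp]
    congr 2
    exact LinearMap.ext fun q => proj_of_mem (proj_mem grH n q)
  have hR : ∀ t, TensorProduct.map LinearMap.id (projGE grH n)
      (K.gradedCan (mulLift (CA := CA) T t)) =
      TensorProduct.map LinearMap.id (GradedAlgebra.proj grH n) t := fun t => by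
    induction t using TensorProduct.induction_on with
    | zero => simp
    | add x y hx hy => simp only [map_add, hx, hy]
    | tmul x q =>
      rw [mulLift_tmul, gradedCan_mulFst, map_mulFst]
      refine (congrArg _ (hT q)).trans ?_
      simp
  have hz : ∀ s : K.horizontal ⊗[k] ΩH, ∃ z : K.horizontal ⊗[k] ΩA,
      TensorProduct.map K.horizontal.subtype LinearMap.id z =
        mulLift (CA := CA) T (TensorProduct.map K.horizontal.subtype LinearMap.id s) := fun s => by
    induction s using TensorProduct.induction_on with
    | zero => exact ⟨0, by simp⟩
    | add x y hx hy =>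
      obtain ⟨z, hz⟩ := hx
      obtain ⟨z', hz'⟩ := hy
      exact ⟨z + z', by simp only [map_add, hz, hz']⟩
    | tmul x q =>
      let m : A →ₗ[k] K.horizontal :=
        (LinearMap.mulLeft k (x : ΩA) ∘ₗ CA.incl.toLinearMap).codRestrict K.horizontal
          fun a => K.mul_mem_horizontal x.2 (K.incl_mem_horizontal a) D
      refine ⟨TensorProduct.map m LinearMap.id (T q), ?_⟩
      rw [TensorProduct.map_tmul, mulLift_tmul, mulFst, TensorProduct.map_map,
        TensorProduct.map_map]
      rfl
  obtain ⟨s, hs⟩ := K.truncCoact_mem_range hy D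
  obtain ⟨z, hz⟩ := hz s
  rw [hs] at hz
  have h1 : (1 : ΩA) ∈ K.horizontal := by
    rw [← map_one CA.incl]; exact K.incl_mem_horizontal 1
  obtain ⟨u, hu⟩ := K.exists_incl_tmul hδ hS D ((⟨1, h1⟩ : K.horizontal) ⊗ₜ y - z)
  rw [map_sub, hz, TensorProduct.map_tmul, Submodule.subtype_apply, LinearMap.id_apply] at hu
  have hcan := K.gradedCan_eq_zero_of_mem hu
  rw [map_sub, sub_eq_zero] at hcan
  have hcan' := congrArg (TensorProduct.map (LinearMap.id : ΩA →ₗ[k] ΩA) (projGE grH n)) hcan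
  have hone : TensorProduct.map (LinearMap.id : ΩA →ₗ[k] ΩA) (projGE grH n)
      (K.gradedCan (1 ⊗ₜ y)) = K.truncCoact n y := by
    rw [gradedCan_tmul, mulFst, LinearMap.mulLeft_one, TensorProduct.map_id, LinearMap.id_apply]
    rfl
  rw [map_sub, map_sub, hR, hgn, hone, sub_self] at hcan'
  obtain ⟨v, hv⟩ := K.exists_sub_mem_of_canTensor_eq_zero D hδ hS (K.truncCoact n)
    (fun b hb x => K.truncCoact_mul n hb x) (u := u) (by
      have h2 := K.canTensor_map D (projGE grH n) u
      have h3 : ∀ t : ΩA ⊗[k] ΩH, TensorProduct.map LinearMap.id (projGE grH n)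
          ((TensorProduct.assoc k ΩA H ΩH).symm (TensorProduct.map LinearMap.id D.leftCoaction t)) =
          (TensorProduct.assoc k ΩA H ΩH).symm (TensorProduct.map LinearMap.id D.leftCoaction
            (TensorProduct.map LinearMap.id (projGE grH n) t)) := fun t => by
        rw [TensorProduct.map_map, leftCoaction_projGE]
        induction t using TensorProduct.induction_on with
        | zero => simp
        | add x y hx hy => simp only [map_add, hx, hy]
        | tmul x q =>
          simp only [TensorProduct.map_tmul, LinearMap.comp_apply, LinearMap.id_apply]
          generalize D.leftCoaction q = t
          induction t using TensorProduct.induction_on with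
          | zero => simp
          | add x y hx hy => simp only [map_add, TensorProduct.tmul_add, hx, hy]
          | tmul x q => rfl
      rw [h3] at h2
      refine h2.trans ?_
      have h4 : TensorProduct.map (LinearMap.id : ΩA →ₗ[k] ΩA) (projGE grH n) (K.inclCan u) = 0 :=
        hcan'.symm
      rw [h4, map_zero, map_zero])
  have hv' : TensorProduct.map CA.incl.toLinearMap (LinearMap.ker (K.truncCoact n)).subtype v ∈
      K.kerSpan n := ⟨TensorProduct.map CA.incl.toLinearMap LinearMap.id v, by
    rw [TensorProduct.map_map]; rfl⟩
  have := Submodule.add_mem_sup (Submodule.add_mem _ hu hv) hv'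
  simpa using this

/-- Summing the previous congruence over the terms of t, multiplied by their first factors, the
correction becomes the lift of the truncation of χ(t), which is zero. -/
theorem mem_sup_kerSpan (hδ : δ.IsQuantumPrincipalBundle)
    (hS : Function.Bijective (HopfAlgebra.antipode k : H →ₗ[k] H))
    (D : CompleteCalculus (RightComoduleAlgebra.regular k H) CH CH) {n : ℕ} {t : ΩA ⊗[k] ΩA}
    (ht : t ∈ K.kerSpan (n + 1)) (h0 : K.gradedCan t = 0) :
    t ∈ balancedRel K.basicForms ΩA ⊔ K.kerSpan n := by
  obtain ⟨T, hT⟩ := K.exists_inclCan_eq_proj hδ n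
  obtain ⟨s, rfl⟩ := ht
  have key : ∀ s : ΩA ⊗[k] LinearMap.ker (K.truncCoact (n + 1)),
      TensorProduct.map LinearMap.id (LinearMap.ker (K.truncCoact (n + 1))).subtype s -
        mulLift (CA := CA) T (TensorProduct.map LinearMap.id (projGE grH n) (K.gradedCan
          (TensorProduct.map LinearMap.id (LinearMap.ker (K.truncCoact (n + 1))).subtype s))) ∈
      balancedRel K.basicForms ΩA ⊔ K.kerSpan n := fun s => by
    induction s using TensorProduct.induction_on with
    | zero => simp only [map_zero, sub_zero]; exact Submodule.zero_mem _
    | add x y hx hy =>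
      simp only [map_add]
      rw [add_sub_add_comm]
      exact Submodule.add_mem _ hx hy
    | tmul x y =>
      have h := K.mulFst_mem_sup (K.one_tmul_sub_mulLift_mem hδ hS D hT y.2) x
      rw [map_sub, mulFst_tmul, mul_one, ← mulLift_mulFst] at h
      rw [TensorProduct.map_tmul, gradedCan_tmul, map_mulFst]
      exact h
  have := key s
  rwa [h0, map_zero, map_zero, sub_zero] at this

/-- The descent ends because the truncated coaction at 0 is injective by counitality. It can start
because a form of degree n lies in the kernel of the truncation at n + 1. -/
theorem mem_balancedRel_of_gradedCan_eq_zero (hδ : δ.IsQuantumPrincipalBundle)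
    (hS : Function.Bijective (HopfAlgebra.antipode k : H →ₗ[k] H))
    (D : CompleteCalculus (RightComoduleAlgebra.regular k H) CH CH) {t : ΩA ⊗[k] ΩA}
    (h0 : K.gradedCan t = 0) : t ∈ balancedRel K.basicForms ΩA := by
  have h1 : ∀ n, ∀ t ∈ K.kerSpan n, K.gradedCan t = 0 → t ∈ balancedRel K.basicForms ΩA := by
    intro n
    induction n with
    | zero =>
      rintro _ ⟨s, rfl⟩ -
      have : (LinearMap.ker (K.truncCoact 0)).subtype = 0 := by
        ext x
        exact (Submodule.mem_bot k).1 (K.ker_truncCoact_zero.le x.2)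
      rw [this, TensorProduct.map_zero_right]
      exact Submodule.zero_mem _
    | succ n ih =>
      intro t ht h0
      obtain ⟨r, hr, s, hs, rfl⟩ := Submodule.mem_sup.1 (K.mem_sup_kerSpan hδ hS D ht h0)
      rw [map_add, K.gradedCan_eq_zero_of_mem hr, zero_add] at h0
      exact Submodule.add_mem _ hr (ih s hs h0)
  have hmono : ∀ n, K.kerSpan n ≤ K.kerSpan (n + 1) := by
    rintro n _ ⟨s, rfl⟩
    have hle : LinearMap.ker (K.truncCoact n) ≤ LinearMap.ker (K.truncCoact (n + 1)) := fun x hx => by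
      have hx' : K.truncCoact n x = 0 := hx
      change K.truncCoact (n + 1) x = 0
      rw [truncCoact, ← projGE_succ_comp_projGE, LinearMap.comp_apply, ← LinearMap.id_comp LinearMap.id,
        ← TensorProduct.map_map]
      refine (congrArg _ hx').trans (map_zero _)
    exact ⟨TensorProduct.map LinearMap.id (Submodule.inclusion hle) s, by
      rw [TensorProduct.map_map]; rfl⟩
  have hmono' : Monotone K.kerSpan := monotone_nat_of_le_succ hmono
  have hex : ∃ n, t ∈ K.kerSpan n := by
    clear h0
    induction t using TensorProduct.induction_on with
    | zero => exact ⟨0, Submodule.zero_mem _⟩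
    | add x y hx hy =>
      obtain ⟨n, hn⟩ := hx
      obtain ⟨m, hm⟩ := hy
      exact ⟨max n m, Submodule.add_mem _ (hmono' (le_max_left n m) hn)
        (hmono' (le_max_right n m) hm)⟩
    | tmul x y =>
      have hy : y ∈ ⨆ n, grA n := by rw [iSup_gr_eq_top]; trivial
      induction hy using Submodule.iSup_induction' with
      | zero => exact ⟨0, by rw [TensorProduct.tmul_zero]; exact Submodule.zero_mem _⟩
      | mem n y hy => exact ⟨n + 1, x ⊗ₜ ⟨y, K.truncCoact_of_lt (Nat.lt_succ_self n) hy⟩, rfl⟩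
      | add y z _ _ hy hz =>
        obtain ⟨n, hn⟩ := hy
        obtain ⟨m, hm⟩ := hz
        refine ⟨max n m, ?_⟩
        rw [TensorProduct.tmul_add]
        exact Submodule.add_mem _ (hmono' (le_max_left n m) hn) (hmono' (le_max_right n m) hm)
  obtain ⟨n, hn⟩ := hex
  exact h1 n t hn h0

theorem gradedGalois_bijective (hδ : δ.IsQuantumPrincipalBundle)
    (hS : Function.Bijective (HopfAlgebra.antipode k : H →ₗ[k] H))
    (D : CompleteCalculus (RightComoduleAlgebra.regular k H) CH CH) :
    Function.Bijective K.gradedGalois := by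
  constructor
  · rw [injective_iff_map_eq_zero]
    intro x hx
    obtain ⟨t, rfl⟩ := Submodule.Quotient.mk_surjective _ x
    rw [Submodule.Quotient.mk_eq_zero]
    exact K.mem_balancedRel_of_gradedCan_eq_zero hδ hS D ((of k grA grH).injective
      (by rw [← gradedGalois_mk, hx, map_zero]))
  · intro y
    obtain ⟨t, ht⟩ := K.gradedCan_surjective hδ ((of k grA grH).symm y)
    exact ⟨Submodule.Quotient.mk t, by rw [gradedGalois_mk, ht, LinearEquiv.apply_symm_apply]⟩

end CompleteCalculus

/-! ### Graded gauge transformations -/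

namespace DifferentialCalculus.HopfExtension

open WithConv GradedTensorProduct

variable {k H Ω : Type*} [Field k] [Ring H] [HopfAlgebra k H] [Ring Ω] [Algebra k Ω]
  {gr : ℕ → Submodule k Ω} [GradedAlgebra gr] {C : DifferentialCalculus k H gr}
  (E : C.HopfExtension) {R R' : Type*} [Ring R] [Algebra k R] [Ring R'] [Algebra k R']

theorem conv_assoc (f g h : Ω →ₗ[k] R) : E.conv (E.conv f g) h = E.conv f (E.conv g h) :=
  let _ := E.coalgebra
  congrArg ofConv (mul_assoc (toConv f) (toConv g) (toConv h))

theorem convOne_conv (f : Ω →ₗ[k] R) : E.conv E.convOne f = f :=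
  let _ := E.coalgebra
  congrArg ofConv (one_mul (toConv f))

theorem conv_convOne (f : Ω →ₗ[k] R) : E.conv f E.convOne = f :=
  let _ := E.coalgebra
  congrArg ofConv (mul_one (toConv f))

theorem algHom_comp_conv (α : R →ₐ[k] R') (f g : Ω →ₗ[k] R) :
    α.toLinearMap ∘ₗ E.conv f g = E.conv (α.toLinearMap ∘ₗ f) (α.toLinearMap ∘ₗ g) := by
  ext q
  simp only [conv, LinearMap.comp_apply]
  generalize toTensor E.comul.toLinearMap q = t
  induction t using TensorProduct.induction_on with
  | zero => simp
  | add x y hx hy => simp only [map_add, hx, hy]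
  | tmul x y => simp

theorem algHom_comp_convOne (α : R →ₐ[k] R') :
    α.toLinearMap ∘ₗ (E.convOne : Ω →ₗ[k] R) = E.convOne := by
  ext q
  exact α.commutes _

theorem conv_one_apply (f g : Ω →ₗ[k] R) : E.conv f g 1 = f 1 * g 1 := by
  have h : toTensor E.comul.toLinearMap 1 = 1 ⊗ₜ 1 := map_one E.comul
  rw [conv, LinearMap.comp_apply, LinearMap.comp_apply, h]
  simp

theorem convOne_one : (E.convOne : Ω →ₗ[k] R) 1 = 1 := by
  simp [convOne]

theorem conv_degree {grR : ℕ → Submodule k R} [GradedAlgebra grR] {f g : Ω →ₗ[k] R}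
    (hf : ∀ n, ∀ ω ∈ gr n, f ω ∈ grR n) (hg : ∀ n, ∀ ω ∈ gr n, g ω ∈ grR n) (n : ℕ) (ω : Ω)
    (hω : ω ∈ gr n) : E.conv f g ω ∈ grR n :=
  let _ := E.coalgebra
  E.isGradedCoalgebra.conv_degree (f := toConv f) (g := toConv g) hf hg n ω hω

theorem convOne_degree {grR : ℕ → Submodule k R} [GradedAlgebra grR] (n : ℕ) (ω : Ω)
    (hω : ω ∈ gr n) : (E.convOne : Ω →ₗ[k] R) ω ∈ grR n :=
  let _ := E.coalgebra
  E.isGradedCoalgebra.one_degree n ω hω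

theorem conv_comp_antipode (α : Ω →ₐ[k] R) :
    E.conv α.toLinearMap (α.toLinearMap ∘ₗ E.antipode) = E.convOne := by
  rw [← E.algHom_comp_convOne α]
  refine Eq.trans ?_ (congrArg (α.toLinearMap ∘ₗ ·) E.mul_antipode)
  exact (E.algHom_comp_conv α LinearMap.id E.antipode).symm

theorem conv_antipode_comp (α : Ω →ₐ[k] R) :
    E.conv (α.toLinearMap ∘ₗ E.antipode) α.toLinearMap = E.convOne := by
  rw [← E.algHom_comp_convOne α]
  refine Eq.trans ?_ (congrArg (α.toLinearMap ∘ₗ ·) E.antipode_mul)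
  exact (E.algHom_comp_conv α E.antipode LinearMap.id).symm

end DifferentialCalculus.HopfExtension

/-! ### The convolution action, and colinearity in the convolution algebra -/

namespace CompleteCalculus

open GradedTensorProduct

variable {k H A ΩH ΩA : Type*} [Field k] [Ring H] [HopfAlgebra k H] [Ring A]
  [Algebra k A]
  [Ring ΩH] [Algebra k ΩH] {grH : ℕ → Submodule k ΩH} [GradedAlgebra grH]
  [Ring ΩA] [Algebra k ΩA] {grA : ℕ → Submodule k ΩA} [GradedAlgebra grA]
  {δ : RightComoduleAlgebra k H A}
  {CH : DifferentialCalculus k H grH} {CA : DifferentialCalculus k A grA}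
  (K : CompleteCalculus δ CH CA) (E : CH.HopfExtension)
  {R R' : Type*} [Ring R] [Algebra k R] [Ring R'] [Algebra k R']

/-- The convolution action `x ↦ φ(x₀) ψ(x₁)`. -/
def act (φ : ΩA →ₗ[k] R) (ψ : ΩH →ₗ[k] R) : ΩA →ₗ[k] R :=
  LinearMap.mul' k R ∘ₗ TensorProduct.map φ ψ ∘ₗ K.coactLin

theorem act_apply (φ : ΩA →ₗ[k] R) (ψ : ΩH →ₗ[k] R) (x : ΩA) :
    K.act φ ψ x = LinearMap.mul' k R (TensorProduct.map φ ψ (K.coactLin x)) := rfl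

/-- With `act_convOne`, the maps Ω(A) → R form a right module over the convolution algebra; this
replaces all later computations with Δ. -/
theorem act_act (φ : ΩA →ₗ[k] R) (ψ χ : ΩH →ₗ[k] R) :
    K.act (K.act φ ψ) χ = K.act φ (E.conv ψ χ) := by
  ext x
  have h := congrArg (fun t => LinearMap.mul' k R (TensorProduct.map
    (LinearMap.mul' k R ∘ₗ TensorProduct.map φ ψ) χ t)) (K.coassoc_apply E.toComplete x)
  refine Eq.trans ?_ (h.trans ?_)
  · rw [TensorProduct.map_map, act_apply]
    rfl
  · rw [act_apply]
    generalize K.coactLin x = t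
    induction t using TensorProduct.induction_on with
    | zero => simp
    | add x y hx hy => simp only [map_add, hx, hy]
    | tmul x q =>
      simp only [TensorProduct.map_tmul, LinearMap.id_apply,
        DifferentialCalculus.HopfExtension.conv, LinearMap.comp_apply]
      change LinearMap.mul' k R (TensorProduct.map _ _ ((TensorProduct.assoc k ΩA ΩH ΩH).symm
        (x ⊗ₜ toTensor E.comul.toLinearMap q))) = _
      generalize toTensor E.comul.toLinearMap q = t
      induction t using TensorProduct.induction_on with
      | zero => simp
      | add x y hx hy => simp only [map_add, TensorProduct.tmul_add, hx, hy]
      | tmul y z => simp [mul_assoc]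

theorem act_convOne (φ : ΩA →ₗ[k] R) : K.act φ E.convOne = φ := by
  ext x
  refine Eq.trans ?_ (congrArg φ (K.counit_apply x))
  rw [act_apply, DifferentialCalculus.HopfExtension.convOne, E.counit_eq]
  generalize K.coactLin x = t
  induction t using TensorProduct.induction_on with
  | zero => simp
  | add x y hx hy => simp only [map_add, hx, hy]
  | tmul x q => simp [Algebra.algebraMap_eq_smul_one]

theorem algHom_comp_act (α : R →ₐ[k] R') (φ : ΩA →ₗ[k] R) (ψ : ΩH →ₗ[k] R) :
    α.toLinearMap ∘ₗ K.act φ ψ = K.act (α.toLinearMap ∘ₗ φ) (α.toLinearMap ∘ₗ ψ) := by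
  ext x
  rw [LinearMap.comp_apply, act_apply, act_apply]
  generalize K.coactLin x = t
  induction t using TensorProduct.induction_on with
  | zero => simp
  | add x y hx hy => simp only [map_add, hx, hy]
  | tmul x q => simp

theorem act_comp (φ : ΩA →ₗ[k] R) (ψ : ΩH →ₗ[k] R) {F : ΩA →ₗ[k] ΩA}
    (hF : K.coactLin ∘ₗ F = TensorProduct.map F LinearMap.id ∘ₗ K.coactLin) :
    K.act φ ψ ∘ₗ F = K.act (φ ∘ₗ F) ψ := by
  rw [act, act, LinearMap.comp_assoc, LinearMap.comp_assoc, hF, ← LinearMap.comp_assoc _ _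
    (TensorProduct.map φ ψ), ← TensorProduct.map_comp, LinearMap.comp_id]

theorem of_map (F : ΩA →ₗ[k] ΩA) (t : ΩA ⊗[k] ΩH) :
    of k grA grH (TensorProduct.map F LinearMap.id t) = LinearMap.mul' k (grA ᵍ⊗[k] grH)
      (TensorProduct.map ((includeLeft grA grH).toLinearMap ∘ₗ F)
        (includeRight grA grH).toLinearMap t) := by
  induction t using TensorProduct.induction_on with
  | zero => simp
  | add x y hx hy => simp only [map_add, hx, hy]
  | tmul x q => exact (includeLeft_mul_includeRight (F x) q).symm

theorem act_includeLeft (F : ΩA →ₗ[k] ΩA) :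
    K.act ((includeLeft grA grH).toLinearMap ∘ₗ F) (includeRight grA grH).toLinearMap =
      (of k grA grH).toLinearMap ∘ₗ TensorProduct.map F LinearMap.id ∘ₗ K.coactLin :=
  LinearMap.ext fun _ => (of_map F _).symm

theorem coact_eq_act : K.coact.toLinearMap =
    K.act (includeLeft grA grH).toLinearMap (includeRight grA grH).toLinearMap := by
  have := K.act_includeLeft LinearMap.id
  rw [LinearMap.comp_id, TensorProduct.map_id, LinearMap.id_comp] at this
  exact this.symm

theorem mul'_map_gradedCan (α : ΩA →ₐ[k] R) (ψ : ΩH →ₗ[k] R) (t : ΩA ⊗[k] ΩA) :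
    LinearMap.mul' k R (TensorProduct.map α.toLinearMap ψ (K.gradedCan t)) =
      LinearMap.mul' k R (TensorProduct.map α.toLinearMap (K.act α.toLinearMap ψ) t) := by
  induction t using TensorProduct.induction_on with
  | zero => simp
  | add x y hx hy => simp only [map_add, hx, hy]
  | tmul x y =>
    rw [gradedCan_tmul, TensorProduct.map_tmul, act_apply, LinearMap.mul'_apply]
    generalize K.coactLin y = t
    induction t using TensorProduct.induction_on with
    | zero => simp
    | add x y hx hy => simp only [map_add, mul_add, hx, hy]
    | tmul y q => simp [mul_assoc]

/-- Writing 1 ⊗ q = Σ xΔ(y), which is possible as χ is surjective, gives φ(q) = Σ α(x)(α·φ)(y),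
where α·φ denotes the action. -/
theorem act_injective (hδ : δ.IsQuantumPrincipalBundle) (α : ΩA →ₐ[k] R) {φ ψ : ΩH →ₗ[k] R}
    (h : K.act α.toLinearMap φ = K.act α.toLinearMap ψ) : φ = ψ := by
  ext q
  obtain ⟨u, hu⟩ := K.gradedCan_surjective hδ (1 ⊗ₜ q)
  have h1 := K.mul'_map_gradedCan α φ u
  have h2 := K.mul'_map_gradedCan α ψ u
  rw [h, ← h2, hu] at h1
  simpa using h1

/-- The colinearity condition, written in the convolution algebra. -/
def IsConvColinear (f : ΩH →ₗ[k] ΩA) : Prop :=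
  E.conv (includeRight grA grH).toLinearMap (K.coact.toLinearMap ∘ₗ f) =
    E.conv ((includeLeft grA grH).toLinearMap ∘ₗ f) (includeRight grA grH).toLinearMap

theorem gradedFlip_tmul {Ω Ω' : Type*} [Ring Ω] [Algebra k Ω] [Ring Ω'] [Algebra k Ω']
    {gr : ℕ → Submodule k Ω} [GradedAlgebra gr] {gr' : ℕ → Submodule k Ω'} [GradedAlgebra gr']
    {i j : ℕ} {a : Ω} {b : Ω'} (ha : a ∈ gr i) (hb : b ∈ gr' j) :
    gradedFlip gr gr' (a ⊗ₜ b) = (-1 : k) ^ (i * j) • (b ⊗ₜ[k] a) := by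
  have h := comm_coe_tmul_coe (R := k) gr gr' (⟨a, ha⟩ : gr i) (⟨b, hb⟩ : gr' j)
  rw [units_smul_eq (k := k), mul_comm] at h
  exact congrArg (of k gr' gr).symm h

/-- The sign in Ad is the Koszul sign of moving 1 ⊗ S(ω₁) past f(ω₂) ⊗ 1. It is absorbed into the
graded product (1 ⊗ S(ω₁))(f(ω₂) ⊗ 1)(1 ⊗ ω₃). -/
theorem of_map_adjoint {f : ΩH →ₗ[k] ΩA} (hf : ∀ n, ∀ ω ∈ grH n, f ω ∈ grA n) :
    (of k grA grH).toLinearMap ∘ₗ TensorProduct.map f LinearMap.id ∘ₗ E.adjoint =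
      E.conv (E.conv ((includeRight grA grH).toLinearMap ∘ₗ E.antipode)
        ((includeLeft grA grH).toLinearMap ∘ₗ f)) (includeRight grA grH).toLinearMap := by
  have key : ∀ (t : grH ᵍ⊗[k] grH) (q : ΩH), of k grA grH (TensorProduct.map f LinearMap.id
      (TensorProduct.map LinearMap.id
        (LinearMap.mul' k ΩH ∘ₗ TensorProduct.map E.antipode LinearMap.id)
        (TensorProduct.assoc k ΩH ΩH ΩH
          (gradedFlip grH grH ((of k grH grH).symm t) ⊗ₜ q)))) =
      LinearMap.mul' k (grA ᵍ⊗[k] grH) (TensorProduct.map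
        ((includeRight grA grH).toLinearMap ∘ₗ E.antipode)
        ((includeLeft grA grH).toLinearMap ∘ₗ f) ((of k grH grH).symm t)) *
          includeRight grA grH q := fun t q => by
    induction t using induction_homogeneous with
    | zero => simp
    | add x y hx hy => simp only [map_add, add_mul, TensorProduct.add_tmul, hx, hy]
    | tmul i j a ha b hb =>
      have h : (of k grH grH).symm (tmul k a b) = a ⊗ₜ b := rfl
      rw [h, gradedFlip_tmul ha hb, ← TensorProduct.smul_tmul']
      simp only [map_smul, TensorProduct.assoc_tmul, TensorProduct.map_tmul, LinearMap.comp_apply,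
        LinearMap.id_apply, LinearMap.mul'_apply, AlgHom.toLinearMap_apply]
      rw [includeRight_mul_includeLeft (hf j b hb) (E.antipode_mem i a ha), smul_mul_assoc,
        tmul_mul_includeRight]
  ext q
  simp only [LinearMap.comp_apply, DifferentialCalculus.HopfExtension.adjoint,
    DifferentialCalculus.HopfExtension.conv, LinearEquiv.coe_coe]
  generalize toTensor E.comul.toLinearMap q = t
  induction t using TensorProduct.induction_on with
  | zero => simp
  | add x y hx hy => simp only [map_add, hx, hy]
  | tmul p q => exact key (E.comul p) q

/-- Since i_R ∘ S is the convolution inverse of i_R, it can be moved to the other side, and the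
antipode disappears from the condition. -/
theorem colinear_iff {f : ΩH →ₗ[k] ΩA} (hf : ∀ n, ∀ ω ∈ grH n, f ω ∈ grA n) :
    toTensor K.coact.toLinearMap ∘ₗ f = TensorProduct.map f LinearMap.id ∘ₗ E.adjoint ↔
      K.IsConvColinear E f := by
  have h1 : toTensor K.coact.toLinearMap ∘ₗ f =
      TensorProduct.map f LinearMap.id ∘ₗ E.adjoint ↔ K.coact.toLinearMap ∘ₗ f =
        (of k grA grH).toLinearMap ∘ₗ TensorProduct.map f LinearMap.id ∘ₗ E.adjoint := by
    constructor
    · intro h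
      rw [← h]
      rfl
    · intro h
      rw [toTensor, LinearMap.comp_assoc, h]
      rfl
  rw [h1, of_map_adjoint E hf, IsConvColinear, E.conv_assoc]
  constructor
  · intro h
    rw [h, ← E.conv_assoc, E.conv_comp_antipode, E.convOne_conv]
  · intro h
    rw [← h, ← E.conv_assoc, E.conv_antipode_comp, E.convOne_conv]

variable {K E}

theorem IsConvColinear.conv {f g : ΩH →ₗ[k] ΩA} (hf : K.IsConvColinear E f)
    (hg : K.IsConvColinear E g) : K.IsConvColinear E (E.conv f g) := by
  rw [IsConvColinear] at *
  rw [E.algHom_comp_conv, E.algHom_comp_conv, ← E.conv_assoc, hf, E.conv_assoc, hg, E.conv_assoc]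

theorem IsConvColinear.one : K.IsConvColinear E E.convOne := by
  rw [IsConvColinear, E.algHom_comp_convOne, E.algHom_comp_convOne, E.conv_convOne, E.convOne_conv]

/-- Multiply i_R * (Δ∘f) = (i_L∘f) * i_R by i_L∘g on the left and by Δ∘g on the right. -/
theorem IsConvColinear.inverse {f g : ΩH →ₗ[k] ΩA} (hf : K.IsConvColinear E f)
    (hfg : E.conv f g = E.convOne) (hgf : E.conv g f = E.convOne) : K.IsConvColinear E g := by
  rw [IsConvColinear] at *
  have h1 := E.algHom_comp_conv (includeLeft grA grH) g f
  have h2 := E.algHom_comp_conv K.coact f g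
  rw [hgf, E.algHom_comp_convOne] at h1
  rw [hfg, E.algHom_comp_convOne] at h2
  rw [← E.convOne_conv (E.conv _ (K.coact.toLinearMap ∘ₗ g)), h1, E.conv_assoc,
    ← E.conv_assoc _ (includeRight grA grH).toLinearMap, ← hf, E.conv_assoc, ← h2, E.conv_convOne]

end CompleteCalculus

namespace CompleteCalculus

open GradedTensorProduct

variable {k H A ΩH ΩA : Type*} [Field k] [Ring H] [HopfAlgebra k H] [Ring A]
  [Algebra k A]
  [Ring ΩH] [Algebra k ΩH] {grH : ℕ → Submodule k ΩH} [GradedAlgebra grH]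
  [Ring ΩA] [Algebra k ΩA] {grA : ℕ → Submodule k ΩA} [GradedAlgebra grA]
  {δ : RightComoduleAlgebra k H A}
  {CH : DifferentialCalculus k H grH} {CA : DifferentialCalculus k A grA}
  {K : CompleteCalculus δ CH CA} {E : CH.HopfExtension}

/-! ### The group of gauge transformations -/

theorem IsGradedGauge.isConvColinear {f : ΩH →ₗ[k] ΩA} (hf : K.IsGradedGauge E f) :
    K.IsConvColinear E f :=
  (K.colinear_iff E hf.degree_zero).1 hf.colinear

theorem IsGradedGauge.conv {f g : ΩH →ₗ[k] ΩA} (hf : K.IsGradedGauge E f)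
    (hg : K.IsGradedGauge E g) : K.IsGradedGauge E (E.conv f g) where
  degree_zero := E.conv_degree hf.degree_zero hg.degree_zero
  conv_invertible := by
    obtain ⟨f', hf', h1, h2⟩ := hf.conv_invertible
    obtain ⟨g', hg', h3, h4⟩ := hg.conv_invertible
    refine ⟨E.conv g' f', E.conv_degree hg' hf', ?_, ?_⟩
    · rw [E.conv_assoc, ← E.conv_assoc g, h3, E.convOne_conv, h1]
    · rw [E.conv_assoc, ← E.conv_assoc f', h2, E.convOne_conv, h4]
  unital := by rw [E.conv_one_apply, hf.unital, hg.unital, one_mul]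
  colinear := (K.colinear_iff E (E.conv_degree hf.degree_zero hg.degree_zero)).2
    (hf.isConvColinear.conv hg.isConvColinear)

theorem IsGradedGauge.one : K.IsGradedGauge E E.convOne where
  degree_zero := E.convOne_degree
  conv_invertible := ⟨E.convOne, E.convOne_degree, E.conv_convOne _, E.conv_convOne _⟩
  unital := E.convOne_one
  colinear := (K.colinear_iff E E.convOne_degree).2 IsConvColinear.one

theorem IsGradedGauge.exists_inverse {f : ΩH →ₗ[k] ΩA} (hf : K.IsGradedGauge E f) :
    ∃ g, K.IsGradedGauge E g ∧ E.conv f g = E.convOne ∧ E.conv g f = E.convOne := by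
  obtain ⟨g, hg, h1, h2⟩ := hf.conv_invertible
  refine ⟨g, ⟨hg, ⟨f, hf.degree_zero, h2, h1⟩, ?_, ?_⟩, h1, h2⟩
  · have h := LinearMap.congr_fun h1 1
    rwa [E.conv_one_apply, hf.unital, one_mul, E.convOne_one] at h
  · exact (K.colinear_iff E hg).2 (hf.isConvColinear.inverse h1 h2)

instance : Group (K.GradedGauge E) where
  mul f g := ⟨E.conv f.1 g.1, f.2.conv g.2⟩
  one := ⟨E.convOne, IsGradedGauge.one⟩
  inv f := ⟨f.2.exists_inverse.choose, f.2.exists_inverse.choose_spec.1⟩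
  mul_assoc f g h := Subtype.ext (E.conv_assoc f.1 g.1 h.1)
  one_mul f := Subtype.ext (E.convOne_conv f.1)
  mul_one f := Subtype.ext (E.conv_convOne f.1)
  inv_mul_cancel f := Subtype.ext f.2.exists_inverse.choose_spec.2.2

/-! ### The group of vertical automorphisms -/

theorem IsGradedVertical.id : K.IsGradedVertical LinearMap.id where
  degree_zero _ _ h := h
  left_linear _ _ _ := rfl
  bijective := Function.bijective_id
  unital := rfl
  colinear := by rw [TensorProduct.map_id]; rfl

theorem IsGradedVertical.comp {F G : ΩA →ₗ[k] ΩA} (hG : K.IsGradedVertical G)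
    (hF : K.IsGradedVertical F) : K.IsGradedVertical (G ∘ₗ F) where
  degree_zero n ω h := hG.degree_zero n _ (hF.degree_zero n ω h)
  left_linear b hb ω := by
    rw [LinearMap.comp_apply, hF.left_linear b hb, hG.left_linear b hb, LinearMap.comp_apply]
  bijective := hG.bijective.comp hF.bijective
  unital := by rw [LinearMap.comp_apply, hF.unital, hG.unital]
  colinear := by
    rw [← LinearMap.comp_assoc, hG.colinear, LinearMap.comp_assoc, hF.colinear,
      ← LinearMap.comp_assoc, ← TensorProduct.map_comp, LinearMap.comp_id]

theorem IsGradedVertical.exists_inverse {F : ΩA →ₗ[k] ΩA} (hF : K.IsGradedVertical F) :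
    ∃ G, K.IsGradedVertical G ∧ F ∘ₗ G = LinearMap.id ∧ G ∘ₗ F = LinearMap.id := by
  let e := LinearEquiv.ofBijective F hF.bijective
  let G : ΩA →ₗ[k] ΩA := e.symm.toLinearMap
  have h1 : ∀ x, F (G x) = x := e.apply_symm_apply
  have h2 : ∀ x, G (F x) = x := e.symm_apply_apply
  have hGF : G ∘ₗ F = LinearMap.id := LinearMap.ext h2
  have hFG : F ∘ₗ G = LinearMap.id := LinearMap.ext h1
  -- A degree-preserving map commutes with the projections, from which its inverse is seen to
  -- preserve degrees.
  have hproj : ∀ n, F ∘ₗ GradedAlgebra.proj grA n = GradedAlgebra.proj grA n ∘ₗ F := fun n => by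
    refine linearMap_ext_homogeneous grA fun m x hx => ?_
    rw [LinearMap.comp_apply, LinearMap.comp_apply]
    obtain rfl | hm := eq_or_ne m n
    · rw [proj_of_mem hx, proj_of_mem (hF.degree_zero m x hx)]
    · rw [proj_of_mem_ne hx hm, proj_of_mem_ne (hF.degree_zero m x hx) hm, map_zero]
  refine ⟨G, ⟨fun n ω hω => ?_, fun b hb ω => ?_, e.symm.bijective, ?_, ?_⟩, hFG, hGF⟩
  · have h : F (GradedAlgebra.proj grA n (G ω)) = F (G ω) := by
      refine (LinearMap.congr_fun (hproj n) (G ω)).trans ?_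
      rw [LinearMap.comp_apply, h1, proj_of_mem hω]
    rw [← hF.bijective.1 h]
    exact proj_mem grA n _
  · refine hF.bijective.1 ?_
    rw [h1, hF.left_linear b hb, h1]
  · refine hF.bijective.1 ?_
    rw [h1, hF.unital]
  · have h := congrArg (fun T => TensorProduct.map G LinearMap.id ∘ₗ T ∘ₗ G) hF.colinear
    change TensorProduct.map G LinearMap.id ∘ₗ (toTensor K.coact.toLinearMap ∘ₗ F) ∘ₗ G =
      TensorProduct.map G LinearMap.id ∘ₗ
        (TensorProduct.map F LinearMap.id ∘ₗ toTensor K.coact.toLinearMap) ∘ₗ G at h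
    rw [LinearMap.comp_assoc, hFG, LinearMap.comp_id, LinearMap.comp_assoc,
      ← LinearMap.comp_assoc _ _ (TensorProduct.map G LinearMap.id), ← TensorProduct.map_comp, hGF,
      LinearMap.comp_id, TensorProduct.map_id, LinearMap.id_comp] at h
    exact h.symm

instance : Group K.GradedVertical where
  mul F G := ⟨G.1 ∘ₗ F.1, G.2.comp F.2⟩
  one := ⟨LinearMap.id, IsGradedVertical.id⟩
  inv F := ⟨F.2.exists_inverse.choose, F.2.exists_inverse.choose_spec.1⟩
  mul_assoc _ _ _ := rfl
  one_mul _ := rfl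
  mul_one _ := rfl
  inv_mul_cancel F := Subtype.ext F.2.exists_inverse.choose_spec.2.1

/-! ### From gauge transformations to vertical automorphisms -/

theorem verticalOfGauge_eq_act (f : ΩH →ₗ[k] ΩA) : K.verticalOfGauge f = K.act LinearMap.id f := rfl

theorem coact_comp_act (f : ΩH →ₗ[k] ΩA) : K.coact.toLinearMap ∘ₗ K.act LinearMap.id f =
    K.act (includeLeft grA grH).toLinearMap
      (E.conv (includeRight grA grH).toLinearMap (K.coact.toLinearMap ∘ₗ f)) := by
  rw [algHom_comp_act, LinearMap.comp_id, ← K.act_act E, ← coact_eq_act]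

theorem IsConvColinear.act_colinear {f : ΩH →ₗ[k] ΩA} (hf : K.IsConvColinear E f) :
    K.coactLin ∘ₗ K.act LinearMap.id f =
      TensorProduct.map (K.act LinearMap.id f) LinearMap.id ∘ₗ K.coactLin := by
  have h := K.coact_comp_act (E := E) f
  rw [hf, ← K.act_act E] at h
  have h2 := K.algHom_comp_act (includeLeft grA grH) LinearMap.id f
  rw [LinearMap.comp_id] at h2
  rw [← h2, act_includeLeft] at h
  rw [coactLin, toTensor, LinearMap.comp_assoc, h]
  rfl

/-- Colinearity of the inner map lets it pass through the coaction; the module law then gives the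
product. The order is why vertical automorphisms carry the opposite composition. -/
theorem act_comp_act {f g : ΩH →ₗ[k] ΩA} (hf : K.IsConvColinear E f) :
    K.act LinearMap.id g ∘ₗ K.act LinearMap.id f = K.act LinearMap.id (E.conv f g) := by
  rw [K.act_comp _ _ hf.act_colinear, LinearMap.id_comp, K.act_act E]

theorem act_one_apply (f : ΩH →ₗ[k] ΩA) : K.act LinearMap.id f 1 = f 1 := by
  have h : K.coactLin 1 = 1 ⊗ₜ 1 := map_one K.coact
  rw [act_apply, h]
  simp

theorem IsGradedGauge.isGradedVertical {f : ΩH →ₗ[k] ΩA} (hf : K.IsGradedGauge E f) :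
    K.IsGradedVertical (K.verticalOfGauge f) where
  degree_zero n ω hω := by
    refine K.apply_coactLin_mem (LinearMap.mul' k ΩA ∘ₗ TensorProduct.map LinearMap.id f) (grA n)
      ?_ hω
    rintro i j rfl a ha b hb
    exact SetLike.mul_mem_graded ha (hf.degree_zero j b hb)
  left_linear b hb ω := by
    rw [verticalOfGauge_eq_act, act_apply, act_apply, mul_coactLin_of_mem K hb]
    generalize K.coactLin ω = t
    induction t using TensorProduct.induction_on with
    | zero => simp
    | add x y hx hy => simp only [map_add, mul_add, hx, hy]
    | tmul x q => simp [mul_assoc]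
  bijective := by
    obtain ⟨g, hg, h1, h2⟩ := hf.exists_inverse
    have h3 := K.act_comp_act (g := g) hf.isConvColinear
    have h4 := K.act_comp_act (g := f) hg.isConvColinear
    rw [h1, act_convOne] at h3
    rw [h2, act_convOne] at h4
    exact Function.bijective_iff_has_inverse.2
      ⟨K.act LinearMap.id g, LinearMap.congr_fun h3, LinearMap.congr_fun h4⟩
  unital := (act_one_apply f).trans hf.unital
  colinear := hf.isConvColinear.act_colinear

/-! ### From vertical automorphisms to gauge transformations -/

variable (hχ : Function.Bijective K.gradedGalois)

/-- The map `x Δ(y) ↦ x F(y)`. -/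
def extendVertical (F : K.GradedVertical) : grA ᵍ⊗[k] grH →ₗ[k] ΩA :=
  BalancedTensor.mulMap K.basicForms F.1 F.2.left_linear ∘ₗ
    (LinearEquiv.ofBijective K.gradedGalois hχ).symm.toLinearMap

theorem extendVertical_of_gradedCan (F : K.GradedVertical) (t : ΩA ⊗[k] ΩA) :
    extendVertical hχ F (of k grA grH (K.gradedCan t)) =
      LinearMap.mul' k ΩA (TensorProduct.map LinearMap.id F.1 t) := by
  have h : (LinearEquiv.ofBijective K.gradedGalois hχ).symm (of k grA grH (K.gradedCan t)) =
      Submodule.Quotient.mk t :=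
    (LinearEquiv.ofBijective K.gradedGalois hχ).symm_apply_eq.2 (K.gradedGalois_mk t).symm
  rw [extendVertical, LinearMap.comp_apply, LinearEquiv.coe_coe, h]
  rfl

theorem extendVertical_mul_coact (F : K.GradedVertical) (x y : ΩA) :
    extendVertical hχ F (includeLeft grA grH x * K.coact y) = x * F.1 y := by
  rw [← of_coactLin, ← of_mulFst, ← gradedCan_tmul, extendVertical_of_gradedCan]
  rfl

/-- The map xΔ(y) ↦ xF(y) is left Ω(A)-linear, hence determined by its values on 1 ⊗ q, which are
those of the candidate gauge transformation. -/
theorem extendVertical_of (hδ : δ.IsQuantumPrincipalBundle) (F : K.GradedVertical)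
    (t : ΩA ⊗[k] ΩH) : extendVertical hχ F (of k grA grH t) =
      LinearMap.mul' k ΩA (TensorProduct.map LinearMap.id (K.gaugeOfVertical hχ F) t) := by
  induction t using TensorProduct.induction_on with
  | zero => simp
  | add x y hx hy => simp only [map_add, hx, hy]
  | tmul x q =>
    obtain ⟨u, hu⟩ := K.gradedCan_surjective hδ (1 ⊗ₜ q)
    have h1 : K.gaugeOfVertical hχ F q =
        LinearMap.mul' k ΩA (TensorProduct.map LinearMap.id F.1 u) := by
      rw [← extendVertical_of_gradedCan hχ, hu]
      rfl
    have h2 : x ⊗ₜ q = K.gradedCan (mulFst k ΩA x u) := by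
      rw [gradedCan_mulFst, hu, mulFst_tmul, mul_one]
    rw [TensorProduct.map_tmul, LinearMap.mul'_apply, h1, h2, extendVertical_of_gradedCan]
    clear h1 h2 hu
    induction u using TensorProduct.induction_on with
    | zero => simp
    | add x y hx hy => simp only [map_add, mul_add, hx, hy]
    | tmul y z => simp [mul_assoc]

theorem act_gaugeOfVertical (hδ : δ.IsQuantumPrincipalBundle) (F : K.GradedVertical) :
    K.act LinearMap.id (K.gaugeOfVertical hχ F) = F.1 := by
  ext x
  rw [act_apply, ← extendVertical_of hχ hδ, of_coactLin]
  have h := extendVertical_mul_coact hχ F 1 x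
  rwa [map_one, one_mul, one_mul] at h

theorem act_id_injective (hδ : δ.IsQuantumPrincipalBundle) {f g : ΩH →ₗ[k] ΩA}
    (h : K.act LinearMap.id f = K.act LinearMap.id g) : f = g :=
  K.act_injective hδ (AlgHom.id k ΩA) h

theorem gaugeOfVertical_degree (hδ : δ.IsQuantumPrincipalBundle) (F : K.GradedVertical) (n : ℕ)
    (q : ΩH) (hq : q ∈ grH n) : K.gaugeOfVertical hχ F q ∈ grA n := by
  have h : K.galoisSpan n ≤ (grA n).comap (extendVertical hχ F) := by
    refine galoisSpan_induction ?_
    rintro i j rfl x hx y hy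
    rw [Submodule.mem_comap, extendVertical_mul_coact]
    exact SetLike.mul_mem_graded hx (F.2.degree_zero j y hy)
  exact h (includeRight_mem_galoisSpan hδ hq)

/-- By faithfulness of the action the condition may be tested after acting on i_L, where it becomes
the colinearity of F. -/
theorem gaugeOfVertical_isConvColinear (hδ : δ.IsQuantumPrincipalBundle) (F : K.GradedVertical) :
    K.IsConvColinear E (K.gaugeOfVertical hχ F) := by
  refine K.act_injective hδ (includeLeft grA grH) ?_
  have h2 := K.algHom_comp_act (includeLeft grA grH) LinearMap.id (K.gaugeOfVertical hχ F)
  rw [LinearMap.comp_id] at h2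
  rw [← coact_comp_act, ← K.act_act E, ← h2, act_gaugeOfVertical hχ hδ, act_includeLeft]
  exact congrArg ((of k grA grH).toLinearMap ∘ₗ ·) F.2.colinear

/-- Supplies the convolution inverse: it comes from the inverse automorphism, again by faithfulness
of the action. -/
theorem gaugeOfVertical_conv (hδ : δ.IsQuantumPrincipalBundle) (F G : K.GradedVertical)
    (h : G.1 ∘ₗ F.1 = LinearMap.id) :
    E.conv (K.gaugeOfVertical hχ F) (K.gaugeOfVertical hχ G) = E.convOne := by
  refine act_id_injective (K := K) hδ ?_
  rw [← act_comp_act (gaugeOfVertical_isConvColinear hχ hδ F), act_gaugeOfVertical hχ hδ,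
    act_gaugeOfVertical hχ hδ, act_convOne, h]

theorem gaugeOfVertical_isGradedGauge (hδ : δ.IsQuantumPrincipalBundle) (F : K.GradedVertical) :
    K.IsGradedGauge E (K.gaugeOfVertical hχ F) where
  degree_zero := gaugeOfVertical_degree hχ hδ F
  conv_invertible := by
    obtain ⟨G, hG, h1, h2⟩ := F.2.exists_inverse
    exact ⟨K.gaugeOfVertical hχ ⟨G, hG⟩, gaugeOfVertical_degree hχ hδ _,
      gaugeOfVertical_conv hχ hδ F ⟨G, hG⟩ h2, gaugeOfVertical_conv hχ hδ ⟨G, hG⟩ F h1⟩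
  unital := by
    rw [← act_one_apply (K := K), act_gaugeOfVertical hχ hδ, F.2.unital]
  colinear := (K.colinear_iff E (gaugeOfVertical_degree hχ hδ F)).2
    (gaugeOfVertical_isConvColinear hχ hδ F)

/-- Gauge transformations are vertical automorphisms. -/
def gaugeEquiv (E : CH.HopfExtension) (hδ : δ.IsQuantumPrincipalBundle) :
    K.GradedGauge E ≃* K.GradedVertical where
  toFun f := ⟨K.verticalOfGauge f.1, f.2.isGradedVertical⟩
  invFun F := ⟨K.gaugeOfVertical hχ F, gaugeOfVertical_isGradedGauge hχ hδ F⟩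
  left_inv _ := Subtype.ext (act_id_injective (K := K) hδ (act_gaugeOfVertical hχ hδ _))
  right_inv F := Subtype.ext (act_gaugeOfVertical hχ hδ F)
  map_mul' f _ := Subtype.ext (act_comp_act f.2.isConvColinear).symm

end CompleteCalculus

end

theorem mainTheorem2 {k H A ΩH ΩA : Type*} [Field k] [Ring H] [HopfAlgebra k H]
    [Ring A] [Algebra k A]
    [Ring ΩH] [Algebra k ΩH] {grH : ℕ → Submodule k ΩH} [GradedAlgebra grH]
    [Ring ΩA] [Algebra k ΩA] {grA : ℕ → Submodule k ΩA} [GradedAlgebra grA]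
    (hS : Function.Bijective (HopfAlgebra.antipode k : H →ₗ[k] H))
    (CH : DifferentialCalculus k H grH) (hbicov : CH.IsBicovariant)
    (hmax : CH.IsMaximalProlongation)
    (δ : RightComoduleAlgebra k H A) (hδ : δ.IsQuantumPrincipalBundle)
    (CA : DifferentialCalculus k A grA) (K : CompleteCalculus δ CH CA) :
    Nonempty CH.HopfExtension ∧
    ∀ E : CH.HopfExtension,
      ∃ hχ : Function.Bijective K.gradedGalois,
      ∃ (_ : Group (K.GradedGauge E)) (_ : Group K.GradedVertical),
        (∀ f g : K.GradedGauge E, (f * g).1 = E.conv f.1 g.1) ∧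
        (1 : K.GradedGauge E).1 = E.convOne ∧
        (∀ F G : K.GradedVertical, (F * G).1 = G.1 ∘ₗ F.1) ∧
        (1 : K.GradedVertical).1 = LinearMap.id ∧
        ∃ θ : K.GradedGauge E ≃* K.GradedVertical,
          (∀ f : K.GradedGauge E, (θ f).1 = K.verticalOfGauge f.1) ∧
          (∀ F : K.GradedVertical, (θ.symm F).1 = K.gaugeOfVertical hχ F) := by
  refine ⟨CH.nonempty_hopfExtension hbicov hmax, fun E => ?_⟩
  have hχ := K.gradedGalois_bijective hδ hS E.toComplete
  exact ⟨hχ, inferInstance, inferInstance, fun _ _ => rfl, rfl, fun _ _ => rfl, rfl,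
    CompleteCalculus.gaugeEquiv hχ E hδ, fun _ => rfl, fun _ => rfl⟩
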